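/- **Setting.** Let $\hat f(k)=\frac1{\sqrt{2\pi}}\int e^{-ikx}f(x)\,dx$, and let $$\phi(x)=\frac1{\sqrt{2\pi}}\int_0^\infty\frac{dk}{2k}\,\bigl[a(k)e^{-ikx}+a^\dagger(k)e^{ikx}\bigr],\qquad [a(k),a^\dagger(k')]=2k\,\delta(k-k'),$$ be the real massless right-moving (incoming) scalar field on the bosonic Fock space over $L^2(\mathbb R_+,\frac{dk}{2k})$, with vacuum $\Omega_o$. Let $x:\mathbb R\to\mathbb R$, $y\mapsto x(y)$, be a smooth transformation of coordinates with $x'>0$. The outgoing field is $\check\phi(y)=\phi(x(y))$, i.e. $\check\phi[f]=\int f(y)\,\phi(x(y))\,dy$. Let $g$ be a Schwartz function with $\hat g(k)=0$ for $k<0$ and $\int_0^\infty\frac{dk}{2k}|\hat g(k)|^2=1$, and let $\Omega_g=\phi[g]^\dagger\Omega_o$ be the corresponding one-particle state. For a state $\Psi\in\{\Omega_o,\Omega_g\}$ the energy-momentum tensor is defined in either of the following ways. (N) *Normal ordering.* The incoming tensor is $(\Psi,:(\partial_x\phi(x))^2:_{in}\Psi)$ and the outgoing one is $(\Psi,:(\partial_y\check\phi(y))^2:_{out}\Psi)$.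 Here $:\ :_{in}$ and $:\ :_{out}$ put the negative-momentum (creation) parts of the field to the left of the positive-momentum (annihilation) parts, the parts being those of the Fourier decomposition in the variable $x$, respectively $y$. The value at $y$ is the value at the coinciding points $(y,y)$ of the continuous kernel of the bidistribution $(\Psi,:\partial\check\phi(y)\,\partial\check\phi(y'):_{out}\Psi)$, and likewise for the incoming tensor. In this case assume in addition that $x''/x'$ is bounded, as it is for $x(y)=-e^{-y}$ (relativistic black hole) and for $x(y)=-\log(1+e^{-y})$ (CGHS black hole). (S) *Subtraction.* With $\Theta_\varepsilon(x)=\frac12[\partial\phi(x)\partial\phi(x+\varepsilon)+\partial\phi(x+\varepsilon)\partial\phi(x)]$ and $\hat\Theta_\varepsilon(y)=\frac12[\partial\check\phi(y)\partial\check\phi(y+\varepsilon)+\partial\check\phi(y+\varepsilon)\partial\check\phi(y)]$, the incoming tensor is $\lim_{\varepsilon\to0}[(\Psi,\Theta_\varepsilon(x)\Psi)-(\Omega_o,\Theta_\varepsilon(x)\Omega_o)]$ and the outgoing one is $\lim_{\varepsilon\to0}[(\Psi,\hat\Theta_\varepsilon(y)\Psi)-(\Omega_o,\Theta_\varepsilon(x(y))\Omega_o)]$,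 where mean values at distinct points are those of the continuous kernels there. **Theorem.** In each of the schemes (N) and (S), the incoming tensor $T_g$ in the state $\Omega_g$ and the outgoing tensors $\hat T_o$ and $\hat T_g$ in the states $\Omega_o$ and $\Omega_g$ are well defined, and for all $x,y\in\mathbb R$ $$T_g(x)=\tfrac12|g(x)|^2,\qquad \hat T_g(y)=\hat T_o(y)+x'(y)^2\,T_g(x(y)),$$ where $$\hat T_o(y)=-\frac1{24\pi}\left[\frac{x'''(y)}{x'(y)}-\frac32\left(\frac{x''(y)}{x'(y)}\right)^2\right].$$ -/

import Mathlib

open MeasureTheory Set Filter Topology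
open scoped ContDiff SchwartzMap ComplexConjugate

noncomputable section

namespace ScalarField

/-! ### Fock space over `L²(dk/2k, ℝ₊)` -/

/-- The measure `dk / 2k` on the half-line of positive momenta. -/
def momentumMeasure : Measure ℝ :=
  (volume.restrict (Ioi 0)).withDensity (fun k => ENNReal.ofReal (1 / (2 * k)))

/-- A Fock vector in the momentum representation: the sequence of its `n`-particle wave functions
`ψ n (k₁, …, kₙ)`. -/
abbrev FockVector : Type := (n : ℕ) → (Fin n → ℝ) → ℂ

/-- The scalar product of Fock space, antilinear in the first argument:
`(ψ, χ) = ∑ₙ ∫ ∏ᵢ dkᵢ/2kᵢ  ψₙ(k₁, …, kₙ)^* χₙ(k₁, …, kₙ)`. -/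
def fockInner (ψ χ : FockVector) : ℂ :=
  ∑' n : ℕ, ∫ k : Fin n → ℝ, conj (ψ n k) * χ n k ∂(Measure.pi fun _ => momentumMeasure)

/-- The vacuum. -/
def vacuum : FockVector
  | 0 => fun _ => 1
  | _ + 1 => fun _ => 0

/-- The creation operator `∫ dk/2k u(k) a†(k)`, where `[a(k), a†(k')] = 2k δ(k - k')`. -/
def creation (u : ℝ → ℂ) (ψ : FockVector) : FockVector
  | 0 => fun _ => 0
  | n + 1 => fun k =>
      (((Real.sqrt (n + 1))⁻¹ : ℝ) : ℂ) * ∑ i : Fin (n + 1), u (k i) * ψ n (fun j => k (i.succAbove j))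

/-- The annihilation operator `∫ dk/2k u(k) a(k)` (linear in `u`). -/
def annihilation (u : ℝ → ℂ) (ψ : FockVector) : FockVector := fun n k =>
  ((Real.sqrt (n + 1) : ℝ) : ℂ) *
    ∫ q : ℝ, u q * ψ (n + 1) (Fin.cons q k : Fin (n + 1) → ℝ) ∂momentumMeasure

/-! ### The real massless right-moving field

The incoming field is `φ(x) = (2π)^{-1/2} ∫₀^∞ dk/2k [a(k) e^{-ikx} + a†(k) e^{ikx}]`.  Under a
transformation of coordinates `x = x(y)` the outgoing field is `φ̌(y) = φ(x(y))`.  The incoming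
field itself is the case `x = id`. -/

/-- `(2π)^{-1/2} ∫ dy e^{-ikx(y)} f(y)`: the Fourier transform of the incoming test function
associated with the outgoing test function `f`, i.e. of the density `f(y) dy` transported by
`x`. For `x = id` this is the Fourier transform of `f`. -/
def inHat (x : ℝ → ℝ) (f : ℝ → ℂ) (k : ℝ) : ℂ :=
  (((Real.sqrt (2 * Real.pi))⁻¹ : ℝ) : ℂ) *
    ∫ y : ℝ, Complex.exp (-(Complex.I * (k : ℂ) * (x y : ℂ))) * f y

/-- The Fourier transform `f̂(k) = (2π)^{-1/2} ∫ dx e^{-ikx} f(x)`. -/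
def hat (f : ℝ → ℂ) : ℝ → ℂ := inHat id f

/-- The smeared field `φ̌[f] = ∫ dy f(y) φ(x(y))` makes sense as an operator: `f` is integrable
and the one-particle wave functions it creates and annihilates belong to `L²(dk/2k, ℝ₊)`. -/
def FieldDefined (x : ℝ → ℝ) (f : ℝ → ℂ) : Prop :=
  Integrable f ∧ MemLp (fun k => inHat x f k) 2 momentumMeasure ∧
    MemLp (fun k => inHat x f (-k)) 2 momentumMeasure

/-- The smeared field `φ̌[f] = ∫ dy f(y) φ(x(y))`, acting in the incoming Fock space. -/
def field (x : ℝ → ℝ) (f : ℝ → ℂ) (ψ : FockVector) : FockVector :=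
  annihilation (fun k => inHat x f k) ψ + creation (fun k => inHat x f (-k)) ψ

/-- The adjoint `φ̌[f]†`. -/
def fieldAdj (x : ℝ → ℝ) (f : ℝ → ℂ) (ψ : FockVector) : FockVector :=
  creation (fun k => conj (inHat x f k)) ψ + annihilation (fun k => conj (inHat x f (-k))) ψ

/-- The smeared derivative of the field, `∫ dy f(y) ∂_y φ̌(y) = - φ̌[f']`. -/
def dField (x : ℝ → ℝ) (f : ℝ → ℂ) (ψ : FockVector) : FockVector :=
  - field x (deriv f) ψ

/-- The incoming one-particle state `Ω_g = φ[g]† Ω_o`. -/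
def oneParticle (g : ℝ → ℂ) : FockVector := fieldAdj id g vacuum

/-- `g` is a normalized test function with `ĝ ∈ 𝓢(ℝ₊)`: `g` is a Schwartz function, `ĝ` vanishes
for negative momenta, and `ĝ` has norm one in `L²(dk/2k, ℝ₊)`. -/
def IsNormalizedTest (g : 𝓢(ℝ, ℂ)) : Prop :=
  (∀ k < 0, hat g k = 0) ∧ ∫ k, ‖hat g k‖ ^ 2 ∂momentumMeasure = 1

/-! ### Normal ordering -/

/-- The part of `f` with positive momenta. -/
def posPart (f : ℝ → ℂ) (y : ℝ) : ℂ :=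
  (((Real.sqrt (2 * Real.pi))⁻¹ : ℝ) : ℂ) *
    ∫ p in Ioi (0 : ℝ), Complex.exp (Complex.I * (p : ℂ) * (y : ℂ)) * hat f p

/-- The part of `f` with negative momenta. -/
def negPart (f : ℝ → ℂ) (y : ℝ) : ℂ :=
  (((Real.sqrt (2 * Real.pi))⁻¹ : ℝ) : ℂ) *
    ∫ p in Iio (0 : ℝ), Complex.exp (Complex.I * (p : ℂ) * (y : ℂ)) * hat f p

/-- The annihilation part of `∫ dy f(y) ∂_y φ̌(y)` with respect to the momentum `p` conjugate to
`y`, i.e. its component in the operators `a_out(p)` of the expansion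
`φ̌(y) = (2π)^{-1/2} ∫₀^∞ dp/2p [a_out(p) e^{-ipy} + a_out†(p) e^{ipy}]`. -/
def dFieldAnn (x : ℝ → ℝ) (f : ℝ → ℂ) (ψ : FockVector) : FockVector :=
  - field x (posPart (deriv f)) ψ

/-- The creation part of `∫ dy f(y) ∂_y φ̌(y)`: its component in the operators `a_out†(p)`. -/
def dFieldCre (x : ℝ → ℝ) (f : ℝ → ℂ) (ψ : FockVector) : FockVector :=
  - field x (negPart (deriv f)) ψ

/-- The normal-ordered product of `∫ f₁ ∂φ̌` and `∫ f₂ ∂φ̌`: all `a_out†` stand to the left of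
all `a_out`. -/
def normalProduct (x : ℝ → ℝ) (f₁ f₂ : ℝ → ℂ) (ψ : FockVector) : FockVector :=
  dFieldAnn x f₁ (dFieldAnn x f₂ ψ) + dFieldCre x f₁ (dFieldAnn x f₂ ψ)
    + dFieldCre x f₂ (dFieldAnn x f₁ ψ) + dFieldCre x f₁ (dFieldCre x f₂ ψ)

/-- The symmetrized product `½ (∫ f₁ ∂φ̌ ∫ f₂ ∂φ̌ + ∫ f₂ ∂φ̌ ∫ f₁ ∂φ̌)`. -/
def symProduct (x : ℝ → ℝ) (f₁ f₂ : ℝ → ℂ) (ψ : FockVector) : FockVector :=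
  (1 / 2 : ℂ) • (dField x f₁ (dField x f₂ ψ) + dField x f₂ (dField x f₁ ψ))

/-! ### Kernels and the energy-momentum tensor -/

/-- Smooth compactly supported functions. -/
def IsTest (f : ℝ → ℂ) : Prop := ContDiff ℝ ∞ f ∧ HasCompactSupport f

/-- On the open set `O` of pairs of points, the bidistribution `B` is given by the continuous
kernel `K`. -/
def HasKernelOn (O : Set (ℝ × ℝ)) (B : (ℝ → ℂ) → (ℝ → ℂ) → ℂ) (K : ℝ × ℝ → ℂ) : Prop :=
  ContinuousOn K O ∧
    ∀ f₁ f₂ : ℝ → ℂ, IsTest f₁ → IsTest f₂ → tsupport f₁ ×ˢ tsupport f₂ ⊆ O →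
      B f₁ f₂ = ∫ p : ℝ × ℝ, K p * (f₁ p.1 * f₂ p.2)

/-- Pairs of distinct points. -/
def offDiag : Set (ℝ × ℝ) := {p | p.1 ≠ p.2}

/-- `T(y) = (Ψ, :Θ(y): Ψ)`, where `Θ = ∂φ̌† ∂φ̌` is normal ordered in the coordinate `y`: the mean
value of the normal-ordered product at two points is a continuous kernel on the plane, and `T` is
its restriction to coinciding points.  For `x = id` this is the incoming
normal-ordered tensor. -/
def IsNormalTensor (x : ℝ → ℝ) (Ψ : FockVector) (T : ℝ → ℝ) : Prop :=
  (∀ f, IsTest f →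
    FieldDefined x (posPart (deriv f)) ∧ FieldDefined x (negPart (deriv f))) ∧
  ∃ K : ℝ × ℝ → ℂ,
    HasKernelOn univ (fun f₁ f₂ => fockInner Ψ (normalProduct x f₁ f₂ Ψ)) K ∧
    ∀ y, (T y : ℂ) = K (y, y)

/-- `T(y) = lim_{ε → 0} [(Ψ, Θ̂_ε(y) Ψ) - (Ω_o, Θ_ε(x(y)) Ω_o)]`, where
`Θ̂_ε(y) = ½ [∂φ̌(y) ∂φ̌(y+ε) + ∂φ̌(y+ε) ∂φ̌(y)]` and `Θ_ε` is the same expression for the incoming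
field; the mean values are those of kernels at pairs of distinct points.  For `x = id` this is
the incoming tensor regularized by subtraction. -/
def IsSubtractedTensor (x : ℝ → ℝ) (Ψ : FockVector) (T : ℝ → ℝ) : Prop :=
  (∀ f, IsTest f → FieldDefined x (deriv f) ∧ FieldDefined id (deriv f)) ∧
  ∃ K K₀ : ℝ × ℝ → ℂ,
    HasKernelOn offDiag (fun f₁ f₂ => fockInner Ψ (symProduct x f₁ f₂ Ψ)) K ∧
    HasKernelOn offDiag (fun f₁ f₂ => fockInner vacuum (symProduct id f₁ f₂ vacuum)) K₀ ∧
    ∀ y, Tendsto (fun ε : ℝ => K (y, y + ε) - K₀ (x y, x y + ε)) (𝓝[≠] 0) (𝓝 (T y : ℂ))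

/-- The Schwarzian derivative `x'''/x' - (3/2) (x''/x')²`. -/
def schwarzian (x : ℝ → ℝ) (y : ℝ) : ℝ :=
  iteratedDeriv 3 x y / deriv x y - 3 / 2 * (iteratedDeriv 2 x y / deriv x y) ^ 2

end ScalarField

end

open ScalarField

/-! Wick's theorem reduces everything to the vacuum two-point function of the derivative field. Seen
in the coordinate y, its kernel at points y, z is -(1/4π) ∂_y ∂_z log(x(y) - x(z)), with an iε
prescription at y = z. The same expression with x = id is the two-point function of the vacuum
belonging to y itself. The difference of the two is -(1/4π) ∂_y ∂_z log Q, where Q(y,z) = (x(y) -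
x(z))/(y - z) extends to a smooth positive function across the diagonal. There Q = x', both first
derivatives are x''/2 and the mixed derivative is x'''/6, so ∂_y ∂_z log Q is one sixth of the
Schwarzian. This is the vacuum term (`exists_regular_kernel`).

A particle in the state g adds only products of an emission and an absorption amplitude. The
derivative on the field cancels the weight dk/2k, and Fourier inversion turns the amplitudes into
integrals against x' g(x) and its conjugate (`emit_deriv`, `absorb_deriv`). The resulting kernel is
continuous and equals x'² |g(x)|²/2 on the diagonal.

Subtraction: off the diagonal the singular part of the outgoing kernel is -1/(4π(y - z)²), a
function of the separation alone. It is cancelled exactly by the incoming vacuum kernel at x(y),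
x(y) + ε, and the regular kernels remain.

Normal ordering: reordering replaces the product f₁⁺f₂⁻ of a positive-momentum and a
negative-momentum part by f₂⁻f₁⁺, which costs a commutator. Since log Q is symmetric, the commutator
is the same in the coordinates x and y, and in y it equals the two-point function of the vacuum of y
(`BoundedAcceleration.twoPt_normal`). The difficulty is analytic: f₁⁺ and f₂⁻ are not test
functions, and their derivatives decay only like 1/y², while x' or 1/x' may grow exponentially.
Boundedness of x''/x' still gives Fourier transforms of size 1/(1 + |log k|), which is square
integrable for dk/2k (`exists_logDecay_inHat`). The bound is uniform enough to extend the commutator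
identity from test functions by cutoffs (`BoundedAcceleration.commutator_eq`).

Continuous kernels are determined by their bidistributions, which gives uniqueness of each tensor.
-/

namespace ScalarField

/-! ### Kernels of bidistributions -/

theorem IsTest.continuous {f : ℝ → ℂ} (hf : IsTest f) : Continuous f := hf.1.continuous

theorem IsTest.integrable {f : ℝ → ℂ} (hf : IsTest f) : Integrable f :=
  hf.continuous.integrable_of_hasCompactSupport hf.2

theorem IsTest.hasDerivAt {f : ℝ → ℂ} (hf : IsTest f) (y : ℝ) : HasDerivAt f (deriv f y) y :=
  ((hf.1.differentiable (by simp)) y).hasDerivAt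

theorem IsTest.deriv {f : ℝ → ℂ} (hf : IsTest f) : IsTest (deriv f) :=
  ⟨(contDiff_infty_iff_deriv.1 hf.1).2, hf.2.deriv⟩

/-- Only the values of `K` on a compact rectangle inside `O` matter, so kernels singular on the
diagonal are admitted. -/
theorem integrable_kernel_mul {O : Set (ℝ × ℝ)} {K : ℝ × ℝ → ℂ} (hK : ContinuousOn K O)
    {f₁ f₂ : ℝ → ℂ} (hf₁ : Continuous f₁) (hf₂ : Continuous f₂) (hc₁ : HasCompactSupport f₁)
    (hc₂ : HasCompactSupport f₂) (hO : tsupport f₁ ×ˢ tsupport f₂ ⊆ O) :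
    Integrable (fun p : ℝ × ℝ => K p * (f₁ p.1 * f₂ p.2)) := by
  have hcpt : IsCompact (tsupport f₁ ×ˢ tsupport f₂) := hc₁.isCompact.prod hc₂.isCompact
  rw [← integrableOn_iff_integrable_of_support_subset (s := tsupport f₁ ×ˢ tsupport f₂)]
  · refine ContinuousOn.integrableOn_compact hcpt ?_
    exact (hK.mono hO).mul (by fun_prop)
  · intro p hp
    have h1 : f₁ p.1 ≠ 0 := fun h => hp (by simp [h])
    have h2 : f₂ p.2 ≠ 0 := fun h => hp (by simp [h])
    exact ⟨subset_tsupport _ h1, subset_tsupport _ h2⟩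

/-- Testing `K - K'` with a product of bumps around `p` gives zero, while continuity keeps `K - K'`
within `ε` of its value at `p` on their support. This is the uniqueness half of the final
equivalences. -/
theorem HasKernelOn.eqOn {O : Set (ℝ × ℝ)} (hO : IsOpen O) {B : (ℝ → ℂ) → (ℝ → ℂ) → ℂ}
    {K K' : ℝ × ℝ → ℂ} (h : HasKernelOn O B K) (h' : HasKernelOn O B K') : EqOn K K' O := by
  intro p hp
  rw [← sub_eq_zero, ← norm_le_zero_iff]
  refine le_of_forall_pos_le_add fun ε hε => ?_
  have hcont : ContinuousAt (fun q => K q - K' q) p :=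
    (h.1.continuousAt (hO.mem_nhds hp)).sub (h'.1.continuousAt (hO.mem_nhds hp))
  obtain ⟨r, hr, hball⟩ := Metric.nhds_basis_closedBall.mem_iff.1
    (Filter.inter_mem (hO.mem_nhds hp) (hcont (Metric.closedBall_mem_nhds _ hε)))
  let b₁ : ContDiffBump p.1 := ⟨r / 2, r, by positivity, by linarith⟩
  let b₂ : ContDiffBump p.2 := ⟨r / 2, r, by positivity, by linarith⟩
  let f₁ : ℝ → ℂ := fun y => (b₁ y : ℂ)
  let f₂ : ℝ → ℂ := fun y => (b₂ y : ℂ)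
  have ht : ∀ (c : ℝ) (b : ContDiffBump c), IsTest (fun y => (b y : ℂ)) := fun c b =>
    ⟨Complex.ofRealCLM.contDiff.comp b.contDiff,
      b.hasCompactSupport.comp_left (g := fun t : ℝ => (t : ℂ)) (by simp)⟩
  have hts : ∀ (c : ℝ) (b : ContDiffBump c),
      tsupport (fun y => (b y : ℂ)) ⊆ Metric.closedBall c b.rOut := fun c b => by
    rw [← b.tsupport_eq]
    exact closure_mono fun y hy hy' => hy (by simp [hy'])
  -- The metric on the plane is the sup metric, so a product of closed balls of radius `r` is again
  -- a closed ball.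
  have hsub : tsupport f₁ ×ˢ tsupport f₂ ⊆ Metric.closedBall p r := by
    have := Set.prod_mono (hts _ b₁) (hts _ b₂)
    rwa [closedBall_prod_same] at this
  have hsubO := hsub.trans (hball.trans inter_subset_left)
  have e := h.2 f₁ f₂ (ht _ b₁) (ht _ b₂) hsubO
  have e' := h'.2 f₁ f₂ (ht _ b₁) (ht _ b₂) hsubO
  have i := integrable_kernel_mul h.1 (ht _ b₁).continuous (ht _ b₂).continuous (ht _ b₁).2
    (ht _ b₂).2 hsubO
  have i' := integrable_kernel_mul h'.1 (ht _ b₁).continuous (ht _ b₂).continuous (ht _ b₁).2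
    (ht _ b₂).2 hsubO
  have i1 := integrable_kernel_mul (K := fun _ => K p - K' p) (O := univ) continuousOn_const
    (ht _ b₁).continuous (ht _ b₂).continuous (ht _ b₁).2 (ht _ b₂).2 (subset_univ _)
  have hzero : ∫ q : ℝ × ℝ, (K q - K' q) * (f₁ q.1 * f₂ q.2) = 0 := by
    simp_rw [sub_mul]
    rw [integral_sub i i', ← e, ← e', sub_self]
  have hint : Integrable (fun q : ℝ × ℝ => b₁ q.1 * b₂ q.2) := b₁.integrable.mul_prod b₂.integrable
  have hpos : 0 < ∫ q : ℝ × ℝ, b₁ q.1 * b₂ q.2 := by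
    rw [MeasureTheory.Measure.volume_eq_prod, integral_prod_mul (fun y => b₁ y) (fun y => b₂ y)]
    exact mul_pos b₁.integral_pos b₂.integral_pos
  have hval : (K p - K' p) * ((∫ q : ℝ × ℝ, b₁ q.1 * b₂ q.2 : ℝ) : ℂ)
      = ∫ q : ℝ × ℝ, ((K p - K' p) - (K q - K' q)) * (f₁ q.1 * f₂ q.2) := by
    have : ∫ q : ℝ × ℝ, ((K p - K' p) - (K q - K' q)) * (f₁ q.1 * f₂ q.2)
        = (∫ q : ℝ × ℝ, (K p - K' p) * (f₁ q.1 * f₂ q.2))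
          - ∫ q : ℝ × ℝ, (K q - K' q) * (f₁ q.1 * f₂ q.2) := by
      rw [← integral_sub i1 ((i.sub i').congr (ae_of_all _ fun q => (sub_mul _ _ _).symm))]
      refine integral_congr_ae (ae_of_all _ fun q => ?_)
      simp only [f₁, f₂]
      ring
    rw [this, hzero, sub_zero, integral_const_mul, ← integral_complex_ofReal]
    congr 2
    ext q
    simp [f₁, f₂]
  have hle : ‖K p - K' p‖ * ∫ q : ℝ × ℝ, b₁ q.1 * b₂ q.2
      ≤ ε * ∫ q : ℝ × ℝ, b₁ q.1 * b₂ q.2 := by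
    calc ‖K p - K' p‖ * ∫ q : ℝ × ℝ, b₁ q.1 * b₂ q.2
        = ‖(K p - K' p) * ((∫ q : ℝ × ℝ, b₁ q.1 * b₂ q.2 : ℝ) : ℂ)‖ := by
          rw [norm_mul, Complex.norm_real, Real.norm_of_nonneg hpos.le]
      _ ≤ ∫ q : ℝ × ℝ, ε * (b₁ q.1 * b₂ q.2) := by
          rw [hval]
          refine norm_integral_le_of_norm_le (hint.const_mul ε) (ae_of_all _ fun q => ?_)
          have hn : ‖f₁ q.1 * f₂ q.2‖ = b₁ q.1 * b₂ q.2 := by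
            simp [f₁, f₂, abs_of_nonneg b₁.nonneg, abs_of_nonneg b₂.nonneg]
          rw [norm_mul, hn]
          by_cases hq : q ∈ Metric.closedBall p r
          · refine mul_le_mul_of_nonneg_right ?_ (mul_nonneg b₁.nonneg b₂.nonneg)
            have := (hball hq).2
            rw [mem_preimage, mem_closedBall_iff_norm'] at this
            exact this
          · have hz : f₁ q.1 * f₂ q.2 = 0 := by
              by_contra hne
              exact hq (hsub ⟨subset_tsupport _ (left_ne_zero_of_mul hne),
                subset_tsupport _ (right_ne_zero_of_mul hne)⟩)
            rw [← hn, hz]; simp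
      _ = _ := integral_const_mul _ _
  rw [zero_add]
  exact le_of_mul_le_mul_right hle hpos

/-! ### Mean values in the vacuum and in one-particle states -/

instance : SigmaFinite momentumMeasure := by
  unfold momentumMeasure
  exact SigmaFinite.withDensity_ofReal _

/-- The two-point function `(Ω_o, φ̌[A] φ̌[B] Ω_o)`. -/
noncomputable def twoPt (x : ℝ → ℝ) (A B : ℝ → ℂ) : ℂ :=
  ∫ k, inHat x A k * inHat x B (-k) ∂momentumMeasure

/-- The amplitude of absorbing `Ω_g` by `φ̌[A]`. -/
noncomputable def absorb (x : ℝ → ℝ) (g A : ℝ → ℂ) : ℂ :=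
  ∫ k, inHat x A k * conj (hat g k) ∂momentumMeasure

/-- The amplitude of emitting `Ω_g` by `φ̌[A]`. -/
noncomputable def emit (x : ℝ → ℝ) (g A : ℝ → ℂ) : ℂ :=
  ∫ k, hat g k * inHat x A (-k) ∂momentumMeasure

theorem field_neg (x : ℝ → ℝ) (f : ℝ → ℂ) (ψ : FockVector) :
    field x f (-ψ) = - field x f ψ := by
  unfold field
  rw [neg_add]
  congr 1
  · funext n k
    simp [annihilation, integral_neg]
  · funext n k
    cases n <;> simp [creation]

theorem fockInner_vacuum (χ : FockVector) : fockInner vacuum χ = χ 0 ![] := by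
  unfold fockInner
  rw [tsum_eq_single 0]
  · rw [Measure.pi_of_empty _ (![] : Fin 0 → ℝ), integral_dirac]
    simp [vacuum]
  · intro n hn
    obtain ⟨m, rfl⟩ := Nat.exists_eq_succ_of_ne_zero hn
    simp [vacuum]

theorem field_field_vacuum (x : ℝ → ℝ) (A B : ℝ → ℂ) :
    field x A (field x B vacuum) 0 ![] = twoPt x A B := by
  simp [field, annihilation, creation, vacuum, twoPt]

theorem oneParticle_zero (g : ℝ → ℂ) (k) : oneParticle g 0 k = 0 := by
  simp [oneParticle, fieldAdj, creation, annihilation, vacuum]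

theorem oneParticle_one (g : ℝ → ℂ) (k) : oneParticle g 1 k = conj (hat g (k 0)) := by
  simp [oneParticle, fieldAdj, creation, annihilation, vacuum, hat]

theorem oneParticle_succ_succ (g : ℝ → ℂ) (n : ℕ) (k) : oneParticle g (n + 2) k = 0 := by
  simp [oneParticle, fieldAdj, creation, annihilation, vacuum]

theorem fockInner_oneParticle (g : ℝ → ℂ) (χ : FockVector) :
    fockInner (oneParticle g) χ = ∫ k, hat g k * χ 1 (fun _ => k) ∂momentumMeasure := by
  unfold fockInner
  rw [tsum_eq_single 1]
  · have h := (measurePreserving_funUnique momentumMeasure (Fin 1)).symm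
    refine (h.integral_comp (MeasurableEquiv.measurableEmbedding _)
      (fun k => conj (oneParticle g 1 k) * χ 1 k)).symm.trans ?_
    refine integral_congr_ae (ae_of_all _ fun k => ?_)
    simp only [oneParticle_one, Complex.conj_conj]
    rfl
  · intro n hn
    match n, hn with
    | 0, _ => simp [oneParticle_zero]
    | 1, hn => exact absurd rfl hn
    | n + 2, _ => simp [oneParticle_succ_succ]

/-- Wick's theorem in the one-particle sector. If `B` creates a second particle, `A` absorbs either
that particle, which gives the two-point function, or the original one; if `B` absorbs the original
particle, `A` creates a new one from the vacuum. The factors √2 and 1/√2 of symmetrization cancel.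
-/
theorem field_field_oneParticle {x : ℝ → ℝ} {g A B : ℝ → ℂ}
    (hA : MemLp (fun k => inHat x A k) 2 momentumMeasure)
    (hB : MemLp (fun k => inHat x B (-k)) 2 momentumMeasure)
    (hg : MemLp (fun k => hat g k) 2 momentumMeasure) (k : ℝ) :
    field x A (field x B (oneParticle g)) 1 (fun _ => k)
      = twoPt x A B * conj (hat g k) + inHat x B (-k) * absorb x g A
        + inHat x A (-k) * absorb x g B := by
  have h2 : ∀ k : Fin 2 → ℝ, field x B (oneParticle g) 2 k
      = ((Real.sqrt 2)⁻¹ : ℝ) * (inHat x B (-k 0) * conj (hat g (k 1))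
          + inHat x B (-k 1) * conj (hat g (k 0))) := by
    intro k
    simp [field, annihilation, creation, oneParticle_succ_succ, oneParticle_one, Fin.sum_univ_two]
    left
    norm_num
  have h0 : ∀ k : Fin 0 → ℝ, field x B (oneParticle g) 0 k = absorb x g B := by
    intro k
    simp [field, annihilation, creation, oneParticle_one, absorb]
  have hg' : MemLp (fun k => conj (hat g k)) 2 momentumMeasure := hg.star
  have i1 : Integrable (fun q => inHat x A q * inHat x B (-q)) momentumMeasure :=
    MemLp.integrable_mul hA hB
  have i2 : Integrable (fun q => inHat x A q * conj (hat g q)) momentumMeasure :=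
    MemLp.integrable_mul hA hg'
  have key : field x A (field x B (oneParticle g)) 1 (fun _ => k)
      = ((Real.sqrt 2 : ℝ) : ℂ) * (∫ q, inHat x A q * field x B (oneParticle g) 2
          (Fin.cons q (fun _ => k) : Fin 2 → ℝ) ∂momentumMeasure)
        + inHat x A (-k) * absorb x g B := by
    conv_lhs => rw [field]
    simp only [Pi.add_apply, annihilation, creation]
    simp [h0]
    left
    norm_num
  rw [key]
  congr 1
  have : ∀ q, inHat x A q * field x B (oneParticle g) 2 (Fin.cons q (fun _ => k) : Fin 2 → ℝ)
      = ((Real.sqrt 2)⁻¹ : ℝ) * ((inHat x A q * inHat x B (-q)) * conj (hat g k)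
          + inHat x B (-k) * (inHat x A q * conj (hat g q))) := by
    intro q
    rw [h2]
    simp
    ring
  simp_rw [this]
  rw [integral_const_mul, ← mul_assoc, ← Complex.ofReal_mul, mul_inv_cancel₀ (by positivity),
    Complex.ofReal_one, one_mul, integral_add (i1.mul_const _) (i2.const_mul _),
    integral_mul_const, integral_const_mul]
  rfl

/-- The mean value of `φ̌[A] φ̌[B]` in the state `Ω_g`. -/
noncomputable def oneParticleMean (x : ℝ → ℝ) (g A B : ℝ → ℂ) : ℂ :=
  twoPt x A B + emit x g A * absorb x g B + emit x g B * absorb x g A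

/-- Pairing with `ĝ` turns the coefficient of the two-point function into the squared norm of `ĝ`,
which is one, and the other terms into emission times absorption. Integrability is kept in the
conclusion because sums of such products have to be integrated term by term. -/
theorem integrable_oneParticle_field_field {x : ℝ → ℝ} {g A B : ℝ → ℂ}
    (hA : FieldDefined x A) (hB : FieldDefined x B)
    (hg : MemLp (fun k => hat g k) 2 momentumMeasure)
    (hn : ∫ k, ‖hat g k‖ ^ 2 ∂momentumMeasure = 1) :
    Integrable (fun k => hat g k * field x A (field x B (oneParticle g)) 1 (fun _ => k))
        momentumMeasure ∧
      ∫ k, hat g k * field x A (field x B (oneParticle g)) 1 (fun _ => k) ∂momentumMeasure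
        = oneParticleMean x g A B := by
  have i0 : Integrable (fun k => hat g k * conj (hat g k)) momentumMeasure :=
    MemLp.integrable_mul hg hg.star
  have iA : Integrable (fun k => hat g k * inHat x A (-k)) momentumMeasure :=
    MemLp.integrable_mul hg hA.2.2
  have iB : Integrable (fun k => hat g k * inHat x B (-k)) momentumMeasure :=
    MemLp.integrable_mul hg hB.2.2
  have e : ∀ k, hat g k * field x A (field x B (oneParticle g)) 1 (fun _ => k)
      = hat g k * conj (hat g k) * twoPt x A B + hat g k * inHat x B (-k) * absorb x g A
        + hat g k * inHat x A (-k) * absorb x g B := by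
    intro k
    rw [field_field_oneParticle hA.2.1 hB.2.2 hg]
    ring
  have e0 : ∫ k, hat g k * conj (hat g k) ∂momentumMeasure = 1 := by
    have : ∀ k, hat g k * conj (hat g k) = ((‖hat g k‖ ^ 2 : ℝ) : ℂ) := fun k => by
      rw [Complex.mul_conj, Complex.normSq_eq_norm_sq]
    simp_rw [this]
    rw [integral_complex_ofReal, hn, Complex.ofReal_one]
  simp_rw [e]
  have i01 := (i0.mul_const (twoPt x A B)).fun_add (iB.mul_const (absorb x g A))
  refine ⟨i01.add (iA.mul_const _), ?_⟩
  rw [integral_add i01 (iA.mul_const _), integral_add (i0.mul_const _) (iB.mul_const _),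
    integral_mul_const, integral_mul_const, integral_mul_const, e0, oneParticleMean]
  unfold emit
  ring

theorem normalProduct_eq (x : ℝ → ℝ) (f₁ f₂ : ℝ → ℂ) (ψ : FockVector) :
    normalProduct x f₁ f₂ ψ
      = field x (posPart (deriv f₁)) (field x (posPart (deriv f₂)) ψ)
        + field x (negPart (deriv f₁)) (field x (posPart (deriv f₂)) ψ)
        + field x (negPart (deriv f₂)) (field x (posPart (deriv f₁)) ψ)
        + field x (negPart (deriv f₁)) (field x (negPart (deriv f₂)) ψ) := by
  simp [normalProduct, dFieldAnn, dFieldCre, field_neg]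

theorem symProduct_eq (x : ℝ → ℝ) (f₁ f₂ : ℝ → ℂ) (ψ : FockVector) :
    symProduct x f₁ f₂ ψ
      = (1 / 2 : ℂ) • (field x (deriv f₁) (field x (deriv f₂) ψ)
        + field x (deriv f₂) (field x (deriv f₁) ψ)) := by
  simp [symProduct, dField, field_neg]

theorem vacuum_normalProduct (x : ℝ → ℝ) (f₁ f₂ : ℝ → ℂ) :
    fockInner vacuum (normalProduct x f₁ f₂ vacuum)
      = twoPt x (posPart (deriv f₁)) (posPart (deriv f₂))
        + twoPt x (negPart (deriv f₁)) (posPart (deriv f₂))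
        + twoPt x (negPart (deriv f₂)) (posPart (deriv f₁))
        + twoPt x (negPart (deriv f₁)) (negPart (deriv f₂)) := by
  rw [normalProduct_eq, fockInner_vacuum]
  simp only [Pi.add_apply, field_field_vacuum]

theorem vacuum_symProduct (x : ℝ → ℝ) (f₁ f₂ : ℝ → ℂ) :
    fockInner vacuum (symProduct x f₁ f₂ vacuum)
      = (twoPt x (deriv f₁) (deriv f₂) + twoPt x (deriv f₂) (deriv f₁)) / 2 := by
  rw [symProduct_eq, fockInner_vacuum]
  simp only [Pi.add_apply, Pi.smul_apply, field_field_vacuum, smul_eq_mul]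
  ring

theorem oneParticle_normalProduct {x : ℝ → ℝ} {g f₁ f₂ : ℝ → ℂ}
    (hg : MemLp (fun k => hat g k) 2 momentumMeasure)
    (hn : ∫ k, ‖hat g k‖ ^ 2 ∂momentumMeasure = 1)
    (hp₁ : FieldDefined x (posPart (deriv f₁))) (hp₂ : FieldDefined x (posPart (deriv f₂)))
    (hm₁ : FieldDefined x (negPart (deriv f₁))) (hm₂ : FieldDefined x (negPart (deriv f₂))) :
    fockInner (oneParticle g) (normalProduct x f₁ f₂ (oneParticle g))
      = oneParticleMean x g (posPart (deriv f₁)) (posPart (deriv f₂))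
        + oneParticleMean x g (negPart (deriv f₁)) (posPart (deriv f₂))
        + oneParticleMean x g (negPart (deriv f₂)) (posPart (deriv f₁))
        + oneParticleMean x g (negPart (deriv f₁)) (negPart (deriv f₂)) := by
  rw [normalProduct_eq, fockInner_oneParticle]
  obtain ⟨i1, e1⟩ := integrable_oneParticle_field_field hp₁ hp₂ hg hn
  obtain ⟨i2, e2⟩ := integrable_oneParticle_field_field hm₁ hp₂ hg hn
  obtain ⟨i3, e3⟩ := integrable_oneParticle_field_field hm₂ hp₁ hg hn
  obtain ⟨i4, e4⟩ := integrable_oneParticle_field_field hm₁ hm₂ hg hn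
  simp only [Pi.add_apply, mul_add]
  rw [integral_add ((i1.fun_add i2).fun_add i3) i4, integral_add (i1.fun_add i2) i3, integral_add i1 i2,
    e1, e2, e3, e4]

theorem oneParticle_symProduct {x : ℝ → ℝ} {g f₁ f₂ : ℝ → ℂ}
    (hg : MemLp (fun k => hat g k) 2 momentumMeasure)
    (hn : ∫ k, ‖hat g k‖ ^ 2 ∂momentumMeasure = 1)
    (h₁ : FieldDefined x (deriv f₁)) (h₂ : FieldDefined x (deriv f₂)) :
    fockInner (oneParticle g) (symProduct x f₁ f₂ (oneParticle g))
      = (oneParticleMean x g (deriv f₁) (deriv f₂)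
        + oneParticleMean x g (deriv f₂) (deriv f₁)) / 2 := by
  rw [symProduct_eq, fockInner_oneParticle]
  obtain ⟨i1, e1⟩ := integrable_oneParticle_field_field h₁ h₂ hg hn
  obtain ⟨i2, e2⟩ := integrable_oneParticle_field_field h₂ h₁ hg hn
  have : ∀ k, hat g k * ((1 / 2 : ℂ) • (field x (deriv f₁) (field x (deriv f₂) (oneParticle g))
        + field x (deriv f₂) (field x (deriv f₁) (oneParticle g))) : FockVector) 1 (fun _ => k)
      = 1 / 2 * (hat g k * field x (deriv f₁) (field x (deriv f₂) (oneParticle g)) 1 (fun _ => k)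
        + hat g k * field x (deriv f₂) (field x (deriv f₁) (oneParticle g)) 1 (fun _ => k)) := by
    intro k
    simp only [Pi.add_apply, Pi.smul_apply, smul_eq_mul]
    ring
  simp_rw [this]
  rw [integral_const_mul, integral_add i1 i2, e1, e2]
  ring

/-! ### Integration over momenta -/

theorem measurable_momentumDensity :
    Measurable (fun k : ℝ => ENNReal.ofReal (1 / (2 * k))) := by fun_prop

theorem ae_momentumMeasure_pos : ∀ᵐ k ∂momentumMeasure, 0 < k := by
  unfold momentumMeasure
  rw [ae_withDensity_iff measurable_momentumDensity]
  filter_upwards [ae_restrict_mem measurableSet_Ioi] with k hk _ using hk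

theorem toReal_momentumDensity {k : ℝ} (hk : 0 < k) :
    (ENNReal.ofReal (1 / (2 * k))).toReal = 1 / (2 * k) :=
  ENNReal.toReal_ofReal (by positivity)

theorem integrable_momentumMeasure_iff {E : Type*} [NormedAddCommGroup E] [NormedSpace ℝ E]
    {F : ℝ → E} :
    Integrable F momentumMeasure ↔ IntegrableOn (fun k => (1 / (2 * k)) • F k) (Ioi 0) := by
  unfold momentumMeasure
  rw [integrable_withDensity_iff_integrable_smul' measurable_momentumDensity (by simp)]
  exact integrableOn_congr_fun (fun k hk => by simp only [toReal_momentumDensity hk])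
    measurableSet_Ioi

theorem integral_momentumMeasure {E : Type*} [NormedAddCommGroup E] [NormedSpace ℝ E]
    (F : ℝ → E) :
    ∫ k, F k ∂momentumMeasure = ∫ k in Ioi (0 : ℝ), (1 / (2 * k)) • F k := by
  unfold momentumMeasure
  rw [integral_withDensity_eq_integral_toReal_smul measurable_momentumDensity (by simp)]
  exact setIntegral_congr_fun measurableSet_Ioi fun k hk => by
    simp only [toReal_momentumDensity hk]

/-- The substitution k = e^s turns dk/2k into ds/2 and the weight into (1 + |s|)⁻². -/
theorem integrable_logWeight :
    Integrable (fun k : ℝ => 1 / (1 + |Real.log k|) ^ 2) momentumMeasure := by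
  rw [integrable_momentumMeasure_iff, ← Real.range_exp, ← image_univ,
    integrableOn_image_iff_integrableOn_abs_deriv_smul MeasurableSet.univ
      (fun s _ => (Real.hasDerivAt_exp s).hasDerivWithinAt) Real.exp_injective.injOn,
    integrableOn_univ]
  have h : Integrable (fun s : ℝ => (1 + ‖s‖) ^ (-2 : ℝ)) :=
    integrable_one_add_norm (by simp)
  refine (h.const_mul (1 / 2)).congr (ae_of_all _ fun s => ?_)
  have : (0 : ℝ) < 1 + |s| := by positivity
  simp only [Real.norm_eq_abs, smul_eq_mul, Real.log_exp, Real.abs_exp]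
  rw [Real.rpow_neg this.le, Real.rpow_two]
  field_simp

/-- Continuity and a logarithmic bound, at zero and at infinity, which ensure square
integrability with respect to `dk / 2k`. -/
def LogDecay (D : ℝ) (u : ℝ → ℂ) : Prop :=
  Continuous u ∧ ∀ k, k ≠ 0 → ‖u k‖ ≤ D / (1 + |Real.log k|)

theorem LogDecay.comp_neg {D : ℝ} {u : ℝ → ℂ} (hu : LogDecay D u) :
    LogDecay D (fun k => u (-k)) :=
  ⟨hu.1.comp continuous_neg, fun k hk => by simpa using hu.2 (-k) (neg_ne_zero.2 hk)⟩

theorem LogDecay.norm_mul_le {D D' : ℝ} {u v : ℝ → ℂ} (hu : LogDecay D u) (hv : LogDecay D' v)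
    {k : ℝ} (hk : k ≠ 0) : ‖u k * v k‖ ≤ D * D' * (1 / (1 + |Real.log k|) ^ 2) := by
  have h1 := hu.2 k hk
  have h2 := hv.2 k hk
  rw [norm_mul]
  calc ‖u k‖ * ‖v k‖ ≤ (D / (1 + |Real.log k|)) * (D' / (1 + |Real.log k|)) := by
        gcongr
        exact (norm_nonneg _).trans h1
    _ = _ := by field_simp

theorem LogDecay.memLp {D : ℝ} {u : ℝ → ℂ} (hu : LogDecay D u) :
    MemLp u 2 momentumMeasure := by
  rw [memLp_two_iff_integrable_sq_norm hu.1.aestronglyMeasurable]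
  refine (integrable_logWeight.const_mul (D * D)).mono'
    (hu.1.norm.pow 2).aestronglyMeasurable ?_
  filter_upwards [ae_momentumMeasure_pos] with k hk
  have := hu.norm_mul_le hu hk.ne'
  rw [norm_mul] at this
  simpa [sq] using this

/-! ### Fourier transforms along the transformation of coordinates -/

theorem norm_phase (k t : ℝ) : ‖Complex.exp (-(Complex.I * (k : ℂ) * (t : ℂ)))‖ = 1 := by
  rw [show -(Complex.I * (k : ℂ) * (t : ℂ)) = ((-(k * t) : ℝ) : ℂ) * Complex.I by push_cast; ring]
  exact Complex.norm_exp_ofReal_mul_I _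

theorem integrable_phase_mul {x : ℝ → ℝ} (hx : Continuous x) {f : ℝ → ℂ} (hf : Integrable f)
    (k : ℝ) : Integrable (fun y => Complex.exp (-(Complex.I * (k : ℂ) * (x y : ℂ))) * f y) := by
  refine hf.bdd_mul (c := 1) (by fun_prop) (ae_of_all _ fun y => (norm_phase _ _).le)

theorem continuous_inHat {x : ℝ → ℝ} (hx : Continuous x) {f : ℝ → ℂ} (hf : Integrable f) :
    Continuous (fun k => inHat x f k) := by
  unfold inHat
  refine continuous_const.mul (continuous_of_dominated (bound := fun y => ‖f y‖)
    (fun k => (integrable_phase_mul hx hf k).aestronglyMeasurable)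
    (fun k => ae_of_all _ fun y => ?_) hf.norm (ae_of_all _ fun y => by fun_prop))
  rw [norm_mul, norm_phase, one_mul]

theorem norm_inHat_le (x : ℝ → ℝ) (f : ℝ → ℂ) (k : ℝ) :
    ‖inHat x f k‖ ≤ (Real.sqrt (2 * Real.pi))⁻¹ * ∫ y, ‖f y‖ := by
  unfold inHat
  rw [norm_mul, Complex.norm_real, Real.norm_of_nonneg (by positivity)]
  gcongr
  refine (norm_integral_le_integral_norm _).trans_eq ?_
  simp_rw [norm_mul, norm_phase, one_mul]

theorem inHat_add {x : ℝ → ℝ} (hx : Continuous x) {f h : ℝ → ℂ} (hf : Integrable f)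
    (hh : Integrable h) (k : ℝ) :
    inHat x (fun y => f y + h y) k = inHat x f k + inHat x h k := by
  unfold inHat
  rw [← mul_add, ← integral_add (integrable_phase_mul hx hf k) (integrable_phase_mul hx hh k)]
  simp_rw [mul_add]

theorem hasDerivAt_phase {x : ℝ → ℝ} {x' y : ℝ} (hx : HasDerivAt x x' y) (k : ℝ) :
    HasDerivAt (fun y => Complex.exp (-(Complex.I * (k : ℂ) * (x y : ℂ))))
      (-(Complex.I * k) * x' * Complex.exp (-(Complex.I * (k : ℂ) * (x y : ℂ)))) y := by
  have h := ((hx.ofReal_comp.const_mul (Complex.I * (k : ℂ))).fun_neg).cexp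
  convert h using 1
  ring

/-- Integration by parts puts the derivative on the phase. The factor `k` gained here is what later
compensates the weight 1/2k. -/
theorem inHat_deriv {x : ℝ → ℝ} (hx : ContDiff ℝ ∞ x) {f : ℝ → ℂ} (hf : IsTest f) (k : ℝ) :
    inHat x (deriv f) k = Complex.I * k * inHat x (fun y => deriv x y * f y) k := by
  have hx1 : Continuous (deriv x) := hx.continuous_deriv (by simp)
  have hxc := hx.continuous
  have hfc := hf.continuous
  have hfd := hf.deriv.continuous
  unfold inHat
  rw [integral_mul_deriv_eq_deriv_mul_of_integrable
    (fun y _ => hasDerivAt_phase ((hx.differentiable (by simp)) y).hasDerivAt k)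
    (fun y _ => hf.hasDerivAt y)]
  · rw [← integral_neg, ← integral_const_mul, ← integral_const_mul, ← integral_const_mul]
    refine integral_congr_ae (ae_of_all _ fun y => ?_)
    simp only
    ring
  · exact Continuous.integrable_of_hasCompactSupport (by fun_prop) hf.deriv.2.mul_left
  · exact Continuous.integrable_of_hasCompactSupport (by fun_prop) hf.2.mul_left
  · exact Continuous.integrable_of_hasCompactSupport (by fun_prop) hf.2.mul_left

theorem IsTest.div {x' : ℝ → ℝ} (hx : ContDiff ℝ ∞ x') (hp : ∀ y, 0 < x' y) {f : ℝ → ℂ}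
    (hf : IsTest f) : IsTest (fun y => f y / x' y) := by
  refine ⟨?_, ?_⟩
  · have h := hf.1.mul (Complex.ofRealCLM.contDiff.comp (hx.inv fun y => (hp y).ne'))
    have e : (fun y => f y / (x' y : ℂ)) = fun y => f y * (Complex.ofRealCLM ∘ x'⁻¹) y := by
      funext y
      simp [div_eq_mul_inv]
    exact e ▸ h
  · refine hf.2.mono fun y hy hy' => hy ?_
    simp [hy']

/-- Since 1 + s ≤ e^s, the quantity 1 + |log k| is at most the larger of |k| and 1/|k|. -/
theorem min_le_logWeight {C k : ℝ} (hC : 0 ≤ C) (hk : k ≠ 0) {t : ℝ} (h1 : t ≤ C * |k|)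
    (h2 : t ≤ C / |k|) : t ≤ C / (1 + |Real.log k|) := by
  have hk' : 0 < |k| := abs_pos.2 hk
  have hL : 0 < 1 + |Real.log k| := by positivity
  have key : 1 + |Real.log k| ≤ Real.exp |Real.log k| := by
    linarith [Real.add_one_le_exp |Real.log k|]
  rw [le_div_iff₀ hL]
  rcases le_total 0 (Real.log k) with h | h
  · rw [abs_of_nonneg h] at key ⊢
    rw [Real.exp_log_eq_abs hk] at key
    calc t * (1 + Real.log k) ≤ C / |k| * (1 + Real.log k) := by gcongr
      _ ≤ C / |k| * |k| := by gcongr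
      _ = C := by field_simp
  · rw [abs_of_nonpos h] at key ⊢
    rw [Real.exp_neg, Real.exp_log_eq_abs hk] at key
    have : 0 ≤ 1 + -Real.log k := by linarith
    calc t * (1 + -Real.log k) ≤ C * |k| * (1 + -Real.log k) := by gcongr
      _ ≤ C * |k| * |k|⁻¹ := by gcongr
      _ = C := by field_simp

/-- For small `k`, integration by parts extracts a factor `k`. For large `k` the same formula is
read backwards: f' is x' times the test function f'/x', so one more derivative yields a factor 1/k.
Compact support makes any growth condition on `x` superfluous. -/
theorem logDecay_inHat_deriv {x : ℝ → ℝ} (hx : ContDiff ℝ ∞ x) (hp : ∀ y, 0 < deriv x y)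
    {f : ℝ → ℂ} (hf : IsTest f) : ∃ D, LogDecay D (fun k => inHat x (deriv f) k) := by
  have hx1 : ContDiff ℝ ∞ (deriv x) := (contDiff_infty_iff_deriv.1 hx).2
  have hu := hf.deriv.div hx1 hp
  set C₁ := (Real.sqrt (2 * Real.pi))⁻¹ * ∫ y, ‖((deriv x y : ℝ) : ℂ) * f y‖
  set C₂ := (Real.sqrt (2 * Real.pi))⁻¹ * ∫ y, ‖deriv (fun y => deriv f y / ((deriv x y : ℝ) : ℂ)) y‖
  have hC₁ : 0 ≤ C₁ := by positivity
  have hC₂ : 0 ≤ C₂ := by positivity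
  refine ⟨max C₁ C₂, continuous_inHat hx.continuous hf.deriv.integrable, fun k hk => ?_⟩
  have hk' : 0 < |k| := abs_pos.2 hk
  refine min_le_logWeight (hC₁.trans (le_max_left _ _)) hk ?_ ?_
  · simp only
    rw [inHat_deriv hx hf, norm_mul, norm_mul, Complex.norm_I, Complex.norm_real, one_mul,
      mul_comm, Real.norm_eq_abs]
    gcongr
    exact (norm_inHat_le _ _ _).trans (le_max_left _ _)
  · have e := inHat_deriv hx hu k
    have e2 : (fun y => ((deriv x y : ℝ) : ℂ) * (deriv f y / ((deriv x y : ℝ) : ℂ))) = deriv f := by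
      funext y
      have : ((deriv x y : ℝ) : ℂ) ≠ 0 := by simpa using (hp y).ne'
      field_simp
    rw [e2] at e
    rw [le_div_iff₀ hk', mul_comm]
    have : |k| * ‖inHat x (deriv f) k‖
        = ‖inHat x (deriv (fun y => deriv f y / ((deriv x y : ℝ) : ℂ))) k‖ := by
      rw [e, norm_mul, norm_mul, Complex.norm_I, Complex.norm_real, one_mul, Real.norm_eq_abs]
    rw [this]
    exact (norm_inHat_le _ _ _).trans (le_max_right _ _)

theorem fieldDefined_of_logDecay {x : ℝ → ℝ} {f : ℝ → ℂ} {D : ℝ} (hf : Integrable f)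
    (h : LogDecay D (fun k => inHat x f k)) : FieldDefined x f :=
  ⟨hf, h.memLp, h.comp_neg.memLp⟩

theorem fieldDefined_deriv {x : ℝ → ℝ} (hx : ContDiff ℝ ∞ x) (hp : ∀ y, 0 < deriv x y)
    {f : ℝ → ℂ} (hf : IsTest f) : FieldDefined x (deriv f) :=
  let ⟨_, h⟩ := logDecay_inHat_deriv hx hp hf
  fieldDefined_of_logDecay hf.deriv.integrable h

/-! ### Regularized two-point functions -/

theorem integrableOn_mul_exp_neg {ε : ℝ} (hε : 0 < ε) :
    IntegrableOn (fun t : ℝ => t * Real.exp (-(ε * t))) (Ioi 0) := by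
  have h := integrableOn_rpow_mul_exp_neg_mul_rpow (p := 1) (s := 1) (b := ε) (by norm_num)
    one_pos hε
  simpa using h

theorem norm_exp_neg_mul_ofReal (z : ℂ) (t : ℝ) :
    ‖Complex.exp (-(z * t))‖ = Real.exp (-(z.re * t)) := by
  rw [Complex.norm_exp]
  simp

theorem integral_mul_cexp_neg {z : ℂ} (hz : 0 < z.re) :
    ∫ t in Ioi (0 : ℝ), (t : ℂ) * Complex.exp (-(z * t)) = 1 / z ^ 2 := by
  have hz0 : z ≠ 0 := fun h => by simp [h] at hz
  have hd : ∀ t ∈ Ici (0 : ℝ), HasDerivAt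
      (fun t : ℝ => -((t : ℂ) / z + 1 / z ^ 2) * Complex.exp (-(z * t)))
      ((t : ℂ) * Complex.exp (-(z * t))) t := by
    intro t _
    have h1 : HasDerivAt (fun t : ℝ => (t : ℂ)) 1 t := Complex.ofRealCLM.hasDerivAt
    have h2 := ((h1.div_const z).add_const (1 / z ^ 2)).fun_neg.fun_mul (h1.const_mul z).fun_neg.cexp
    refine h2.congr_deriv ?_
    field_simp
    ring
  have hi : IntegrableOn (fun t : ℝ => (t : ℂ) * Complex.exp (-(z * t))) (Ioi 0) := by
    refine (integrableOn_mul_exp_neg hz).mono' (by fun_prop) ?_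
    filter_upwards [ae_restrict_mem measurableSet_Ioi] with t ht
    rw [norm_mul, norm_exp_neg_mul_ofReal, Complex.norm_real, Real.norm_of_nonneg (le_of_lt ht)]
  have e0 : Tendsto (fun t : ℝ => Real.exp (-(z.re * t))) atTop (𝓝 0) :=
    Real.tendsto_exp_neg_atTop_nhds_zero.comp (tendsto_id.const_mul_atTop hz)
  have e1 : Tendsto (fun t : ℝ => t * Real.exp (-(z.re * t))) atTop (𝓝 0) := by
    have h := ((Real.tendsto_pow_mul_exp_neg_atTop_nhds_zero 1).comp
      (tendsto_id.const_mul_atTop hz)).const_mul z.re⁻¹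
    rw [mul_zero] at h
    refine h.congr fun t => ?_
    simp
    field_simp
  have hl : Tendsto (fun t : ℝ => -((t : ℂ) / z + 1 / z ^ 2) * Complex.exp (-(z * t))) atTop
      (𝓝 0) := by
    rw [tendsto_zero_iff_norm_tendsto_zero]
    have hb := (e1.const_mul (1 / ‖z‖)).add (e0.const_mul (1 / ‖z‖ ^ 2))
    rw [mul_zero, mul_zero, add_zero] at hb
    refine squeeze_zero' (Eventually.of_forall fun t => norm_nonneg _) ?_ hb
    filter_upwards [eventually_ge_atTop 0] with t ht
    rw [norm_mul, norm_neg, norm_exp_neg_mul_ofReal]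
    have : ‖(t : ℂ) / z + 1 / z ^ 2‖ ≤ t / ‖z‖ + 1 / ‖z‖ ^ 2 := by
      refine (norm_add_le _ _).trans_eq ?_
      simp [abs_of_nonneg ht]
    calc _ ≤ (t / ‖z‖ + 1 / ‖z‖ ^ 2) * Real.exp (-(z.re * t)) := by gcongr
      _ = _ := by ring
  rw [integral_Ioi_of_hasDerivAt_of_tendsto' hd hi hl]
  simp

/-- The two-point function with the momenta damped by `e^{-εk}`. -/
noncomputable def twoPtReg (x : ℝ → ℝ) (A B : ℝ → ℂ) (ε : ℝ) : ℂ :=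
  ∫ k, Complex.exp (-(ε * k)) * (inHat x A k * inHat x B (-k)) ∂momentumMeasure

/-- The undamped integrand is already dominated by the logarithmic weight. The damping serves only
to allow the momentum integral to be done first. -/
theorem tendsto_twoPtReg {x : ℝ → ℝ} {A B : ℝ → ℂ} {D D' : ℝ}
    (hA : LogDecay D (fun k => inHat x A k)) (hB : LogDecay D' (fun k => inHat x B k)) :
    Tendsto (twoPtReg x A B) (𝓝[>] 0) (𝓝 (twoPt x A B)) := by
  unfold twoPtReg twoPt
  have hAc := hA.1
  have hBc := hB.comp_neg.1
  refine tendsto_integral_filter_of_dominated_convergence _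
    (Eventually.of_forall fun ε => ?_) ?_ (integrable_logWeight.const_mul (D * D'))
    (ae_of_all _ fun k => ?_)
  · exact Continuous.aestronglyMeasurable (by fun_prop)
  · filter_upwards [self_mem_nhdsWithin] with ε hε
    filter_upwards [ae_momentumMeasure_pos] with k hk
    have h1 : ‖Complex.exp (-(ε * k))‖ ≤ 1 := by
      rw [norm_exp_neg_mul_ofReal, Real.exp_le_one_iff, Complex.ofReal_re]
      have : 0 < ε * k := mul_pos hε hk
      linarith
    rw [norm_mul]
    calc _ ≤ 1 * ‖inHat x A k * inHat x B (-k)‖ := by gcongr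
      _ ≤ _ := by rw [one_mul]; exact hA.norm_mul_le hB.comp_neg hk.ne'
  · have : Continuous fun ε : ℝ =>
        Complex.exp (-(ε * k)) * (inHat x A k * inHat x B (-k)) := by fun_prop
    have h := (this.tendsto 0).mono_left (nhdsWithin_le_nhds (s := Ioi 0))
    simpa using h

theorem inHat_mul_inHat {x : ℝ → ℝ} {u₁ u₂ : ℝ → ℂ} (k : ℝ) :
    inHat x u₁ k * inHat x u₂ (-k) = (1 / (2 * Real.pi) : ℝ) * ∫ p : ℝ × ℝ,
      Complex.exp (-(Complex.I * ((x p.1 - x p.2 : ℝ) : ℂ) * k)) * (u₁ p.1 * u₂ p.2) := by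
  unfold inHat
  have hc : (((Real.sqrt (2 * Real.pi))⁻¹ : ℝ) : ℂ) * (((Real.sqrt (2 * Real.pi))⁻¹ : ℝ) : ℂ)
      = (1 / (2 * Real.pi) : ℝ) := by
    rw [← Complex.ofReal_mul, ← mul_inv, Real.mul_self_sqrt (by positivity), one_div]
  rw [← hc, mul_mul_mul_comm, ← integral_prod_mul, ← Measure.volume_eq_prod]
  congr 1
  refine integral_congr_ae (ae_of_all _ fun p => ?_)
  simp only
  rw [mul_mul_mul_comm, ← Complex.exp_add]
  congr 2
  push_cast
  ring

/-- Two integrations by parts give k², the weight leaves k/2, and the damping permits Fubini. The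
momentum integral is then the Laplace transform of `k` at z = ε + i(x(y) - x(z)), namely 1/z²; the
constant is (1/2π)(1/2). -/
theorem twoPtReg_eq {x : ℝ → ℝ} (hx : ContDiff ℝ ∞ x) {f₁ f₂ : ℝ → ℂ}
    (hf₁ : IsTest f₁) (hf₂ : IsTest f₂) {ε : ℝ} (hε : 0 < ε) :
    twoPtReg x (deriv f₁) (deriv f₂) ε
      = (1 / (4 * Real.pi) : ℝ) * ∫ p : ℝ × ℝ,
        (deriv x p.1 * deriv x p.2 / (ε + Complex.I * ((x p.1 - x p.2 : ℝ) : ℂ)) ^ 2)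
          * (f₁ p.1 * f₂ p.2) := by
  have hxc := hx.continuous
  have hx1 : Continuous (deriv x) := hx.continuous_deriv (by simp)
  have hc₁ := hf₁.continuous
  have hc₂ := hf₂.continuous
  set u₁ : ℝ → ℂ := fun y => deriv x y * f₁ y with hu₁
  set u₂ : ℝ → ℂ := fun y => deriv x y * f₂ y with hu₂
  have i₁ : Integrable u₁ :=
    Continuous.integrable_of_hasCompactSupport (by fun_prop) hf₁.2.mul_left
  have i₂ : Integrable u₂ :=
    Continuous.integrable_of_hasCompactSupport (by fun_prop) hf₂.2.mul_left
  have iu : Integrable (fun p : ℝ × ℝ => u₁ p.1 * u₂ p.2) := i₁.mul_prod i₂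
  let z : ℝ × ℝ → ℂ := fun p => ε + Complex.I * ((x p.1 - x p.2 : ℝ) : ℂ)
  have hz : ∀ p, (z p).re = ε := fun p => by
    simp only [z, Complex.add_re, Complex.ofReal_re, Complex.mul_re, Complex.I_re, Complex.I_im,
      Complex.ofReal_im]
    ring
  have hzc : Continuous z := by fun_prop
  unfold twoPtReg
  rw [integral_momentumMeasure]
  have e1 : ∀ k ∈ Ioi (0 : ℝ), (1 / (2 * k)) •
      (Complex.exp (-(ε * k)) * (inHat x (deriv f₁) k * inHat x (deriv f₂) (-k)))
      = (1 / (4 * Real.pi) : ℝ) * ∫ p : ℝ × ℝ,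
        ((k : ℂ) * Complex.exp (-(z p * k))) * (u₁ p.1 * u₂ p.2) := by
    intro k hk
    have hk0 : (k : ℂ) ≠ 0 := by simpa using ne_of_gt hk
    have hpi : (Real.pi : ℂ) ≠ 0 := by simp
    have e2 : ∀ p : ℝ × ℝ, ((k : ℂ) * Complex.exp (-(z p * k))) * (u₁ p.1 * u₂ p.2)
        = (k * Complex.exp (-(ε * k))) *
          (Complex.exp (-(Complex.I * ((x p.1 - x p.2 : ℝ) : ℂ) * k)) * (u₁ p.1 * u₂ p.2)) := by
      intro p
      have : Complex.exp (-(z p * k)) = Complex.exp (-(ε * k)) *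
          Complex.exp (-(Complex.I * ((x p.1 - x p.2 : ℝ) : ℂ) * k)) := by
        rw [← Complex.exp_add]
        congr 1
        simp only [z]
        ring
      rw [this]
      ring
    simp_rw [e2]
    rw [integral_const_mul, inHat_deriv hx hf₁, inHat_deriv hx hf₂, mul_mul_mul_comm,
      inHat_mul_inHat, Complex.real_smul]
    generalize (∫ p : ℝ × ℝ, _ : ℂ) = J
    push_cast
    have : Complex.I * k * (Complex.I * -k) = (k : ℂ) ^ 2 := by
      linear_combination (-(k : ℂ) ^ 2) * Complex.I_sq
    rw [this]
    field_simp
    ring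
  rw [setIntegral_congr_fun measurableSet_Ioi e1, integral_const_mul]
  congr 1
  have hF : Integrable (Function.uncurry fun (k : ℝ) (p : ℝ × ℝ) =>
      ((k : ℂ) * Complex.exp (-(z p * k))) * (u₁ p.1 * u₂ p.2))
      ((volume.restrict (Ioi 0)).prod volume) := by
    have hb := Integrable.mul_prod (integrableOn_mul_exp_neg hε) iu.norm
    have hm : Continuous (Function.uncurry fun (k : ℝ) (p : ℝ × ℝ) =>
      ((k : ℂ) * Complex.exp (-(z p * k))) * (u₁ p.1 * u₂ p.2)) := by
      unfold Function.uncurry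
      fun_prop
    refine hb.mono hm.aestronglyMeasurable (ae_of_all _ fun q => ?_)
    simp only [Function.uncurry]
    rw [norm_mul, norm_mul, norm_exp_neg_mul_ofReal, hz]
    refine le_of_eq ?_
    simp [Real.abs_exp]
  rw [integral_integral_swap hF]
  refine integral_congr_ae (ae_of_all _ fun p => ?_)
  simp only
  rw [integral_mul_const, integral_mul_cexp_neg (by rw [hz]; exact hε)]
  simp only [hu₁, hu₂, z]
  ring

/-! ### Logarithmic form of the damped two-point function -/

theorem IsTest.integral_deriv_mul {f : ℝ → ℂ} (hf : IsTest f) {u u' : ℝ → ℂ}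
    (hu : ∀ y, HasDerivAt u (u' y) y) (hu' : Continuous u') :
    ∫ y, u' y * f y = -∫ y, u y * _root_.deriv f y := by
  have hc : Continuous u := continuous_iff_continuousAt.2 fun y => (hu y).continuousAt
  have hfc := hf.continuous
  have hfd := hf.deriv.continuous
  rw [integral_mul_deriv_eq_deriv_mul_of_integrable (fun y _ => hu y) (fun y _ => hf.hasDerivAt y),
    neg_neg]
  · exact Continuous.integrable_of_hasCompactSupport (by fun_prop) hf.deriv.2.mul_left
  · exact Continuous.integrable_of_hasCompactSupport (by fun_prop) hf.2.mul_left
  · exact Continuous.integrable_of_hasCompactSupport (by fun_prop) hf.2.mul_left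

/-- One integration by parts in each variable; the two signs cancel. It is applied both to the
regularized logarithm and to log Q. -/
theorem integral_mixed_deriv_mul {L L₂ L₁₂ : ℝ × ℝ → ℂ}
    (h₂ : ∀ y y', HasDerivAt (fun t => L (y, t)) (L₂ (y, y')) y')
    (h₁₂ : ∀ y y', HasDerivAt (fun s => L₂ (s, y')) (L₁₂ (y, y')) y)
    (hL : Continuous L) (hL₂ : Continuous L₂) (hL₁₂ : Continuous L₁₂)
    {f₁ f₂ : ℝ → ℂ} (hf₁ : IsTest f₁) (hf₂ : IsTest f₂) :
    ∫ p : ℝ × ℝ, L₁₂ p * (f₁ p.1 * f₂ p.2) = ∫ p : ℝ × ℝ, L p * (deriv f₁ p.1 * deriv f₂ p.2) := by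
  have i12 : Integrable (fun p : ℝ × ℝ => L₁₂ p * (f₁ p.1 * f₂ p.2)) :=
    integrable_kernel_mul (O := univ) hL₁₂.continuousOn hf₁.continuous hf₂.continuous hf₁.2 hf₂.2
      (subset_univ _)
  have i2 : Integrable (fun p : ℝ × ℝ => L₂ p * (deriv f₁ p.1 * f₂ p.2)) :=
    integrable_kernel_mul (O := univ) hL₂.continuousOn hf₁.deriv.continuous hf₂.continuous
      hf₁.deriv.2 hf₂.2 (subset_univ _)
  have i0 : Integrable (fun p : ℝ × ℝ => L p * (deriv f₁ p.1 * deriv f₂ p.2)) :=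
    integrable_kernel_mul (O := univ) hL.continuousOn hf₁.deriv.continuous hf₂.deriv.continuous
      hf₁.deriv.2 hf₂.deriv.2 (subset_univ _)
  have e1 : ∫ p : ℝ × ℝ, L₁₂ p * (f₁ p.1 * f₂ p.2)
      = -∫ p : ℝ × ℝ, L₂ p * (deriv f₁ p.1 * f₂ p.2) := by
    rw [Measure.volume_eq_prod] at i12 i2 ⊢
    rw [integral_prod_symm _ i12, integral_prod_symm _ i2, ← integral_neg]
    refine integral_congr_ae (ae_of_all _ fun y' => ?_)
    simp only
    have := hf₁.integral_deriv_mul (fun y => h₁₂ y y') (by fun_prop)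
    simp_rw [← mul_assoc]
    rw [integral_mul_const, integral_mul_const, this, neg_mul]
  have e2 : ∫ p : ℝ × ℝ, L₂ p * (deriv f₁ p.1 * f₂ p.2)
      = -∫ p : ℝ × ℝ, L p * (deriv f₁ p.1 * deriv f₂ p.2) := by
    rw [Measure.volume_eq_prod] at i0 i2 ⊢
    rw [integral_prod _ i2, integral_prod _ i0, ← integral_neg]
    refine integral_congr_ae (ae_of_all _ fun y => ?_)
    simp only
    have := hf₂.integral_deriv_mul (fun y' => h₂ y y') (by fun_prop)
    simp_rw [mul_left_comm _ (deriv f₁ y) _]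
    rw [integral_const_mul, integral_const_mul, this, mul_neg]
  rw [e1, e2, neg_neg]

theorem slitPlane_regularized {ε : ℝ} (hε : 0 < ε) (d : ℝ) :
    (ε : ℂ) + Complex.I * (d : ℂ) ∈ Complex.slitPlane := by
  left
  simpa using hε

/-- The double pole is minus the mixed derivative of a logarithm. In this form the factors x'
disappear, and a change of coordinates merely multiplies the argument's imaginary part by Q, so that
two coordinates can be compared as ε tends to zero. -/
theorem twoPtReg_eq_log {x : ℝ → ℝ} (hx : ContDiff ℝ ∞ x) {f₁ f₂ : ℝ → ℂ}
    (hf₁ : IsTest f₁) (hf₂ : IsTest f₂) {ε : ℝ} (hε : 0 < ε) :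
    twoPtReg x (deriv f₁) (deriv f₂) ε
      = -(1 / (4 * Real.pi) : ℝ) * ∫ p : ℝ × ℝ,
        Complex.log (ε + Complex.I * ((x p.1 - x p.2 : ℝ) : ℂ))
          * (deriv f₁ p.1 * deriv f₂ p.2) := by
  have hxc := hx.continuous
  have hx1 : Continuous (deriv x) := hx.continuous_deriv (by simp)
  have hd : ∀ y, HasDerivAt (fun y => ((x y : ℝ) : ℂ)) ((deriv x y : ℝ) : ℂ) y := fun y =>
    ((hx.differentiable (by simp)) y).hasDerivAt.ofReal_comp
  have hs := fun p : ℝ × ℝ => slitPlane_regularized hε (x p.1 - x p.2)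
  have hne := fun p => Complex.slitPlane_ne_zero (hs p)
  rw [twoPtReg_eq hx hf₁ hf₂ hε, neg_mul, ← mul_neg,
    ← integral_mixed_deriv_mul
      (L₂ := fun p => -(Complex.I * deriv x p.2) / (ε + Complex.I * ((x p.1 - x p.2 : ℝ) : ℂ)))
      (L₁₂ := fun p => -(deriv x p.1 * deriv x p.2
        / (ε + Complex.I * ((x p.1 - x p.2 : ℝ) : ℂ)) ^ 2)) ?_ ?_ ?_ ?_ ?_ hf₁ hf₂]
  · rw [← integral_neg]
    congr 2
    funext p
    ring
  · intro y y'
    have h := ((((hd y').const_sub (x y : ℂ)).const_mul Complex.I).const_add (ε : ℂ)).clog_real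
      (by have := hs (y, y'); push_cast at this; exact this)
    simp only [Complex.ofReal_sub]
    convert h using 1
    ring
  · intro y y'
    have h := (hasDerivAt_const y (-(Complex.I * deriv x y'))).fun_div
      ((((hd y).sub_const (x y' : ℂ)).const_mul Complex.I).const_add (ε : ℂ))
      (by have := hne (y, y'); push_cast at this; exact this)
    simp only [Complex.ofReal_sub]
    refine h.congr_deriv ?_
    have h2 := hne (y, y')
    push_cast at h2
    field_simp
    linear_combination (((deriv x y : ℝ) : ℂ) * ((deriv x y' : ℝ) : ℂ)) * Complex.I_sq
  · exact Continuous.clog (by fun_prop) hs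
  · exact Continuous.div (by fun_prop) (by fun_prop) hne
  · exact (Continuous.div (by fun_prop) (by fun_prop) fun p => pow_ne_zero 2 (hne p)).neg

/-! ### Comparison of regularized logarithms in two coordinates -/

theorem norm_regularized_le {ε Q : ℝ} (hQ : 1 ≤ Q) (d : ℝ) :
    ‖(ε : ℂ) + Complex.I * (d : ℂ)‖ ≤ ‖(ε : ℂ) + Complex.I * ((Q * d : ℝ) : ℂ)‖ ∧
      ‖(ε : ℂ) + Complex.I * ((Q * d : ℝ) : ℂ)‖ ≤ Q * ‖(ε : ℂ) + Complex.I * (d : ℂ)‖ := by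
  have hn : ∀ d : ℝ, ‖(ε : ℂ) + Complex.I * (d : ℂ)‖ ^ 2 = ε ^ 2 + d ^ 2 := fun d => by
    rw [← Complex.normSq_eq_norm_sq, Complex.normSq_apply]
    simp
    ring
  have hQ2 : 1 ≤ Q ^ 2 := one_le_pow₀ hQ
  constructor
  · refine le_of_sq_le_sq ?_ (norm_nonneg _)
    rw [hn, hn]
    nlinarith [mul_le_mul_of_nonneg_right hQ2 (sq_nonneg d)]
  · refine le_of_sq_le_sq ?_ (by positivity)
    rw [mul_pow, hn, hn]
    nlinarith [mul_le_mul_of_nonneg_right hQ2 (sq_nonneg ε)]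

theorem abs_log_norm_regularized_sub_le {ε Q : ℝ} (hε : 0 < ε) (hQ : 0 < Q) (d : ℝ) :
    |Real.log ‖(ε : ℂ) + Complex.I * ((Q * d : ℝ) : ℂ)‖
      - Real.log ‖(ε : ℂ) + Complex.I * (d : ℂ)‖| ≤ |Real.log Q| := by
  have hpos : ∀ d : ℝ, 0 < ‖(ε : ℂ) + Complex.I * (d : ℂ)‖ := fun d =>
    norm_pos_iff.2 (Complex.slitPlane_ne_zero (slitPlane_regularized hε d))
  have key : ∀ {Q : ℝ} (d : ℝ), 1 ≤ Q → |Real.log ‖(ε : ℂ) + Complex.I * ((Q * d : ℝ) : ℂ)‖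
      - Real.log ‖(ε : ℂ) + Complex.I * (d : ℂ)‖| ≤ |Real.log Q| := by
    intro Q d hQ
    have hQ0 : 0 < Q := by linarith
    obtain ⟨h1, h2⟩ := norm_regularized_le (ε := ε) hQ d
    have h3 := Real.log_le_log (hpos _) h1
    have h4 := Real.log_le_log (hpos _) h2
    rw [Real.log_mul hQ0.ne' (hpos _).ne'] at h4
    rw [abs_of_nonneg (by linarith), abs_of_nonneg (Real.log_nonneg hQ)]
    linarith
  rcases le_total 1 Q with h | h
  · exact key d h
  -- For Q ≤ 1 the roles of `d` and `Q * d` are exchanged.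
  · have h' := key (Q := Q⁻¹) (Q * d) ((one_le_inv₀ hQ).2 h)
    rw [inv_mul_cancel_left₀ hQ.ne', abs_sub_comm, Real.log_inv, abs_neg] at h'
    exact h'

/-- The bound does not depend on `ε` or `d`, so it dominates the limit. The term 2π is a crude bound
for the difference of two arguments. -/
theorem norm_log_regularized_sub_le {ε Q : ℝ} (hε : 0 < ε) (hQ : 0 < Q) (d : ℝ) :
    ‖Complex.log (ε + Complex.I * ((Q * d : ℝ) : ℂ)) - Complex.log (ε + Complex.I * (d : ℂ))‖
      ≤ |Real.log Q| + 2 * Real.pi := by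
  refine (Complex.norm_le_abs_re_add_abs_im _).trans (add_le_add ?_ ?_)
  · rw [Complex.sub_re, Complex.log_re, Complex.log_re]
    exact abs_log_norm_regularized_sub_le hε hQ d
  · rw [Complex.sub_im, Complex.log_im, Complex.log_im, two_mul]
    exact (abs_sub _ _).trans (add_le_add (Complex.abs_arg_le_pi _) (Complex.abs_arg_le_pi _))

/-- At ε = 0 the two arguments differ by the positive factor `Q`, which does not change the branch
of the logarithm. The condition d ≠ 0 keeps the limit points i d and i Q d off the cut. -/
theorem tendsto_log_regularized_sub {Q d : ℝ} (hQ : 0 < Q) (hd : d ≠ 0) :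
    Tendsto (fun ε : ℝ => Complex.log (ε + Complex.I * ((Q * d : ℝ) : ℂ))
      - Complex.log (ε + Complex.I * (d : ℂ))) (𝓝 0) (𝓝 (Real.log Q : ℂ)) := by
  have hc : ∀ d : ℝ, d ≠ 0 → Tendsto (fun ε : ℝ => Complex.log (ε + Complex.I * (d : ℂ))) (𝓝 0)
      (𝓝 (Complex.log (Complex.I * (d : ℂ)))) := by
    intro d hd
    have h : Continuous fun ε : ℝ => (ε : ℂ) + Complex.I * (d : ℂ) := by fun_prop
    have h0 := h.tendsto 0
    rw [Complex.ofReal_zero, zero_add] at h0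
    refine h0.clog ?_
    right
    simpa using hd
  have h := (hc (Q * d) (mul_ne_zero hQ.ne' hd)).sub (hc d hd)
  have e : Complex.log (Complex.I * ((Q * d : ℝ) : ℂ)) - Complex.log (Complex.I * (d : ℂ))
      = Real.log Q := by
    rw [Complex.ofReal_mul, mul_left_comm, Complex.log_ofReal_mul hQ
      (mul_ne_zero Complex.I_ne_zero (by simpa using hd))]
    ring
  rwa [e] at h

theorem ae_fst_ne_snd : ∀ᵐ p : ℝ × ℝ, p.1 ≠ p.2 := by
  have hm : MeasurableSet {p : ℝ × ℝ | p.1 = p.2} := measurableSet_eq_fun measurable_fst measurable_snd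
  rw [ae_iff]
  simp only [ne_eq, not_not]
  rw [Measure.volume_eq_prod, Measure.measure_prod_null hm]
  refine ae_of_all _ fun y => ?_
  simp [preimage]

/-- The two-point function depends on the coordinates by a regular term. -/
theorem twoPt_sub_twoPt_id {x : ℝ → ℝ} (hx : ContDiff ℝ ∞ x) (hp : ∀ y, 0 < deriv x y)
    {Q : ℝ × ℝ → ℝ} (hQ : Continuous Q) (hQ0 : ∀ p, 0 < Q p)
    (hxQ : ∀ p, x p.1 - x p.2 = Q p * (p.1 - p.2)) {f₁ f₂ : ℝ → ℂ}
    (hf₁ : IsTest f₁) (hf₂ : IsTest f₂) :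
    twoPt x (deriv f₁) (deriv f₂) - twoPt id (deriv f₁) (deriv f₂)
      = -(1 / (4 * Real.pi) : ℝ) *
        ∫ p : ℝ × ℝ, (Real.log (Q p) : ℂ) * (deriv f₁ p.1 * deriv f₂ p.2) := by
  have hid : ∀ y : ℝ, 0 < deriv id y := fun y => by simp
  obtain ⟨D₁, hD₁⟩ := logDecay_inHat_deriv hx hp hf₁
  obtain ⟨D₂, hD₂⟩ := logDecay_inHat_deriv hx hp hf₂
  obtain ⟨E₁, hE₁⟩ := logDecay_inHat_deriv contDiff_id hid hf₁
  obtain ⟨E₂, hE₂⟩ := logDecay_inHat_deriv contDiff_id hid hf₂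
  -- The damped difference has the left-hand side as its limit; its limit is now computed again
  -- through the logarithms.
  refine tendsto_nhds_unique ((tendsto_twoPtReg hD₁ hD₂).sub (tendsto_twoPtReg hE₁ hE₂)) ?_
  have hxc := hx.continuous
  have hd₁ := hf₁.deriv.continuous
  have hd₂ := hf₂.deriv.continuous
  have hlogQ : Continuous fun p => Real.log (Q p) := hQ.log fun p => (hQ0 p).ne'
  have hint : ∀ (K : ℝ × ℝ → ℂ), Continuous K →
      Integrable (fun p : ℝ × ℝ => K p * (deriv f₁ p.1 * deriv f₂ p.2)) := fun K hK =>
    integrable_kernel_mul (O := univ) hK.continuousOn hd₁ hd₂ hf₁.deriv.2 hf₂.deriv.2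
      (subset_univ _)
  have hcl : ∀ {z : ℝ → ℝ}, Continuous z → ∀ {ε : ℝ}, 0 < ε →
      Continuous fun p : ℝ × ℝ => Complex.log (ε + Complex.I * ((z p.1 - z p.2 : ℝ) : ℂ)) :=
    fun hz _ hε => Continuous.clog (by fun_prop) fun p => slitPlane_regularized hε _
  have hlim : Tendsto (fun ε : ℝ => ∫ p : ℝ × ℝ,
      (Complex.log (ε + Complex.I * ((Q p * (p.1 - p.2) : ℝ) : ℂ))
        - Complex.log (ε + Complex.I * ((p.1 - p.2 : ℝ) : ℂ)))
          * (deriv f₁ p.1 * deriv f₂ p.2)) (𝓝[>] 0)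
      (𝓝 (∫ p : ℝ × ℝ, (Real.log (Q p) : ℂ) * (deriv f₁ p.1 * deriv f₂ p.2))) := by
    refine tendsto_integral_filter_of_dominated_convergence
      (fun p => ‖((|Real.log (Q p)| + 2 * Real.pi : ℝ) : ℂ) * (deriv f₁ p.1 * deriv f₂ p.2)‖)
      ?_ ?_ (hint _ (by fun_prop)).norm ?_
    · filter_upwards [self_mem_nhdsWithin] with ε hε
      have h1 := hcl hxc hε
      have h2 := hcl continuous_id hε
      simp only [hxQ, id] at h1 h2
      exact ((h1.sub h2).mul (by fun_prop)).aestronglyMeasurable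
    · filter_upwards [self_mem_nhdsWithin] with ε hε
      refine ae_of_all _ fun p => ?_
      rw [norm_mul, norm_mul _ (deriv f₁ p.1 * deriv f₂ p.2), Complex.norm_real,
        Real.norm_of_nonneg (by positivity)]
      gcongr
      exact norm_log_regularized_sub_le hε (hQ0 p) _
    · filter_upwards [ae_fst_ne_snd] with p hpne
      exact ((tendsto_log_regularized_sub (hQ0 p) (sub_ne_zero.2 hpne)).mono_left
        nhdsWithin_le_nhds).mul_const _
  refine (hlim.const_mul _).congr' ?_
  filter_upwards [self_mem_nhdsWithin] with ε hε
  rw [twoPtReg_eq_log hx hf₁ hf₂ hε, twoPtReg_eq_log contDiff_id hf₁ hf₂ hε, ← mul_sub,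
    ← integral_sub (hint _ (hcl hxc hε)) (hint _ (hcl continuous_id hε))]
  congr 2
  funext p
  rw [hxQ, id, id, sub_mul]

/-- Off the diagonal the two-point function has the kernel `-1 / (4π (y - y')²)`. -/
theorem twoPt_id_offDiag {f₁ f₂ : ℝ → ℂ} (hf₁ : IsTest f₁) (hf₂ : IsTest f₂)
    (hO : tsupport f₁ ×ˢ tsupport f₂ ⊆ offDiag) :
    twoPt id (deriv f₁) (deriv f₂)
      = ∫ p : ℝ × ℝ, (-(1 / (4 * Real.pi) / (p.1 - p.2) ^ 2 : ℝ) : ℂ) * (f₁ p.1 * f₂ p.2) := by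
  have hid : ∀ y : ℝ, 0 < deriv id y := fun y => by simp
  obtain ⟨E₁, hE₁⟩ := logDecay_inHat_deriv contDiff_id hid hf₁
  obtain ⟨E₂, hE₂⟩ := logDecay_inHat_deriv contDiff_id hid hf₂
  refine tendsto_nhds_unique (tendsto_twoPtReg hE₁ hE₂) ?_
  have hc₁ := hf₁.continuous
  have hc₂ := hf₂.continuous
  -- The test functions vanish together with the denominator, so the undamped singular kernel does
  -- no harm.
  have hzero : ∀ p : ℝ × ℝ, p.1 = p.2 → f₁ p.1 * f₂ p.2 = 0 := by
    intro p hp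
    by_contra hne
    exact hO (a := p) ⟨subset_tsupport _ (left_ne_zero_of_mul hne),
      subset_tsupport _ (right_ne_zero_of_mul hne)⟩ hp
  have hn : ∀ (ε d : ℝ), d ^ 2 ≤ ‖(ε : ℂ) + Complex.I * (d : ℂ)‖ ^ 2 := fun ε d => by
    rw [← Complex.normSq_eq_norm_sq, Complex.normSq_apply]
    simp
    nlinarith [sq_nonneg ε]
  have hlim : Tendsto (fun ε : ℝ => ∫ p : ℝ × ℝ,
        (1 / (ε + Complex.I * ((p.1 - p.2 : ℝ) : ℂ)) ^ 2) * (f₁ p.1 * f₂ p.2)) (𝓝[>] 0)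
      (𝓝 (∫ p : ℝ × ℝ, (1 / (Complex.I * ((p.1 - p.2 : ℝ) : ℂ)) ^ 2) * (f₁ p.1 * f₂ p.2))) := by
    refine tendsto_integral_filter_of_dominated_convergence
      (fun p => ‖((1 / (p.1 - p.2) ^ 2 : ℝ) : ℂ) * (f₁ p.1 * f₂ p.2)‖) ?_ ?_
      (integrable_kernel_mul (O := offDiag) ?_ hc₁ hc₂ hf₁.2 hf₂.2 hO).norm ?_
    · filter_upwards [self_mem_nhdsWithin] with ε hε
      refine Continuous.aestronglyMeasurable (Continuous.mul (Continuous.div (by fun_prop)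
        (by fun_prop) fun p => ?_) (by fun_prop))
      exact pow_ne_zero 2 (Complex.slitPlane_ne_zero (slitPlane_regularized hε _))
    · filter_upwards [self_mem_nhdsWithin] with ε hε
      filter_upwards [ae_fst_ne_snd] with p hp
      have : 0 < (p.1 - p.2) ^ 2 := by
        have := sub_ne_zero.2 hp
        positivity
      rw [norm_mul, norm_mul _ (f₁ p.1 * f₂ p.2), Complex.norm_real,
        Real.norm_of_nonneg (by positivity), norm_div, norm_one, norm_pow]
      exact mul_le_mul_of_nonneg_right (one_div_le_one_div_of_le this (hn _ _)) (norm_nonneg _)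
    · refine Continuous.comp_continuousOn Complex.continuous_ofReal ?_
      refine continuousOn_const.div (by fun_prop) fun p hp => ?_
      exact pow_ne_zero 2 (sub_ne_zero.2 hp)
    · refine ae_of_all _ fun p => ?_
      by_cases hp : p.1 = p.2
      · simp only [hzero p hp, mul_zero]
        exact tendsto_const_nhds
      · refine Tendsto.mul_const _ ?_
        have hne : Complex.I * ((p.1 - p.2 : ℝ) : ℂ) ≠ 0 :=
          mul_ne_zero Complex.I_ne_zero (by exact_mod_cast sub_ne_zero.2 hp)
        have h : Continuous fun ε : ℝ => ((ε : ℂ) + Complex.I * ((p.1 - p.2 : ℝ) : ℂ)) ^ 2 := by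
          fun_prop
        have h0 := h.tendsto 0
        rw [Complex.ofReal_zero, zero_add] at h0
        exact (tendsto_const_nhds.div h0 (pow_ne_zero 2 hne)).mono_left nhdsWithin_le_nhds
  have hlim' := hlim.const_mul ((1 / (4 * Real.pi) : ℝ) : ℂ)
  rw [← integral_const_mul] at hlim'
  have e : ∀ p : ℝ × ℝ, ((1 / (4 * Real.pi) : ℝ) : ℂ) *
      ((1 / (Complex.I * ((p.1 - p.2 : ℝ) : ℂ)) ^ 2) * (f₁ p.1 * f₂ p.2))
      = (-(1 / (4 * Real.pi) / (p.1 - p.2) ^ 2 : ℝ) : ℂ) * (f₁ p.1 * f₂ p.2) := by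
    intro p
    rw [mul_pow, Complex.I_sq, neg_one_mul, div_neg]
    push_cast
    ring
  simp_rw [e] at hlim'
  refine hlim'.congr' ?_
  filter_upwards [self_mem_nhdsWithin] with ε hε
  rw [twoPtReg_eq contDiff_id hf₁ hf₂ hε]
  simp

/-! ### Divided differences -/

/-- `∫₀¹ c(t) φ(y' + t (y - y')) dt`. -/
noncomputable def chordMean (c φ : ℝ → ℝ) (p : ℝ × ℝ) : ℝ :=
  ∫ t in (0 : ℝ)..1, c t * φ ((1 - t) * p.2 + p.1 * t)

theorem continuous_chordMean {c φ : ℝ → ℝ} (hc : Continuous c) (hφ : Continuous φ) :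
    Continuous (chordMean c φ) := by
  unfold chordMean
  refine intervalIntegral.continuous_parametric_intervalIntegral_of_continuous' ?_ 0 1
  unfold Function.uncurry
  fun_prop

theorem hasDerivAt_integral_affine {a b c φ φ' : ℝ → ℝ} (ha : Continuous a) (hb : Continuous b)
    (hc : Continuous c) (hφ : ∀ y, HasDerivAt φ (φ' y) y) (hφ' : Continuous φ') (s₀ : ℝ) :
    HasDerivAt (fun s => ∫ t in (0 : ℝ)..1, c t * φ (a t + s * b t))
      (∫ t in (0 : ℝ)..1, (c t * b t) * φ' (a t + s₀ * b t)) s₀ := by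
  have hφc : Continuous φ := continuous_iff_continuousAt.2 fun y => (hφ y).continuousAt
  -- Compactness of a unit neighbourhood of `s₀` times [0,1] supplies the constant dominating the
  -- differentiated integrand.
  have hcpt : IsCompact (Icc (s₀ - 1) (s₀ + 1) ×ˢ Icc (0 : ℝ) 1) := isCompact_Icc.prod isCompact_Icc
  obtain ⟨M, hM⟩ := hcpt.exists_bound_of_continuousOn
    (f := fun q : ℝ × ℝ => (c q.2 * b q.2) * φ' (a q.2 + q.1 * b q.2))
    (Continuous.continuousOn (by fun_prop))
  refine (intervalIntegral.hasDerivAt_integral_of_dominated_loc_of_deriv_le (bound := fun _ => M)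
    (F := fun s t => c t * φ (a t + s * b t)) (F' := fun s t => (c t * b t) * φ' (a t + s * b t))
    (s := Icc (s₀ - 1) (s₀ + 1)) (Icc_mem_nhds (by linarith) (by linarith))
    (Eventually.of_forall fun s => Continuous.aestronglyMeasurable (by fun_prop))
    (Continuous.intervalIntegrable (by fun_prop) _ _)
    (Continuous.aestronglyMeasurable (by fun_prop)) (ae_of_all _ fun t ht s hs => ?_)
    intervalIntegrable_const (ae_of_all _ fun t ht s hs => ?_)).2
  · rw [uIoc_of_le zero_le_one] at ht
    exact hM (s, t) ⟨hs, Ioc_subset_Icc_self ht⟩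
  · have h1 : HasDerivAt (fun s => a t + s * b t) (b t) s := by
      simpa using ((hasDerivAt_id s).mul_const (b t)).const_add (a t)
    refine (((hφ (a t + s * b t)).comp s h1).const_mul (c t)).congr_deriv ?_
    ring

theorem hasDerivAt_chordMean_fst {c φ φ' : ℝ → ℝ} (hc : Continuous c)
    (hφ : ∀ y, HasDerivAt φ (φ' y) y) (hφ' : Continuous φ') (y y' : ℝ) :
    HasDerivAt (fun s => chordMean c φ (s, y')) (chordMean (fun t => c t * t) φ' (y, y')) y :=
  hasDerivAt_integral_affine (a := fun t => (1 - t) * y') (b := fun t => t) (by fun_prop)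
    (by fun_prop) hc hφ hφ' y

theorem hasDerivAt_chordMean_snd {c φ φ' : ℝ → ℝ} (hc : Continuous c)
    (hφ : ∀ y, HasDerivAt φ (φ' y) y) (hφ' : Continuous φ') (y y' : ℝ) :
    HasDerivAt (fun s => chordMean c φ (y, s))
      (chordMean (fun t => c t * (1 - t)) φ' (y, y')) y' := by
  have h := hasDerivAt_integral_affine (a := fun t => y * t) (b := fun t => 1 - t) (by fun_prop)
    (by fun_prop) hc hφ hφ' y'
  unfold chordMean
  simp only
  convert h using 3
  · ext; ring_nf
  · ring_nf

theorem chordMean_diag (c φ : ℝ → ℝ) (y : ℝ) :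
    chordMean c φ (y, y) = (∫ t in (0 : ℝ)..1, c t) * φ y := by
  unfold chordMean
  rw [← intervalIntegral.integral_mul_const]
  congr 1
  funext t
  simp only
  congr 2
  ring

/-- The fundamental theorem of calculus along the segment. It presents the divided difference as a
mean of the derivative, which remains regular, and positive if the derivative is, at coinciding
points. -/
theorem sub_eq_chordMean_mul {φ φ' : ℝ → ℝ} (hφ : ∀ y, HasDerivAt φ (φ' y) y)
    (hφ' : Continuous φ') (p : ℝ × ℝ) :
    φ p.1 - φ p.2 = chordMean (fun _ => 1) φ' p * (p.1 - p.2) := by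
  unfold chordMean
  rw [← intervalIntegral.integral_mul_const, intervalIntegral.integral_eq_sub_of_hasDerivAt
    (f := fun t => φ ((1 - t) * p.2 + p.1 * t))]
  · simp
  · intro t _
    have h1 : HasDerivAt (fun t : ℝ => (1 - t) * p.2 + p.1 * t) (p.1 - p.2) t := by
      have := (((hasDerivAt_id t).const_sub 1).mul_const p.2).add ((hasDerivAt_id t).const_mul p.1)
      refine this.congr_deriv ?_
      ring
    refine ((hφ _).comp t h1).congr_deriv ?_
    ring
  · exact Continuous.intervalIntegrable (by fun_prop) _ _

theorem chordMean_pos {φ : ℝ → ℝ} (hφ : Continuous φ) (hp : ∀ y, 0 < φ y) (p : ℝ × ℝ) :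
    0 < chordMean (fun _ => 1) φ p :=
  intervalIntegral.intervalIntegral_pos_of_pos (Continuous.intervalIntegrable (by fun_prop) _ _)
    (fun t => by simpa using hp _) one_pos

theorem integral_kernel_swap (K : ℝ × ℝ → ℂ) (f₁ f₂ : ℝ → ℂ) :
    ∫ p : ℝ × ℝ, K p * (f₂ p.1 * f₁ p.2) = ∫ p : ℝ × ℝ, K p.swap * (f₁ p.1 * f₂ p.2) := by
  rw [Measure.volume_eq_prod, ← integral_prod_swap]
  simp only [Prod.fst_swap, Prod.snd_swap, mul_comm (f₂ _)]

/-- The kernel is -(1/4π) times the mixed derivative of log Q, with Q the divided difference of `x`.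
Since log Q is symmetric, exchanging the test functions changes the two-point functions of `x` and
of `id` by the same amount: this is the coordinate independence of the commutator. -/
theorem exists_regular_kernel {x : ℝ → ℝ} (hx : ContDiff ℝ ∞ x) (hp : ∀ y, 0 < deriv x y) :
    ∃ K : ℝ × ℝ → ℂ, Continuous K ∧
      (∀ y, K (y, y) = (-(1 / (24 * Real.pi)) * schwarzian x y : ℝ)) ∧
      ∀ f₁ f₂ : ℝ → ℂ, IsTest f₁ → IsTest f₂ →
        twoPt x (deriv f₁) (deriv f₂) - twoPt id (deriv f₁) (deriv f₂)
          = ∫ p : ℝ × ℝ, K p * (f₁ p.1 * f₂ p.2) ∧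
        twoPt x (deriv f₁) (deriv f₂) - twoPt x (deriv f₂) (deriv f₁)
          = twoPt id (deriv f₁) (deriv f₂) - twoPt id (deriv f₂) (deriv f₁) := by
  have hx1 : ContDiff ℝ ∞ (deriv x) := (contDiff_infty_iff_deriv.1 hx).2
  have hx2 : ContDiff ℝ ∞ (deriv (deriv x)) := (contDiff_infty_iff_deriv.1 hx1).2
  have hx3 : ContDiff ℝ ∞ (deriv (deriv (deriv x))) := (contDiff_infty_iff_deriv.1 hx2).2
  have d0 : ∀ y, HasDerivAt x (deriv x y) y := fun y => (hx.differentiable (by simp) y).hasDerivAt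
  have d1 : ∀ y, HasDerivAt (deriv x) (deriv (deriv x) y) y :=
    fun y => (hx1.differentiable (by simp) y).hasDerivAt
  have d2 : ∀ y, HasDerivAt (deriv (deriv x)) (deriv (deriv (deriv x)) y) y :=
    fun y => (hx2.differentiable (by simp) y).hasDerivAt
  set Q := chordMean (fun _ => 1) (deriv x)
  set Q₁ := chordMean (fun t => 1 * t) (deriv (deriv x))
  set Q₂ := chordMean (fun t => 1 * (1 - t)) (deriv (deriv x))
  set Q₁₂ := chordMean (fun t => 1 * (1 - t) * t) (deriv (deriv (deriv x)))
  have cQ : Continuous Q := continuous_chordMean (by fun_prop) hx1.continuous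
  have cQ₁ : Continuous Q₁ := continuous_chordMean (by fun_prop) hx2.continuous
  have cQ₂ : Continuous Q₂ := continuous_chordMean (by fun_prop) hx2.continuous
  have cQ₁₂ : Continuous Q₁₂ := continuous_chordMean (by fun_prop) hx3.continuous
  have hQ0 : ∀ p, 0 < Q p := chordMean_pos hx1.continuous hp
  have hxQ : ∀ p : ℝ × ℝ, x p.1 - x p.2 = Q p * (p.1 - p.2) := sub_eq_chordMean_mul d0 hx1.continuous
  have hsymm : ∀ p : ℝ × ℝ, Q p.swap = Q p := by
    intro p
    by_cases h : p.1 = p.2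
    · congr 1
      ext <;> simp [h]
    · refine mul_right_cancel₀ (sub_ne_zero.2 h) ?_
      rw [← hxQ]
      have := hxQ p.swap
      simp only [Prod.fst_swap, Prod.snd_swap] at this
      linarith
  -- The quotient rule for the derivative of `Q₂ / Q` in the first variable, `Q₂ / Q` being the
  -- derivative of log Q in the second.
  set k : ℝ × ℝ → ℝ := fun p => (Q₁₂ p * Q p - Q₂ p * Q₁ p) / Q p ^ 2
  have ck : Continuous k :=
    ((cQ₁₂.mul cQ).sub (cQ₂.mul cQ₁)).div (cQ.pow 2) fun p => pow_ne_zero 2 (hQ0 p).ne'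
  refine ⟨fun p => -(1 / (4 * Real.pi) : ℝ) * (k p : ℂ), by fun_prop, fun y => ?_,
    fun f₁ f₂ hf₁ hf₂ => ⟨?_, ?_⟩⟩
  -- On the diagonal only the means of the weights t, 1 - t and t(1 - t) enter. They are 1/2, 1/2
  -- and 1/6 and produce the coefficients of the Schwarzian.
  · have a1 : ∫ t in (0 : ℝ)..1, (1 * (1 - t)) = 1 / 2 := by
      simp only [one_mul]
      rw [intervalIntegral.integral_sub (by simp) (by simp)]
      simp
      norm_num
    have a2 : ∫ t in (0 : ℝ)..1, (1 * (1 - t) * t) = 1 / 6 := by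
      have : ∀ t : ℝ, 1 * (1 - t) * t = t - t ^ 2 := fun t => by ring
      simp_rw [this]
      rw [intervalIntegral.integral_sub (by simp) (by simp)]
      simp
      norm_num
    have e : k (y, y) = schwarzian x y / 6 := by
      have h0 := (hp y).ne'
      have b : ∀ y, iteratedDeriv 2 x y = deriv (deriv x) y := fun y => by
        simp [iteratedDeriv_succ]
      have b3 : iteratedDeriv 3 x y = deriv (deriv (deriv x)) y := by
        simp [iteratedDeriv_succ]
      simp only [k, Q, Q₁, Q₂, Q₁₂, chordMean_diag, schwarzian, b, b3, a1, a2]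
      simp
      field_simp
      ring
    simp only
    rw [e]
    push_cast
    ring
  · rw [twoPt_sub_twoPt_id hx hp cQ hQ0 hxQ hf₁ hf₂]
    simp_rw [mul_assoc]
    rw [integral_const_mul]
    congr 1
    symm
    refine integral_mixed_deriv_mul (L₂ := fun p => ((Q₂ p / Q p : ℝ) : ℂ)) (fun y y' => ?_)
      (fun y y' => ?_) ?_ ?_ ?_ hf₁ hf₂
    · exact ((hasDerivAt_chordMean_snd continuous_const d1 hx2.continuous y y').log
        (hQ0 (y, y')).ne').ofReal_comp
    · exact ((hasDerivAt_chordMean_fst (by fun_prop) d2 hx3.continuous y y').div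
        (hasDerivAt_chordMean_fst continuous_const d1 hx2.continuous y y')
        (hQ0 (y, y')).ne').ofReal_comp
    · exact Complex.continuous_ofReal.comp (cQ.log fun p => (hQ0 p).ne')
    · exact Complex.continuous_ofReal.comp (cQ₂.div cQ fun p => (hQ0 p).ne')
    · exact Complex.continuous_ofReal.comp ck
  · have h12 := twoPt_sub_twoPt_id hx hp cQ hQ0 hxQ hf₁ hf₂
    have h21 := twoPt_sub_twoPt_id hx hp cQ hQ0 hxQ hf₂ hf₁
    rw [integral_kernel_swap] at h21
    simp_rw [hsymm] at h21
    linear_combination h12 - h21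

/-! ### Fourier inversion -/

theorem hat_eq_fourier (f : ℝ → ℂ) (k : ℝ) :
    hat f k = ((Real.sqrt (2 * Real.pi))⁻¹ : ℝ) * FourierTransform.fourier f ((2 * Real.pi)⁻¹ * k) := by
  unfold hat inHat
  rw [Real.fourier_real_eq_integral_exp_smul]
  congr 1
  refine integral_congr_ae (ae_of_all _ fun y => ?_)
  simp only [smul_eq_mul, id]
  congr 2
  have : (-2 * Real.pi * y * ((2 * Real.pi)⁻¹ * k) : ℝ) = -(k * y) := by
    have := Real.pi_ne_zero
    field_simp
  rw [this]
  push_cast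
  ring

theorem integral_exp_mul_hat {f : ℝ → ℂ} (hc : Continuous f) (hf : Integrable f)
    (hh : Integrable (hat f)) (y : ℝ) :
    (((Real.sqrt (2 * Real.pi))⁻¹ : ℝ) : ℂ) *
      ∫ p : ℝ, Complex.exp (Complex.I * (p : ℂ) * (y : ℂ)) * hat f p = f y := by
  have hpi : (0 : ℝ) < 2 * Real.pi := by positivity
  have hs : (((Real.sqrt (2 * Real.pi))⁻¹ : ℝ) : ℂ) ≠ 0 := by
    rw [Complex.ofReal_ne_zero]
    positivity
  have hF : Integrable (FourierTransform.fourier f) := by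
    have h1 := (hh.const_mul (((Real.sqrt (2 * Real.pi))⁻¹ : ℝ) : ℂ)⁻¹).comp_mul_left' hpi.ne'
    refine h1.congr (ae_of_all _ fun p => ?_)
    simp only [hat_eq_fourier]
    rw [inv_mul_cancel_left₀ hpi.ne', inv_mul_cancel_left₀ hs]
  have h := congrFun (hc.fourierInv_fourier_eq hf hF) y
  rw [Real.fourierInv_eq'] at h
  rw [← h]
  have h2 := Measure.integral_comp_mul_left (fun p : ℝ => Complex.exp (Complex.I * (p : ℂ) * (y : ℂ))
    * hat f p) (2 * Real.pi)
  have h3 : ∫ p : ℝ, Complex.exp (Complex.I * (p : ℂ) * (y : ℂ)) * hat f p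
      = (2 * Real.pi : ℝ) * ∫ p : ℝ, Complex.exp (Complex.I * ((2 * Real.pi * p : ℝ) : ℂ) * (y : ℂ))
        * hat f (2 * Real.pi * p) := by
    rw [h2, abs_of_pos (by positivity), Complex.real_smul, ← mul_assoc, ← Complex.ofReal_mul,
      mul_inv_cancel₀ hpi.ne', Complex.ofReal_one, one_mul]
  rw [h3, ← mul_assoc, ← integral_const_mul]
  refine integral_congr_ae (ae_of_all _ fun p => ?_)
  simp only [hat_eq_fourier, smul_eq_mul]
  rw [inv_mul_cancel_left₀ hpi.ne']
  have hc2 : (((Real.sqrt (2 * Real.pi))⁻¹ : ℝ) : ℂ) * ((2 * Real.pi : ℝ) : ℂ)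
      * (((Real.sqrt (2 * Real.pi))⁻¹ : ℝ) : ℂ) = 1 := by
    rw [← Complex.ofReal_mul, ← Complex.ofReal_mul, mul_right_comm, ← mul_inv,
      Real.mul_self_sqrt hpi.le, inv_mul_cancel₀ hpi.ne', Complex.ofReal_one]
  have he : Complex.exp (Complex.I * ((2 * Real.pi * p : ℝ) : ℂ) * (y : ℂ))
      = Complex.exp (((2 * Real.pi * inner ℝ p y : ℝ) : ℂ) * Complex.I) := by
    congr 1
    simp
    ring
  rw [he]
  linear_combination (Complex.exp (((2 * Real.pi * inner ℝ p y : ℝ) : ℂ) * Complex.I)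
    * FourierTransform.fourier f p) * hc2

/-- The inversion formula is applied to `m`, whose transform is `h` reflected and hence integrable.
-/
theorem hat_integral_exp_mul {m : ℝ → ℂ} (hc : Continuous m) (hm : Integrable m)
    {h : ℝ → ℂ} (hh : Integrable h) (e : ∀ y : ℝ, h y = (((Real.sqrt (2 * Real.pi))⁻¹ : ℝ) : ℂ) *
      ∫ p : ℝ, Complex.exp (Complex.I * (p : ℂ) * (y : ℂ)) * m p) (k : ℝ) : hat h k = m k := by
  have e1 : ∀ y, hat m y = h (-y) := by
    intro y
    rw [e]
    unfold hat inHat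
    congr 1
    refine integral_congr_ae (ae_of_all _ fun p => ?_)
    simp only [id]
    congr 2
    push_cast
    ring
  have hi : Integrable (hat m) := by
    rw [funext e1]
    exact hh.comp_neg
  rw [← integral_exp_mul_hat hc hm hi k]
  unfold hat inHat
  congr 1
  rw [← integral_neg_eq_self]
  refine integral_congr_ae (ae_of_all _ fun p => ?_)
  simp only [id]
  have := e1 p
  unfold hat at this
  rw [← this]
  congr 2
  push_cast
  ring

theorem norm_cexp_I_mul (p y : ℝ) : ‖Complex.exp (Complex.I * (p : ℂ) * (y : ℂ))‖ = 1 := by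
  rw [show Complex.I * (p : ℂ) * (y : ℂ) = ((p * y : ℝ) : ℂ) * Complex.I by push_cast; ring]
  exact Complex.norm_exp_ofReal_mul_I _

theorem integrable_cexp_mul {h : ℝ → ℂ} {μ : Measure ℝ} (hh : Integrable h μ) (y : ℝ) :
    Integrable (fun p : ℝ => Complex.exp (Complex.I * (p : ℂ) * (y : ℂ)) * h p) μ :=
  hh.bdd_mul (c := 1) (Continuous.aestronglyMeasurable (by fun_prop))
    (ae_of_all _ fun p => (norm_cexp_I_mul p y).le)

theorem posPart_add_negPart {f : ℝ → ℂ} (hc : Continuous f) (hf : Integrable f)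
    (hh : Integrable (hat f)) (y : ℝ) : posPart f y + negPart f y = f y := by
  rw [← integral_exp_mul_hat hc hf hh y]
  unfold posPart negPart
  rw [← mul_add, add_comm, ← integral_Iic_eq_integral_Iio]
  rw [← compl_Iic, integral_add_compl measurableSet_Iic (integrable_cexp_mul hh y)]

/-! ### Emission and absorption amplitudes -/

theorem integrable_hat_schwartz (g : 𝓢(ℝ, ℂ)) : Integrable (hat g) := by
  have hpi : (0 : ℝ) < 2 * Real.pi := by positivity
  have h1 : Integrable (FourierTransform.fourier (g : ℝ → ℂ)) := by
    rw [← SchwartzMap.fourier_coe]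
    exact SchwartzMap.integrable _
  have h2 := (h1.comp_mul_left' (inv_ne_zero hpi.ne')).const_mul
    (((Real.sqrt (2 * Real.pi))⁻¹ : ℝ) : ℂ)
  exact h2.congr (ae_of_all _ fun k => (hat_eq_fourier _ k).symm)

theorem posPart_schwartz {g : 𝓢(ℝ, ℂ)} (hg : ∀ k < 0, hat g k = 0) (y : ℝ) : posPart g y = g y := by
  rw [← posPart_add_negPart g.continuous g.integrable (integrable_hat_schwartz g)]
  have : negPart g y = 0 := by
    unfold negPart
    rw [setIntegral_eq_zero_of_forall_eq_zero fun k hk => by rw [hg k hk, mul_zero], mul_zero]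
  rw [this, add_zero]

theorem memLp_hat {g : 𝓢(ℝ, ℂ)} (hg : IsNormalizedTest g) :
    MemLp (fun k => hat g k) 2 momentumMeasure := by
  have hc : Continuous (fun k => hat g k) := continuous_inHat continuous_id g.integrable
  rw [memLp_two_iff_integrable_sq_norm hc.aestronglyMeasurable]
  -- The integral of a non-integrable function is zero by convention, so the normalization to one
  -- forces square integrability.
  by_contra h
  have := hg.2
  rw [integral_undef h] at this
  exact zero_ne_one this

/-- The factor -ik from the derivative cancels the weight 1/2k up to -i/2. What remains is the
Fourier inversion integral of `g` at x(y), over the half-line which carries all of `ĝ`. -/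
theorem emit_deriv {x : ℝ → ℝ} (hx : ContDiff ℝ ∞ x) {g : 𝓢(ℝ, ℂ)} (hg : ∀ k < 0, hat g k = 0)
    {f : ℝ → ℂ} (hf : IsTest f) :
    emit x g (deriv f) = -(Complex.I / 2) * ∫ y, deriv x y * g (x y) * f y := by
  have hxc := hx.continuous
  have hx1 : Continuous (deriv x) := hx.continuous_deriv (by simp)
  have hfc := hf.continuous
  have hgc : Continuous (hat g) := continuous_inHat continuous_id g.integrable
  have iu : Integrable (fun y => (deriv x y : ℝ) * f y) :=
    Continuous.integrable_of_hasCompactSupport (by fun_prop) hf.2.mul_left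
  have ig : IntegrableOn (hat g) (Ioi 0) := (integrable_hat_schwartz g).integrableOn
  unfold emit
  rw [integral_momentumMeasure]
  have e1 : ∀ k ∈ Ioi (0 : ℝ), (1 / (2 * k)) • (hat g k * inHat x (deriv f) (-k))
      = -(Complex.I / 2) * ((((Real.sqrt (2 * Real.pi))⁻¹ : ℝ) : ℂ) * ∫ y,
        hat g k * (Complex.exp (Complex.I * (k : ℂ) * (x y : ℂ)) * ((deriv x y : ℝ) * f y))) := by
    intro k hk
    have hk0 : (k : ℂ) ≠ 0 := by simpa using ne_of_gt hk
    rw [inHat_deriv hx hf, integral_const_mul, Complex.real_smul]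
    unfold inHat
    have : ∀ y, Complex.exp (-(Complex.I * ((-k : ℝ) : ℂ) * (x y : ℂ)))
        = Complex.exp (Complex.I * (k : ℂ) * (x y : ℂ)) := fun y => by
      congr 1; push_cast; ring
    simp_rw [this]
    push_cast
    field_simp
  rw [setIntegral_congr_fun measurableSet_Ioi e1, integral_const_mul, integral_const_mul]
  congr 1
  have hF : Integrable (Function.uncurry fun (k y : ℝ) =>
      hat g k * (Complex.exp (Complex.I * (k : ℂ) * (x y : ℂ)) * ((deriv x y : ℝ) * f y)))
      ((volume.restrict (Ioi 0)).prod volume) := by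
    refine (Integrable.mul_prod ig iu).mono (Continuous.aestronglyMeasurable ?_)
      (ae_of_all _ fun q => ?_)
    · unfold Function.uncurry
      fun_prop
    · simp only [Function.uncurry, norm_mul, norm_cexp_I_mul, one_mul]
      exact le_rfl
  rw [integral_integral_swap hF, ← integral_const_mul]
  refine integral_congr_ae (ae_of_all _ fun y => ?_)
  simp only
  rw [← posPart_schwartz hg, posPart]
  have : ∀ k : ℝ, hat g k * (Complex.exp (Complex.I * (k : ℂ) * (x y : ℂ)) * ((deriv x y : ℝ) * f y))
      = Complex.exp (Complex.I * (k : ℂ) * (x y : ℂ)) * hat g k * ((deriv x y : ℝ) * f y) :=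
    fun k => by ring
  simp_rw [this]
  rw [integral_mul_const]
  ring

/-- Absorption by `f` is the conjugate of emission by the conjugate of `f`. -/
theorem absorb_deriv {x : ℝ → ℝ} (hx : ContDiff ℝ ∞ x) {g : 𝓢(ℝ, ℂ)} (hg : ∀ k < 0, hat g k = 0)
    {f : ℝ → ℂ} (hf : IsTest f) :
    absorb x g (deriv f) = Complex.I / 2 * ∫ y, conj (deriv x y * g (x y)) * f y := by
  have hfs : IsTest (fun y => conj (f y)) :=
    ⟨Complex.conjCLE.contDiff.comp hf.1, hf.2.comp_left (g := conj) (map_zero _)⟩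
  have hd : ∀ y, deriv (fun y => conj (f y)) y = conj (deriv f y) := fun y =>
    (Complex.conjCLE.hasFDerivAt.comp_hasDerivAt y (hf.hasDerivAt y)).deriv
  have h := congrArg conj (emit_deriv hx hg hfs)
  have e : conj (emit x g (deriv fun y => conj (f y))) = absorb x g (deriv f) := by
    unfold emit absorb
    rw [← integral_conj]
    refine integral_congr_ae (ae_of_all _ fun k => ?_)
    simp only
    rw [map_mul, mul_comm]
    congr 1
    unfold inHat
    rw [map_mul, Complex.conj_ofReal, ← integral_conj]
    congr 1
    refine integral_congr_ae (ae_of_all _ fun y => ?_)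
    simp only
    rw [hd, map_mul, Complex.conj_conj, ← Complex.exp_conj]
    congr 2
    simp
  rw [← e, h, map_mul, ← integral_conj]
  congr 1
  · have h2 : conj (2 : ℂ) = 2 := Complex.conj_ofReal 2
    rw [map_neg, map_div₀, Complex.conj_I, h2]
    ring
  · refine integral_congr_ae (ae_of_all _ fun y => ?_)
    simp

/-! ### Logarithmic decay of Fourier transforms along the transformation of coordinates -/

/-- The left side is the integral of 1/(1 + y²) beyond `Y`; the lemma controls the tails left by
truncation. -/
theorem pi_div_two_sub_arctan_le {Y : ℝ} (hY : 0 ≤ Y) :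
    Real.pi / 2 - Real.arctan Y ≤ 4 / (1 + Y) := by
  rw [le_div_iff₀ (by positivity)]
  rcases le_total Y 1 with h | h
  · have h0 : 0 ≤ Real.arctan Y := Real.arctan_nonneg.2 hY
    nlinarith [Real.pi_le_four]
  · have hY0 : 0 < Y := by linarith
    have h1 : Real.pi / 2 - Real.arctan Y = Real.arctan Y⁻¹ := (Real.arctan_inv_of_pos hY0).symm
    have h2 : Real.arctan Y⁻¹ ≤ Y⁻¹ := by
      have h3 := Real.le_tan (Real.arctan_nonneg.2 (by positivity : 0 ≤ Y⁻¹))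
        (Real.arctan_lt_pi_div_two _)
      rwa [Real.tan_arctan] at h3
    rw [h1]
    calc Real.arctan Y⁻¹ * (1 + Y) ≤ Y⁻¹ * (1 + Y) := by gcongr
      _ = Y⁻¹ + 1 := by field_simp
      _ ≤ 4 := by linarith [inv_le_one_of_one_le₀ h]

theorem integrable_const_mul_inv_one_add_sq (M : ℝ) : Integrable (fun y : ℝ => M / (1 + y ^ 2)) := by
  simpa [div_eq_mul_inv] using integrable_inv_one_add_sq.const_mul M

theorem norm_integral_le_truncated {F : ℝ → ℂ} {M : ℝ} (hF : Integrable F)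
    (hM : ∀ y, ‖F y‖ ≤ M / (1 + y ^ 2)) {Y : ℝ} (hY : 0 ≤ Y) :
    ‖∫ y, F y‖ ≤ ‖∫ y in -Y..Y, F y‖ + 8 * M / (1 + Y) := by
  have hM0 : 0 ≤ M := by simpa using (norm_nonneg _).trans (hM 0)
  have hi := integrable_const_mul_inv_one_add_sq M
  have e : ∫ y, F y = (∫ y in -Y..Y, F y) + ((∫ y in Iic (-Y), F y) + ∫ y in Ioi Y, F y) := by
    rw [← intervalIntegral.integral_Iic_sub_Iic hF.integrableOn hF.integrableOn,
      ← integral_add_compl measurableSet_Iic hF, compl_Iic]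
    ring
  have h1 : ‖∫ y in Iic (-Y), F y‖ ≤ M * (Real.pi / 2 - Real.arctan Y) := by
    refine (norm_integral_le_of_norm_le hi.integrableOn (ae_of_all _ hM)).trans_eq ?_
    simp_rw [div_eq_mul_inv]
    rw [integral_const_mul, integral_Iic_inv_one_add_sq, Real.arctan_neg]
    ring
  have h2 : ‖∫ y in Ioi Y, F y‖ ≤ M * (Real.pi / 2 - Real.arctan Y) := by
    refine (norm_integral_le_of_norm_le hi.integrableOn (ae_of_all _ hM)).trans_eq ?_
    simp_rw [div_eq_mul_inv]
    rw [integral_const_mul, integral_Ioi_inv_one_add_sq]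
    ring
  have h3 := mul_le_mul_of_nonneg_left (pi_div_two_sub_arctan_le hY) hM0
  rw [e]
  calc _ ≤ ‖∫ y in -Y..Y, F y‖ + (‖∫ y in Iic (-Y), F y‖ + ‖∫ y in Ioi Y, F y‖) :=
        (norm_add_le _ _).trans (add_le_add_right (norm_add_le _ _) _)
    _ ≤ ‖∫ y in -Y..Y, F y‖ + (M * (4 / (1 + Y)) + M * (4 / (1 + Y))) := by linarith
    _ = _ := by ring

/-- The hypothesis says that log x' has slope at most `C`; hence x' and 1/x' grow at most like
e^{C|y|}. -/
theorem abs_log_deriv_sub_le {x : ℝ → ℝ} (hx : ContDiff ℝ ∞ x) (hp : ∀ y, 0 < deriv x y) {C : ℝ}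
    (hC : ∀ y, |deriv (deriv x) y| ≤ C * deriv x y) (y : ℝ) :
    |Real.log (deriv x y) - Real.log (deriv x 0)| ≤ C * |y| := by
  have hx1 : ContDiff ℝ ∞ (deriv x) := (contDiff_infty_iff_deriv.1 hx).2
  have d1 : ∀ y, HasDerivAt (fun y => Real.log (deriv x y)) (deriv (deriv x) y / deriv x y) y :=
    fun y => ((hx1.differentiable (by simp) y).hasDerivAt).log (hp y).ne'
  have h := convex_univ.norm_image_sub_le_of_norm_hasDerivWithin_le (C := C)
    (fun y _ => (d1 y).hasDerivWithinAt) (fun y _ => ?_) (mem_univ 0) (mem_univ y)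
  · simpa using h
  · rw [norm_div, Real.norm_eq_abs, Real.norm_of_nonneg (hp y).le, div_le_iff₀ (hp y)]
    exact hC y

theorem deriv_le_exp {x : ℝ → ℝ} (hx : ContDiff ℝ ∞ x) (hp : ∀ y, 0 < deriv x y) {C : ℝ}
    (hC : ∀ y, |deriv (deriv x) y| ≤ C * deriv x y) (y : ℝ) :
    deriv x y ≤ deriv x 0 * Real.exp (C * |y|) := by
  have h := (abs_le.1 (abs_log_deriv_sub_le hx hp hC y)).2
  rw [← Real.log_le_log_iff (hp y) (mul_pos (hp 0) (Real.exp_pos _)),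
    Real.log_mul (hp 0).ne' (Real.exp_pos _).ne', Real.log_exp]
  linarith

theorem inv_deriv_le_exp {x : ℝ → ℝ} (hx : ContDiff ℝ ∞ x) (hp : ∀ y, 0 < deriv x y) {C : ℝ}
    (hC : ∀ y, |deriv (deriv x) y| ≤ C * deriv x y) (y : ℝ) :
    (deriv x y)⁻¹ ≤ (deriv x 0)⁻¹ * Real.exp (C * |y|) := by
  have h := (abs_le.1 (abs_log_deriv_sub_le hx hp hC y)).1
  rw [← Real.log_le_log_iff (inv_pos.2 (hp y)) (mul_pos (inv_pos.2 (hp 0)) (Real.exp_pos _)),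
    Real.log_mul (inv_pos.2 (hp 0)).ne' (Real.exp_pos _).ne', Real.log_exp, Real.log_inv,
    Real.log_inv]
  linarith

theorem abs_sub_le_exp {x : ℝ → ℝ} (hx : ContDiff ℝ ∞ x) (hp : ∀ y, 0 < deriv x y) {C : ℝ}
    (hC0 : 0 ≤ C) (hC : ∀ y, |deriv (deriv x) y| ≤ C * deriv x y) (y : ℝ) :
    |x y - x 0| ≤ deriv x 0 * Real.exp (C * |y|) * |y| := by
  have h := (convex_Icc (-|y|) |y|).norm_image_sub_le_of_norm_hasDerivWithin_le (f := x)
    (C := deriv x 0 * Real.exp (C * |y|))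
    (fun t _ => (hx.differentiable (by simp) t).hasDerivAt.hasDerivWithinAt) (fun t ht => ?_)
    (x := 0) (y := y) ⟨by simp, by simp⟩ ⟨neg_abs_le y, le_abs_self y⟩
  · simpa using h
  · rw [Real.norm_of_nonneg (hp t).le]
    refine (deriv_le_exp hx hp hC t).trans ?_
    have := (hp 0).le
    have := abs_le.2 ht
    gcongr

theorem norm_phase_sub_phase_le (k s t : ℝ) :
    ‖Complex.exp (-(Complex.I * (k : ℂ) * (s : ℂ))) - Complex.exp (-(Complex.I * (k : ℂ) * (t : ℂ)))‖
      ≤ |k| * |s - t| := by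
  have e : Complex.exp (-(Complex.I * (k : ℂ) * (s : ℂ)))
      - Complex.exp (-(Complex.I * (k : ℂ) * (t : ℂ)))
      = Complex.exp (-(Complex.I * (k : ℂ) * (t : ℂ))) *
        (Complex.exp (Complex.I * ((-(k * (s - t)) : ℝ) : ℂ)) - 1) := by
    rw [mul_sub, ← Complex.exp_add, mul_one]
    congr 2
    push_cast
    ring
  rw [e, norm_mul, norm_phase, one_mul]
  refine (Real.norm_exp_I_mul_ofReal_sub_one_le).trans_eq ?_
  rw [norm_neg, norm_mul, Real.norm_eq_abs, Real.norm_eq_abs]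

/-- One factor on the left comes from the length of the truncated interval, the other from the
logarithmic rate to be proved. The exponential gain e^{-L/2} absorbs both. -/
theorem poly_le_exp_half {L : ℝ} (hL : 0 ≤ L) : (2 + L) * (1 + L) ≤ 10 * Real.exp (L / 2) := by
  have := Real.quadratic_le_exp_of_nonneg (x := L / 2) (by positivity)
  nlinarith

/-- Logarithmic decay, with a constant which depends only on the transformation of coordinates. -/
theorem exists_logDecay_inHat {x : ℝ → ℝ} (hx : ContDiff ℝ ∞ x) (hp : ∀ y, 0 < deriv x y) {C : ℝ}
    (hC0 : 0 ≤ C) (hC : ∀ y, |deriv (deriv x) y| ≤ C * deriv x y) :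
    ∃ D : ℝ, 0 ≤ D ∧ ∀ (h h' : ℝ → ℂ) (M : ℝ), (∀ y, HasDerivAt h (h' y) y) → Continuous h' →
      (∀ y, ‖h y‖ ≤ M / (1 + y ^ 2)) → (∀ y, ‖h' y‖ ≤ M / (1 + y ^ 2)) → ∫ y, h y = 0 →
      LogDecay (D * M) (fun k => inHat x h k) := by
  have hx1 : ContDiff ℝ ∞ (deriv x) := (contDiff_infty_iff_deriv.1 hx).2
  have hx2 : ContDiff ℝ ∞ (deriv (deriv x)) := (contDiff_infty_iff_deriv.1 hx1).2
  have hxc := hx.continuous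
  have hx1c := hx1.continuous
  have hx2c := hx2.continuous
  set a := deriv x 0 with ha
  have ha0 : 0 < a := hp 0
  have hγ : 0 < C + 1 := by linarith
  -- The three terms come from the tails, from |k| ≤ 1 and from |k| ≥ 1.
  refine ⟨32 * (C + 1) + 10 * a + 10 * a⁻¹, by positivity, fun h h' M hd hc' hM hM' h0 => ?_⟩
  have hc : Continuous h := continuous_iff_continuousAt.2 fun y => (hd y).continuousAt
  have hi : Integrable h := (integrable_const_mul_inv_one_add_sq M).mono'
    hc.aestronglyMeasurable (ae_of_all _ hM)
  have hM0 : 0 ≤ M := by simpa using (norm_nonneg _).trans (hM 0)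
  have hle : ∀ y : ℝ, M / (1 + y ^ 2) ≤ M := fun y =>
    div_le_self hM0 (by nlinarith [sq_nonneg y])
  refine ⟨continuous_inHat hxc hi, fun k hk => ?_⟩
  have hk0 : 0 < |k| := abs_pos.2 hk
  set L := |Real.log k| with hL
  have hL0 : 0 ≤ L := abs_nonneg _
  -- The cutoff is proportional to |log k|: the tails are then of order 1/L, while the exponential
  -- growth of x' or 1/x' inside costs at most half of the power of `k` available.
  set Y := L / (2 * (C + 1)) with hYdef
  have hY0 : 0 ≤ Y := by positivity
  have hYL : 2 * (C + 1) * Y = L := by rw [hYdef]; field_simp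
  have hCY : C * Y ≤ L / 2 := by nlinarith
  have hpoly := poly_le_exp_half hL0
  have hexp : Real.exp (L / 2) * Real.exp (-(L / 2)) = 1 := by
    rw [← Real.exp_add, add_neg_cancel, Real.exp_zero]
  have hpoly' : (2 + L) * (1 + L) * Real.exp (-(L / 2)) ≤ 10 := by
    calc _ ≤ 10 * Real.exp (L / 2) * Real.exp (-(L / 2)) := by gcongr
      _ = 10 := by rw [mul_assoc, hexp, mul_one]
  have hphase : Continuous fun y => Complex.exp (-(Complex.I * (k : ℂ) * (x y : ℂ))) := by fun_prop
  -- the main term, over the interval `[-Y, Y]`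
  have main : ∃ E : ℝ → ℂ, Continuous E ∧ (∀ y, ‖E y‖ ≤ 2) ∧
      ∫ y, Complex.exp (-(Complex.I * (k : ℂ) * (x y : ℂ))) * h y = ∫ y, E y * h y ∧
      ‖∫ y in -Y..Y, E y * h y‖ * (1 + L) ≤ (10 * a + 10 * a⁻¹) * M := by
    rcases le_total |k| 1 with hk1 | hk1
    -- For small `k` the mean zero of `h` allows a constant phase to be subtracted. The difference
    -- of phases is at most |k| |x(y) - x(0)|, hence at most a e^{-L + (C+1)Y} = a e^{-L/2} on the
    -- interval.
    · refine ⟨fun y => Complex.exp (-(Complex.I * (k : ℂ) * (x y : ℂ)))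
        - Complex.exp (-(Complex.I * (k : ℂ) * (x 0 : ℂ))), by fun_prop, fun y => ?_, ?_, ?_⟩
      · refine (norm_sub_le _ _).trans_eq ?_
        rw [norm_phase, norm_phase]
        norm_num
      · simp_rw [sub_mul]
        rw [integral_sub (integrable_phase_mul hxc hi k) (hi.const_mul _), integral_const_mul, h0,
          mul_zero, sub_zero]
      · have hkL : |k| = Real.exp (-L) := by
          rw [hL, ← Real.log_abs, abs_of_nonpos (Real.log_nonpos hk0.le hk1), neg_neg,
            Real.exp_log hk0]
        have hb : ∀ y ∈ uIoc (-Y) Y, ‖(Complex.exp (-(Complex.I * (k : ℂ) * (x y : ℂ)))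
            - Complex.exp (-(Complex.I * (k : ℂ) * (x 0 : ℂ)))) * h y‖
            ≤ a * Real.exp (-(L / 2)) * M := by
          intro y hy
          rw [uIoc_of_le (by linarith)] at hy
          have hyY : |y| ≤ Y := abs_le.2 ⟨hy.1.le, hy.2⟩
          rw [norm_mul]
          refine mul_le_mul ?_ ((hM y).trans (hle y)) (norm_nonneg _) (by positivity)
          refine (norm_phase_sub_phase_le _ _ _).trans ?_
          have hyexp : |y| ≤ Real.exp Y := hyY.trans (by linarith [Real.add_one_le_exp Y])
          calc |k| * |x y - x 0| ≤ Real.exp (-L) * (a * Real.exp (C * Y) * Real.exp Y) := by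
                rw [hkL]
                gcongr
                refine (abs_sub_le_exp hx hp hC0 hC y).trans ?_
                gcongr
            _ = a * (Real.exp (-L) * Real.exp (C * Y) * Real.exp Y) := by ring
            _ = a * Real.exp (-(L / 2)) := by
                rw [← Real.exp_add, ← Real.exp_add]
                congr 2
                linarith
        have hn := intervalIntegral.norm_integral_le_of_norm_le_const hb
        rw [abs_of_nonneg (by linarith)] at hn
        have hYL' : Y - -Y ≤ 2 + L := by nlinarith
        calc _ ≤ a * Real.exp (-(L / 2)) * M * (Y - -Y) * (1 + L) := by gcongr
          _ ≤ a * Real.exp (-(L / 2)) * M * (2 + L) * (1 + L) := by gcongr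
          _ = a * M * ((2 + L) * (1 + L) * Real.exp (-(L / 2))) := by ring
          _ ≤ a * M * 10 := by gcongr
          _ ≤ (10 * a + 10 * a⁻¹) * M := by
              have : 0 ≤ a⁻¹ * M := by positivity
              nlinarith
    -- For large `k` an integration by parts with w = h/x' gains 1/|k| = e^{-L}. Both `w` and its
    -- derivative are of order e^{L/2} on the interval.
    · refine ⟨_, hphase, fun y => ?_, rfl, ?_⟩
      · rw [norm_phase]
        norm_num
      have hkL : |k| = Real.exp L := by
        rw [hL, ← Real.log_abs, abs_of_nonneg (Real.log_nonneg hk1), Real.exp_log hk0]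
      set B := a⁻¹ * Real.exp (L / 2) * M with hB
      have hinv : ∀ y, |y| ≤ Y → (deriv x y)⁻¹ ≤ a⁻¹ * Real.exp (L / 2) := by
        intro y hy
        refine (inv_deriv_le_exp hx hp hC y).trans ?_
        rw [← ha]
        gcongr
        exact (mul_le_mul_of_nonneg_left hy hC0).trans hCY
      have hne : ∀ y, ((deriv x y : ℝ) : ℂ) ≠ 0 := fun y => by simpa using (hp y).ne'
      have hquot : ∀ y, |y| ≤ Y → ∀ (z : ℂ), ‖z‖ ≤ M → ‖z / ((deriv x y : ℝ) : ℂ)‖ ≤ B := by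
        intro y hy z hz
        rw [norm_div, Complex.norm_real, Real.norm_of_nonneg (hp y).le, div_eq_inv_mul, hB]
        have := inv_pos.2 (hp y)
        gcongr
        exact hinv y hy
      let w : ℝ → ℂ := fun y => h y / ((deriv x y : ℝ) : ℂ)
      let w' : ℝ → ℂ := fun y => h' y / ((deriv x y : ℝ) : ℂ)
        - h y / ((deriv x y : ℝ) : ℂ) * ((deriv (deriv x) y / deriv x y : ℝ) : ℂ)
      have hw : ∀ y, HasDerivAt w (w' y) y := by
        intro y
        have h1 : HasDerivAt (fun y => ((deriv x y : ℝ) : ℂ)) ((deriv (deriv x) y : ℝ) : ℂ) y :=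
          ((hx1.differentiable (by simp)) y).hasDerivAt.ofReal_comp
        refine ((hd y).fun_div h1 (hne y)).congr_deriv ?_
        have := hne y
        simp only [w']
        push_cast
        field_simp
      have hw'c : Continuous w' := by
        have hq : Continuous fun y => deriv (deriv x) y / deriv x y :=
          hx2c.div hx1c fun y => (hp y).ne'
        refine (hc'.div (by fun_prop) hne).sub ((hc.div (by fun_prop) hne).mul ?_)
        exact Complex.continuous_ofReal.comp hq
      have hwb : ∀ y, |y| ≤ Y → ‖w y‖ ≤ B := fun y hy => hquot y hy _ ((hM y).trans (hle y))
      have hB0 : 0 ≤ B := by positivity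
      have hw'b : ∀ y, |y| ≤ Y → ‖w' y‖ ≤ B * (C + 1) := by
        intro y hy
        refine (norm_sub_le _ _).trans ?_
        have h1 := hquot y hy _ ((hM' y).trans (hle y))
        have h2 : ‖((deriv (deriv x) y / deriv x y : ℝ) : ℂ)‖ ≤ C := by
          rw [Complex.norm_real, norm_div, Real.norm_eq_abs, Real.norm_of_nonneg (hp y).le,
            div_le_iff₀ (hp y)]
          exact hC y
        have h3 : ‖w y * ((deriv (deriv x) y / deriv x y : ℝ) : ℂ)‖ ≤ B * C := by
          rw [norm_mul]
          exact mul_le_mul (hwb y hy) h2 (norm_nonneg _) hB0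
        calc _ ≤ B + B * C := add_le_add h1 h3
          _ = _ := by ring
      let e : ℝ → ℂ := fun y => Complex.exp (-(Complex.I * (k : ℂ) * (x y : ℂ)))
      have hFTC : ∫ y in -Y..Y, (-(Complex.I * k) * (e y * h y) + e y * w' y)
          = e Y * w Y - e (-Y) * w (-Y) := by
        refine intervalIntegral.integral_eq_sub_of_hasDerivAt (f := fun y => e y * w y)
          (fun y _ => ?_) (Continuous.intervalIntegrable (by fun_prop) _ _)
        refine ((hasDerivAt_phase ((hx.differentiable (by simp)) y).hasDerivAt k).fun_mul
          (hw y)).congr_deriv ?_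
        have := hne y
        simp only [w, e]
        field_simp
      rw [intervalIntegral.integral_add (Continuous.intervalIntegrable (by fun_prop) _ _)
        (Continuous.intervalIntegrable (by fun_prop) _ _),
        intervalIntegral.integral_const_mul] at hFTC
      have hJ : ‖∫ y in -Y..Y, e y * w' y‖ ≤ B * (C + 1) * (Y - -Y) := by
        have := intervalIntegral.norm_integral_le_of_norm_le_const (a := -Y) (b := Y)
          (f := fun y => e y * w' y) (C := B * (C + 1)) (fun y hy => by
            rw [uIoc_of_le (by linarith)] at hy
            rw [norm_mul, norm_phase, one_mul]
            exact hw'b y (abs_le.2 ⟨hy.1.le, hy.2⟩))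
        rwa [abs_of_nonneg (by linarith)] at this
      have hkI : |k| * ‖∫ y in -Y..Y, e y * h y‖ ≤ B * (2 + L) := by
        have e1 : -(Complex.I * k) * ∫ y in -Y..Y, e y * h y
            = e Y * w Y - e (-Y) * w (-Y) - ∫ y in -Y..Y, e y * w' y :=
          eq_sub_of_add_eq hFTC
        have e2 : |k| * ‖∫ y in -Y..Y, e y * h y‖ = ‖-(Complex.I * k) * ∫ y in -Y..Y, e y * h y‖ := by
          rw [norm_mul, norm_neg, norm_mul, Complex.norm_I, one_mul, Complex.norm_real,
            Real.norm_eq_abs]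
        rw [e2, e1]
        have b1 : ‖e Y * w Y‖ ≤ B := by
          rw [norm_mul, norm_phase, one_mul]
          exact hwb Y (abs_of_nonneg hY0).le
        have b2 : ‖e (-Y) * w (-Y)‖ ≤ B := by
          rw [norm_mul, norm_phase, one_mul]
          exact hwb (-Y) (by rw [abs_neg, abs_of_nonneg hY0])
        have b3 : B * (C + 1) * (Y - -Y) = B * L := by rw [← hYL]; ring
        calc _ ≤ ‖e Y * w Y‖ + ‖e (-Y) * w (-Y)‖ + ‖∫ y in -Y..Y, e y * w' y‖ :=
              (norm_sub_le _ _).trans (add_le_add_left (norm_sub_le _ _) _)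
          _ ≤ B + B + B * L := by linarith
          _ = _ := by ring
      have hI : ‖∫ y in -Y..Y, e y * h y‖ ≤ a⁻¹ * M * (2 + L) * Real.exp (-(L / 2)) := by
        refine le_of_mul_le_mul_left (hkI.trans_eq ?_) hk0
        have : Real.exp L * Real.exp (-(L / 2)) = Real.exp (L / 2) := by
          rw [← Real.exp_add]
          congr 1
          ring
        rw [hB, hkL, ← this]
        ring
      calc _ ≤ a⁻¹ * M * (2 + L) * Real.exp (-(L / 2)) * (1 + L) := by gcongr
        _ = a⁻¹ * M * ((2 + L) * (1 + L) * Real.exp (-(L / 2))) := by ring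
        _ ≤ a⁻¹ * M * 10 := by gcongr
        _ ≤ (10 * a + 10 * a⁻¹) * M := by
            have : 0 ≤ a * M := by positivity
            nlinarith
  obtain ⟨E, hEc, hE2, hEeq, hEb⟩ := main
  have hEh : ∀ y, ‖E y * h y‖ ≤ 2 * M / (1 + y ^ 2) := fun y => by
    rw [norm_mul, mul_div_assoc]
    exact mul_le_mul (hE2 y) (hM y) (norm_nonneg _) zero_le_two
  have hEi : Integrable (fun y => E y * h y) :=
    hi.bdd_mul (c := 2) hEc.aestronglyMeasurable (ae_of_all _ hE2)
  have ht := norm_integral_le_truncated hEi hEh hY0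
  have hc1 : (Real.sqrt (2 * Real.pi))⁻¹ ≤ 1 := by
    refine inv_le_one_of_one_le₀ (Real.one_le_sqrt.2 ?_)
    linarith [Real.pi_gt_three]
  rw [le_div_iff₀ (by positivity)]
  have hin : ‖inHat x h k‖ ≤ ‖∫ y in -Y..Y, E y * h y‖ + 8 * (2 * M) / (1 + Y) := by
    unfold inHat
    rw [norm_mul, Complex.norm_real, Real.norm_of_nonneg (by positivity), hEeq]
    calc _ ≤ 1 * ‖∫ y, E y * h y‖ := by gcongr
      _ ≤ _ := by rw [one_mul]; exact ht
  -- Here 1 + L = 1 + 2(C+1)Y is at most 2(C+1)(1 + Y).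
  have htail : 8 * (2 * M) / (1 + Y) * (1 + L) ≤ 32 * (C + 1) * M := by
    rw [div_mul_eq_mul_div, div_le_iff₀ (by positivity), ← hYL]
    have h1 : 0 ≤ M * Y := by positivity
    have h2 : 0 ≤ M * C := by positivity
    have h3 : 0 ≤ M * (C * Y) := by positivity
    nlinarith
  calc _ ≤ (‖∫ y in -Y..Y, E y * h y‖ + 8 * (2 * M) / (1 + Y)) * (1 + L) := by gcongr
    _ = ‖∫ y in -Y..Y, E y * h y‖ * (1 + L) + 8 * (2 * M) / (1 + Y) * (1 + L) := by ring
    _ ≤ (10 * a + 10 * a⁻¹) * M + 32 * (C + 1) * M := add_le_add hEb htail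
    _ = _ := by ring

/-! ### Slowly decaying test functions -/

/-- Smooth functions which decay like `1/|y|`, with two derivatives decaying like `1/y²`. -/
def IsTame (M : ℝ) (G : ℝ → ℂ) : Prop :=
  ContDiff ℝ ∞ G ∧ (∀ y, ‖G y‖ ≤ M / (1 + |y|)) ∧ (∀ y, ‖deriv G y‖ ≤ M / (1 + y ^ 2)) ∧
    ∀ y, ‖deriv (deriv G) y‖ ≤ M / (1 + y ^ 2)

theorem IsTame.contDiff_deriv {M : ℝ} {G : ℝ → ℂ} (hG : IsTame M G) : ContDiff ℝ ∞ (deriv G) :=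
  (contDiff_infty_iff_deriv.1 hG.1).2

theorem IsTame.hasDerivAt {M : ℝ} {G : ℝ → ℂ} (hG : IsTame M G) (y : ℝ) :
    HasDerivAt G (_root_.deriv G y) y :=
  (hG.1.differentiable (by simp) y).hasDerivAt

theorem IsTame.hasDerivAt_deriv {M : ℝ} {G : ℝ → ℂ} (hG : IsTame M G) (y : ℝ) :
    HasDerivAt (deriv G) (deriv (deriv G) y) y :=
  (hG.contDiff_deriv.differentiable (by simp) y).hasDerivAt

theorem IsTame.continuous_deriv_deriv {M : ℝ} {G : ℝ → ℂ} (hG : IsTame M G) :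
    Continuous (deriv (deriv G)) :=
  (contDiff_infty_iff_deriv.1 hG.contDiff_deriv).2.continuous

theorem IsTame.integrable_deriv {M : ℝ} {G : ℝ → ℂ} (hG : IsTame M G) : Integrable (deriv G) :=
  (integrable_const_mul_inv_one_add_sq M).mono' hG.contDiff_deriv.continuous.aestronglyMeasurable
    (ae_of_all _ hG.2.2.1)

theorem IsTame.sub {M N : ℝ} {G H : ℝ → ℂ} (hG : IsTame M G) (hH : IsTame N H) :
    IsTame (M + N) (fun y => G y - H y) := by
  have d1 : deriv (fun y => G y - H y) = fun y => deriv G y - deriv H y :=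
    funext fun y => ((hG.hasDerivAt y).fun_sub (hH.hasDerivAt y)).deriv
  have d2 : deriv (fun y => deriv G y - deriv H y) = fun y => deriv (deriv G) y - deriv (deriv H) y :=
    funext fun y => ((hG.hasDerivAt_deriv y).fun_sub (hH.hasDerivAt_deriv y)).deriv
  have key : ∀ (u v : ℂ) (t : ℝ), ‖u‖ ≤ M / t → ‖v‖ ≤ N / t → ‖u - v‖ ≤ (M + N) / t :=
    fun u v t hu hv => by
      rw [add_div]
      exact (norm_sub_le _ _).trans (add_le_add hu hv)
  refine ⟨hG.1.sub hH.1, fun y => key _ _ _ (hG.2.1 y) (hH.2.1 y), fun y => ?_, fun y => ?_⟩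
  · rw [d1]
    exact key _ _ _ (hG.2.2.1 y) (hH.2.2.1 y)
  · rw [d1, d2]
    exact key _ _ _ (hG.2.2.2 y) (hH.2.2.2 y)

theorem exists_bound_mul {f : ℝ → ℂ} (hc : Continuous f) (hs : HasCompactSupport f) {w : ℝ → ℝ}
    (hw : Continuous w) (hpos : ∀ y, 0 < w y) : ∃ M, ∀ y, ‖f y‖ ≤ M / w y := by
  obtain ⟨M, hM⟩ := (hs.mul_right (f' := fun y => (w y : ℂ))).exists_bound_of_continuous
    (hc.mul (Complex.continuous_ofReal.comp hw))
  refine ⟨M, fun y => ?_⟩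
  rw [le_div_iff₀ (hpos y)]
  have := hM y
  simpa [abs_of_pos (hpos y)] using this

theorem IsTest.isTame {f : ℝ → ℂ} (hf : IsTest f) : ∃ M, IsTame M f := by
  obtain ⟨M₀, h₀⟩ := exists_bound_mul hf.continuous hf.2 (w := fun y => 1 + |y|) (by fun_prop)
    (fun y => by positivity)
  obtain ⟨M₁, h₁⟩ := exists_bound_mul hf.deriv.continuous hf.deriv.2 (w := fun y => 1 + y ^ 2)
    (by fun_prop) (fun y => by positivity)
  obtain ⟨M₂, h₂⟩ := exists_bound_mul hf.deriv.deriv.continuous hf.deriv.deriv.2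
    (w := fun y => 1 + y ^ 2) (by fun_prop) (fun y => by positivity)
  refine ⟨max M₀ (max M₁ M₂), hf.1, fun y => (h₀ y).trans ?_, fun y => (h₁ y).trans ?_,
    fun y => (h₂ y).trans ?_⟩
  · gcongr; exact le_max_left _ _
  · gcongr; exact (le_max_left _ _).trans (le_max_right _ _)
  · gcongr; exact (le_max_right _ _).trans (le_max_right _ _)

/-- `G` vanishes at both ends. This is the mean-zero condition needed for decay at small momenta. -/
theorem IsTame.integral_deriv {M : ℝ} {G : ℝ → ℂ} (hG : IsTame M G) :
    ∫ y, _root_.deriv G y = 0 := by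
  have hlim : ∀ l : Filter ℝ, Tendsto (fun y : ℝ => |y|) l atTop → Tendsto G l (𝓝 0) := by
    intro l hl
    refine squeeze_zero_norm hG.2.1 ?_
    exact tendsto_const_nhds.div_atTop (tendsto_atTop_add_const_left _ _ hl)
  rw [integral_of_hasDerivAt_of_tendsto hG.hasDerivAt hG.integrable_deriv
    (hlim _ tendsto_abs_atBot_atTop) (hlim _ tendsto_abs_atTop_atTop), sub_zero]

/-- Smooth cutoffs of tame functions, with uniform bounds. -/
theorem IsTame.exists_approx {M : ℝ} {G : ℝ → ℂ} (hG : IsTame M G) :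
    ∃ (N : ℝ) (F : ℕ → ℝ → ℂ), (∀ n, IsTest (F n)) ∧ (∀ n, IsTame N (F n)) ∧
      ∀ y, Tendsto (fun n => _root_.deriv (F n) y) atTop (𝓝 (_root_.deriv G y)) := by
  let b : ContDiffBump (0 : ℝ) := ⟨1, 2, one_pos, one_lt_two⟩
  let χ : ℝ → ℂ := fun y => (b y : ℂ)
  have hχ : IsTest χ := ⟨Complex.ofRealCLM.contDiff.comp b.contDiff,
    b.hasCompactSupport.comp_left (g := fun t : ℝ => (t : ℂ)) (by simp)⟩
  have hχ1 : ∀ y, ‖χ y‖ ≤ 1 := fun y => by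
    simpa [χ, abs_of_nonneg b.nonneg] using b.le_one
  have hχ0 : χ 0 = 1 := by
    simp [χ, b.one_of_mem_closedBall (Metric.mem_closedBall_self b.rIn_pos.le)]
  obtain ⟨A, hA⟩ := hχ.deriv.isTame
  have hA1 : ∀ y, ‖deriv χ y‖ ≤ A / (1 + |y|) := hA.2.1
  have hA0 : 0 ≤ A := by simpa using (norm_nonneg _).trans (hA1 0)
  have hM0 : 0 ≤ M := by simpa using (norm_nonneg _).trans (hG.2.1 0)
  obtain ⟨A₂, hA₂'⟩ := exists_bound_mul hχ.deriv.deriv.continuous hχ.deriv.deriv.2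
    (w := fun y => 1 + |y|) (by fun_prop) (fun y => by positivity)
  have hA₂0 : 0 ≤ A₂ := by simpa using (norm_nonneg _).trans (hA₂' 0)
  let s : ℕ → ℝ := fun n => 1 / ((n : ℝ) + 1)
  have hs0 : ∀ n, 0 < s n := fun n => by positivity
  have hs1 : ∀ n, s n ≤ 1 := fun n => by
    refine (div_le_one (by positivity)).2 ?_
    have : (0 : ℝ) ≤ n := n.cast_nonneg
    linarith
  have hslim : Tendsto s atTop (𝓝 0) := tendsto_one_div_add_atTop_nhds_zero_nat
  -- Cutoff at scale n + 1. A derivative falling on the cutoff brings the factor `s n`, worth a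
  -- decay 1/(1 + |y|) uniformly in `n`; together with the 1/|y| decay of `G` this restores 1/y².
  let F : ℕ → ℝ → ℂ := fun n y => χ (s n * y) * G y
  have hsd : ∀ n y, HasDerivAt (fun y => s n * y) (s n) y := fun n y => by
    simpa using (hasDerivAt_id y).const_mul (s n)
  have hd1 : ∀ n y, HasDerivAt (F n)
      (s n * deriv χ (s n * y) * G y + χ (s n * y) * deriv G y) y := fun n y => by
    have h := ((hχ.hasDerivAt (s n * y)).scomp y (hsd n y)).fun_mul (hG.hasDerivAt y)
    simpa using h
  have hF1 : ∀ n, deriv (F n) =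
      fun y => s n * deriv χ (s n * y) * G y + χ (s n * y) * deriv G y :=
    fun n => funext fun y => (hd1 n y).deriv
  have hF2 : ∀ n y, deriv (deriv (F n)) y =
      s n * (s n * deriv (deriv χ) (s n * y)) * G y + s n * deriv χ (s n * y) * deriv G y
        + (s n * deriv χ (s n * y) * deriv G y + χ (s n * y) * deriv (deriv G) y) := fun n y => by
    rw [hF1]
    have h := ((((hχ.deriv.hasDerivAt (s n * y)).scomp y (hsd n y)).const_mul (s n : ℂ)).fun_mul
      (hG.hasDerivAt y)).fun_add
      (((hχ.hasDerivAt (s n * y)).scomp y (hsd n y)).fun_mul (hG.hasDerivAt_deriv y))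
    simpa using h.deriv
  have hw : ∀ y : ℝ, 1 / (1 + |y|) * (1 / (1 + |y|)) ≤ 1 / (1 + y ^ 2) := fun y => by
    rw [div_mul_div_comm, one_mul]
    refine one_div_le_one_div_of_le (by positivity) ?_
    nlinarith [abs_nonneg y, sq_abs y]
  -- a derivative of the cutoff gains a factor `1/|y|`
  have hgain : ∀ (ψ : ℝ → ℂ) (B : ℝ), 0 ≤ B → (∀ y, ‖ψ y‖ ≤ B / (1 + |y|)) → ∀ n y,
      ‖(s n : ℂ) * ψ (s n * y)‖ ≤ B * (1 / (1 + |y|)) := by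
    intro ψ B hB hψ n y
    rw [norm_mul, Complex.norm_real, Real.norm_of_nonneg (hs0 n).le]
    calc s n * ‖ψ (s n * y)‖ ≤ s n * (B / (1 + |s n * y|)) := by
          have := hs0 n
          gcongr
          exact hψ _
      _ ≤ B * (1 / (1 + |y|)) := by
          rw [abs_mul, abs_of_pos (hs0 n), mul_div_assoc', mul_one_div,
            div_le_div_iff₀ (by have := hs0 n; positivity) (by positivity)]
          have h1 := hs1 n
          have : s n * (1 + |y|) ≤ 1 + s n * |y| := by linarith
          nlinarith
  have hb1 : ∀ n y, ‖(s n : ℂ) * deriv χ (s n * y) * G y‖ ≤ A * M * (1 / (1 + y ^ 2)) := by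
    intro n y
    rw [norm_mul]
    calc _ ≤ (A * (1 / (1 + |y|))) * (M / (1 + |y|)) :=
          mul_le_mul (hgain _ A hA0 hA1 n y) (hG.2.1 y) (norm_nonneg _) (by positivity)
      _ = A * M * (1 / (1 + |y|) * (1 / (1 + |y|))) := by ring
      _ ≤ _ := by gcongr; exact hw y
  have hb2 : ∀ n y, ‖χ (s n * y) * deriv G y‖ ≤ M * (1 / (1 + y ^ 2)) := by
    intro n y
    rw [norm_mul, mul_one_div]
    calc _ ≤ 1 * (M / (1 + y ^ 2)) := mul_le_mul (hχ1 _) (hG.2.2.1 y) (norm_nonneg _) zero_le_one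
      _ = _ := one_mul _
  have hb3 : ∀ n y, ‖χ (s n * y) * deriv (deriv G) y‖ ≤ M * (1 / (1 + y ^ 2)) := by
    intro n y
    rw [norm_mul, mul_one_div]
    calc _ ≤ 1 * (M / (1 + y ^ 2)) := mul_le_mul (hχ1 _) (hG.2.2.2 y) (norm_nonneg _) zero_le_one
      _ = _ := one_mul _
  have hone : ∀ y : ℝ, 1 / (1 + |y|) ≤ 1 := fun y =>
    (div_le_one (by positivity)).2 (by linarith [abs_nonneg y])
  have hb4 : ∀ n y, ‖(s n : ℂ) * deriv χ (s n * y) * deriv G y‖ ≤ A * M * (1 / (1 + y ^ 2)) := by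
    intro n y
    rw [norm_mul]
    calc _ ≤ (A * (1 / (1 + |y|))) * (M / (1 + y ^ 2)) :=
          mul_le_mul (hgain _ A hA0 hA1 n y) (hG.2.2.1 y) (norm_nonneg _) (by positivity)
      _ ≤ (A * 1) * (M / (1 + y ^ 2)) := by gcongr; exact hone y
      _ = _ := by ring
  have hb5 : ∀ n y, ‖(s n : ℂ) * (s n * deriv (deriv χ) (s n * y)) * G y‖
      ≤ A₂ * M * (1 / (1 + y ^ 2)) := by
    intro n y
    rw [norm_mul, norm_mul, Complex.norm_real, Real.norm_of_nonneg (hs0 n).le]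
    calc _ ≤ (1 * (A₂ * (1 / (1 + |y|)))) * (M / (1 + |y|)) :=
          mul_le_mul (mul_le_mul (hs1 n) (hgain _ A₂ hA₂0 hA₂' n y) (norm_nonneg _) zero_le_one)
            (hG.2.1 y) (norm_nonneg _) (by positivity)
      _ = A₂ * M * (1 / (1 + |y|) * (1 / (1 + |y|))) := by ring
      _ ≤ _ := by gcongr; exact hw y
  have hFtest : ∀ n, IsTest (F n) := fun n => by
    refine ⟨(hχ.1.comp (contDiff_const.mul contDiff_id)).mul hG.1, ?_⟩
    refine HasCompactSupport.mul_right (f := fun y => χ (s n * y)) ?_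
    exact hχ.2.comp_homeomorph (Homeomorph.mulLeft₀ (s n) (hs0 n).ne')
  -- One constant that exceeds the bounds for `F n` and both its derivatives; the second derivative,
  -- with four terms, is the largest.
  refine ⟨2 * M + 2 * (A * M) + A₂ * M, F, hFtest, fun n => ⟨(hFtest n).1, fun y => ?_, fun y => ?_,
    fun y => ?_⟩, fun y => ?_⟩
  · have h1 : ‖F n y‖ ≤ M / (1 + |y|) := by
      calc _ = ‖χ (s n * y)‖ * ‖G y‖ := norm_mul _ _
        _ ≤ 1 * (M / (1 + |y|)) := mul_le_mul (hχ1 _) (hG.2.1 y) (norm_nonneg _) zero_le_one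
        _ = _ := one_mul _
    refine h1.trans ?_
    gcongr
    have := mul_nonneg hA0 hM0
    have := mul_nonneg hA₂0 hM0
    linarith
  · rw [hF1, ← mul_one_div]
    have hnn : 0 ≤ 1 / (1 + y ^ 2) := by positivity
    have p1 := mul_nonneg (mul_nonneg hA0 hM0) hnn
    have p2 := mul_nonneg (mul_nonneg hA₂0 hM0) hnn
    have p3 := mul_nonneg hM0 hnn
    linarith [norm_add_le ((s n : ℂ) * deriv χ (s n * y) * G y) (χ (s n * y) * deriv G y), hb1 n y,
      hb2 n y]
  · rw [hF2, ← mul_one_div]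
    have hnn : 0 ≤ 1 / (1 + y ^ 2) := by positivity
    have p3 := mul_nonneg hM0 hnn
    have t1 := norm_add₃_le (a := (s n : ℂ) * (s n * deriv (deriv χ) (s n * y)) * G y)
      (b := s n * deriv χ (s n * y) * deriv G y)
      (c := s n * deriv χ (s n * y) * deriv G y + χ (s n * y) * deriv (deriv G) y)
    have t2 := norm_add_le ((s n : ℂ) * deriv χ (s n * y) * deriv G y)
      (χ (s n * y) * deriv (deriv G) y)
    linarith [hb3 n y, hb4 n y, hb5 n y]
  · simp only [hF1]
    have hsy : Tendsto (fun n => s n * y) atTop (𝓝 0) := by simpa using hslim.mul_const y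
    have t1 := (hχ.deriv.continuous.tendsto 0).comp hsy
    have t2 := (hχ.continuous.tendsto 0).comp hsy
    have t3 : Tendsto (fun n => (s n : ℂ)) atTop (𝓝 0) := by
      have h := (Complex.continuous_ofReal.tendsto 0).comp hslim
      rw [Complex.ofReal_zero] at h
      exact h
    have := ((t3.mul t1).mul_const (G y)).add (t2.mul_const (deriv G y))
    simpa [hχ0] using this

/-! ### The commutator does not depend on the coordinates -/

theorem tendsto_inHat {x : ℝ → ℝ} (hx : Continuous x) {F : ℕ → ℝ → ℂ} {G : ℝ → ℂ} {M : ℝ}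
    (hF : ∀ n, Continuous (F n)) (hb : ∀ n y, ‖F n y‖ ≤ M / (1 + y ^ 2))
    (hlim : ∀ y, Tendsto (fun n => F n y) atTop (𝓝 (G y))) (k : ℝ) :
    Tendsto (fun n => inHat x (F n) k) atTop (𝓝 (inHat x G k)) := by
  unfold inHat
  refine Tendsto.const_mul _ (tendsto_integral_of_dominated_convergence _ (fun n => ?_)
    (integrable_const_mul_inv_one_add_sq M) (fun n => ae_of_all _ fun y => ?_)
    (ae_of_all _ fun y => (hlim y).const_mul _))
  · have := hF n
    exact Continuous.aestronglyMeasurable (by fun_prop)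
  · rw [norm_mul, norm_phase, one_mul]
    exact hb n y

/-- The constants `D` and `E` do not depend on `n`, so the logarithmic weight dominates the whole
sequence. -/
theorem tendsto_twoPt {x : ℝ → ℝ} {A B : ℕ → ℝ → ℂ} {A' B' : ℝ → ℂ} {D E : ℝ}
    (hA : ∀ n, LogDecay D (fun k => inHat x (A n) k))
    (hB : ∀ n, LogDecay E (fun k => inHat x (B n) k))
    (hA' : ∀ k, Tendsto (fun n => inHat x (A n) k) atTop (𝓝 (inHat x A' k)))
    (hB' : ∀ k, Tendsto (fun n => inHat x (B n) k) atTop (𝓝 (inHat x B' k))) :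
    Tendsto (fun n => twoPt x (A n) (B n)) atTop (𝓝 (twoPt x A' B')) := by
  refine tendsto_integral_of_dominated_convergence _ (fun n => ?_)
    (integrable_logWeight.const_mul (D * E)) (fun n => ?_)
    (ae_of_all _ fun k => (hA' k).mul (hB' (-k)))
  · exact ((hA n).1.mul (hB n).comp_neg.1).aestronglyMeasurable
  · filter_upwards [ae_momentumMeasure_pos] with k hk
    exact (hA n).norm_mul_le (hB n).comp_neg hk.ne'

/-- Coordinates whose acceleration is controlled by the velocity. -/
def BoundedAcceleration (x : ℝ → ℝ) : Prop :=
  ContDiff ℝ ∞ x ∧ (∀ y, 0 < deriv x y) ∧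
    ∃ C, 0 ≤ C ∧ ∀ y, |deriv (deriv x) y| ≤ C * deriv x y

theorem boundedAcceleration_id : BoundedAcceleration id := by
  refine ⟨contDiff_id, fun y => by simp, 0, le_rfl, fun y => ?_⟩
  have : deriv (id : ℝ → ℝ) = fun _ => 1 := funext fun y => by simp
  simp [this]

theorem BoundedAcceleration.exists_logDecay {x : ℝ → ℝ} (hx : BoundedAcceleration x) :
    ∃ D : ℝ, 0 ≤ D ∧ ∀ (M : ℝ) (G : ℝ → ℂ), IsTame M G →
      LogDecay (D * M) (fun k => inHat x (_root_.deriv G) k) := by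
  obtain ⟨hx0, hp, C, hC0, hC⟩ := hx
  obtain ⟨D, hD0, hD⟩ := exists_logDecay_inHat hx0 hp hC0 hC
  exact ⟨D, hD0, fun M G hG => hD _ _ M hG.hasDerivAt_deriv hG.continuous_deriv_deriv hG.2.2.1
    hG.2.2.2 hG.integral_deriv⟩

theorem BoundedAcceleration.fieldDefined {x : ℝ → ℝ} (hx : BoundedAcceleration x) {M : ℝ}
    {G : ℝ → ℂ} (hG : IsTame M G) : FieldDefined x (_root_.deriv G) :=
  let ⟨_, _, hD⟩ := hx.exists_logDecay
  fieldDefined_of_logDecay hG.integrable_deriv (hD M G hG)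

theorem BoundedAcceleration.tendsto_approx {x : ℝ → ℝ} (hx : BoundedAcceleration x)
    {G H : ℝ → ℂ} {F E : ℕ → ℝ → ℂ} {M' N' : ℝ} (hF : ∀ n, IsTame M' (F n))
    (hE : ∀ n, IsTame N' (E n))
    (hFl : ∀ y, Tendsto (fun n => _root_.deriv (F n) y) atTop (𝓝 (_root_.deriv G y)))
    (hEl : ∀ y, Tendsto (fun n => _root_.deriv (E n) y) atTop (𝓝 (_root_.deriv H y))) :
    Tendsto (fun n => twoPt x (_root_.deriv (F n)) (_root_.deriv (E n))) atTop
      (𝓝 (twoPt x (_root_.deriv G) (_root_.deriv H))) := by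
  obtain ⟨D, _, hD⟩ := hx.exists_logDecay
  exact tendsto_twoPt (fun n => hD _ _ (hF n)) (fun n => hD _ _ (hE n))
    (tendsto_inHat hx.1.continuous (fun n => (hF n).contDiff_deriv.continuous)
      (fun n => (hF n).2.2.1) hFl)
    (tendsto_inHat hx.1.continuous (fun n => (hE n).contDiff_deriv.continuous)
      (fun n => (hE n).2.2.1) hEl)

/-- For test functions this is the symmetry of log Q. Cutoffs with uniform bounds carry it over to
tame functions, as is needed for the positive- and negative-momentum parts of test functions. -/
theorem BoundedAcceleration.commutator_eq {x : ℝ → ℝ} (hx : BoundedAcceleration x) {M N : ℝ}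
    {G H : ℝ → ℂ} (hG : IsTame M G) (hH : IsTame N H) :
    twoPt x (_root_.deriv G) (_root_.deriv H) - twoPt x (_root_.deriv H) (_root_.deriv G)
      = twoPt id (_root_.deriv G) (_root_.deriv H)
        - twoPt id (_root_.deriv H) (_root_.deriv G) := by
  obtain ⟨M', F, hFt, hF, hFl⟩ := hG.exists_approx
  obtain ⟨N', E, hEt, hE, hEl⟩ := hH.exists_approx
  obtain ⟨_, _, _, hK⟩ := exists_regular_kernel hx.1 hx.2.1
  have hi := boundedAcceleration_id
  refine tendsto_nhds_unique ((hx.tendsto_approx hF hE hFl hEl).sub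
    (hx.tendsto_approx hE hF hEl hFl)) ?_
  refine ((hi.tendsto_approx hF hE hFl hEl).sub (hi.tendsto_approx hE hF hEl hFl)).congr fun n => ?_
  exact ((hK _ _ (hFt n) (hEt n)).2).symm

/-! ### The parts of positive and negative momenta -/

theorem hat_deriv {f : ℝ → ℂ} (hf : IsTest f) (k : ℝ) :
    hat (deriv f) k = Complex.I * k * hat f k := by
  have := inHat_deriv contDiff_id hf k
  simpa [hat] using this

theorem continuous_hat {f : ℝ → ℂ} (hf : IsTest f) : Continuous (hat f) :=
  continuous_inHat continuous_id hf.integrable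

theorem exists_hat_le {f : ℝ → ℂ} (hf : IsTest f) : ∃ M, ∀ k, ‖hat f k‖ ≤ M / (1 + k ^ 2) := by
  refine ⟨(Real.sqrt (2 * Real.pi))⁻¹ * (∫ y, ‖f y‖)
    + (Real.sqrt (2 * Real.pi))⁻¹ * ∫ y, ‖deriv (deriv f) y‖, fun k => ?_⟩
  rw [le_div_iff₀ (by positivity), mul_add, mul_one]
  refine add_le_add (norm_inHat_le _ _ _) ?_
  have h : ‖hat f k‖ * k ^ 2 = ‖hat (deriv (deriv f)) k‖ := by
    rw [hat_deriv hf.deriv, hat_deriv hf]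
    simp only [norm_mul, Complex.norm_I, Complex.norm_real, Real.norm_eq_abs, one_mul]
    rw [← sq_abs k]
    ring
  rw [h]
  exact norm_inHat_le _ _ _

theorem integrable_hat {f : ℝ → ℂ} (hf : IsTest f) : Integrable (hat f) := by
  obtain ⟨M, hM⟩ := exists_hat_le hf
  exact (integrable_const_mul_inv_one_add_sq M).mono' (continuous_hat hf).aestronglyMeasurable
    (ae_of_all _ hM)

theorem tendsto_hat_atTop {f : ℝ → ℂ} (hf : IsTest f) : Tendsto (hat f) atTop (𝓝 0) := by
  obtain ⟨M, hM⟩ := exists_hat_le hf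
  refine squeeze_zero_norm hM ?_
  exact tendsto_const_nhds.div_atTop (tendsto_atTop_add_const_left _ _
    (tendsto_pow_atTop two_ne_zero))

theorem IsTest.id_mul {f : ℝ → ℂ} (hf : IsTest f) : IsTest (fun y => (y : ℂ) * f y) :=
  ⟨Complex.ofRealCLM.contDiff.mul hf.1, hf.2.mul_left⟩

theorem hasDerivAt_hat {f : ℝ → ℂ} (hf : IsTest f) (k : ℝ) :
    HasDerivAt (hat f) (-Complex.I * hat (fun y => (y : ℂ) * f y) k) k := by
  have hc := hf.continuous
  have h := (hasDerivAt_integral_of_dominated_loc_of_deriv_le (μ := volume) (x₀ := k)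
    (F := fun (k : ℝ) (y : ℝ) => Complex.exp (-(Complex.I * (k : ℂ) * ((id y : ℝ) : ℂ))) * f y)
    (F' := fun (k : ℝ) (y : ℝ) => Complex.exp (-(Complex.I * (k : ℂ) * ((id y : ℝ) : ℂ)))
      * (-Complex.I * ((y : ℂ) * f y)))
    (bound := fun y : ℝ => ‖(y : ℂ) * f y‖) univ_mem
    (Eventually.of_forall fun k => (integrable_phase_mul continuous_id hf.integrable
      k).aestronglyMeasurable)
    (integrable_phase_mul continuous_id hf.integrable k)
    (Continuous.aestronglyMeasurable (by fun_prop))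
    (ae_of_all _ fun y k _ => ?_) hf.id_mul.integrable.norm (ae_of_all _ fun y k _ => ?_)).2
  · have h2 := h.const_mul (((Real.sqrt (2 * Real.pi))⁻¹ : ℝ) : ℂ)
    refine h2.congr_deriv ?_
    unfold hat inHat
    simp_rw [mul_left_comm _ (-Complex.I)]
    rw [integral_const_mul]
    ring
  · rw [norm_mul, norm_phase, norm_mul, norm_neg, Complex.norm_I, one_mul, one_mul]
  · have h1 : HasDerivAt (fun k : ℝ => (k : ℂ)) 1 k := Complex.ofRealCLM.hasDerivAt
    have h2 := (((h1.const_mul Complex.I).mul_const ((id y : ℝ) : ℂ)).fun_neg.cexp).mul_const (f y)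
    refine h2.congr_deriv ?_
    simp only [id]
    ring

theorem hasDerivAt_posPart {f : ℝ → ℂ} (hf : IsTest f) (y : ℝ) :
    HasDerivAt (posPart f) (posPart (deriv f) y) y := by
  have hc := continuous_hat hf
  have hc' := continuous_hat hf.deriv
  have hi := integrable_hat hf
  unfold posPart
  refine HasDerivAt.const_mul _ (hasDerivAt_integral_of_dominated_loc_of_deriv_le
    (μ := volume.restrict (Ioi 0)) (x₀ := y)
    (F := fun (y : ℝ) (p : ℝ) => Complex.exp (Complex.I * (p : ℂ) * (y : ℂ)) * hat f p)
    (F' := fun (y : ℝ) (p : ℝ) => Complex.exp (Complex.I * (p : ℂ) * (y : ℂ)) * hat (deriv f) p)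
    (bound := fun p => ‖hat (deriv f) p‖) univ_mem
    (Eventually.of_forall fun y => Continuous.aestronglyMeasurable (by fun_prop))
    (integrable_cexp_mul hi.integrableOn y)
    (Continuous.aestronglyMeasurable (by fun_prop))
    (ae_of_all _ fun p y _ => ?_) (integrable_hat hf.deriv).norm.integrableOn
    (ae_of_all _ fun p y _ => ?_)).2
  · rw [norm_mul, norm_cexp_I_mul, one_mul]
  · have h1 : HasDerivAt (fun y : ℝ => (y : ℂ)) 1 y := Complex.ofRealCLM.hasDerivAt
    have h2 := ((h1.const_mul (Complex.I * (p : ℂ))).cexp).mul_const (hat f p)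
    refine h2.congr_deriv ?_
    rw [hat_deriv hf]
    ring

theorem deriv_posPart {f : ℝ → ℂ} (hf : IsTest f) : deriv (posPart f) = posPart (deriv f) :=
  funext fun y => (hasDerivAt_posPart hf y).deriv

theorem contDiff_posPart {f : ℝ → ℂ} (hf : IsTest f) : ContDiff ℝ ∞ (posPart f) := by
  have h : ∀ (n : ℕ) (f : ℝ → ℂ), IsTest f → ContDiff ℝ n (posPart f) := by
    intro n
    induction n with
    | zero =>
      intro f hf
      exact contDiff_zero.2 (continuous_iff_continuousAt.2 fun y =>
        (hasDerivAt_posPart hf y).continuousAt)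
    | succ n ih =>
      intro f hf
      push_cast
      rw [contDiff_succ_iff_deriv]
      refine ⟨fun y => (hasDerivAt_posPart hf y).differentiableAt, by simp, ?_⟩
      rw [deriv_posPart hf]
      exact ih _ hf.deriv
  exact contDiff_infty.2 fun n => h n f hf

/-- Multiplication by `y` is a derivative in `p` of the phase. Integrating by parts over the
half-line leaves a boundary term at p = 0, which limits the decay to 1/|y| unless the transform of
`f` vanishes there. -/
theorem mul_posPart {f : ℝ → ℂ} (hf : IsTest f) (y : ℝ) :
    (y : ℂ) * posPart f y = Complex.I * (((Real.sqrt (2 * Real.pi))⁻¹ : ℝ) : ℂ) * hat f 0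
      + posPart (fun y => (y : ℂ) * f y) y := by
  have i1 : IntegrableOn (fun p : ℝ => Complex.exp (Complex.I * (p : ℂ) * (y : ℂ)) * hat f p)
      (Ioi 0) := integrable_cexp_mul (integrable_hat hf).integrableOn y
  have i2 : IntegrableOn (fun p : ℝ => Complex.exp (Complex.I * (p : ℂ) * (y : ℂ))
      * hat (fun y => (y : ℂ) * f y) p) (Ioi 0) :=
    integrable_cexp_mul (integrable_hat hf.id_mul).integrableOn y
  have hd : ∀ p ∈ Ici (0 : ℝ), HasDerivAt
      (fun p : ℝ => Complex.exp (Complex.I * (p : ℂ) * (y : ℂ)) * hat f p)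
      (Complex.I * y * (Complex.exp (Complex.I * (p : ℂ) * (y : ℂ)) * hat f p)
        + -Complex.I * (Complex.exp (Complex.I * (p : ℂ) * (y : ℂ))
          * hat (fun y => (y : ℂ) * f y) p)) p := by
    intro p _
    have h1 : HasDerivAt (fun p : ℝ => (p : ℂ)) 1 p := Complex.ofRealCLM.hasDerivAt
    refine ((((h1.const_mul Complex.I).mul_const (y : ℂ)).cexp).fun_mul
      (hasDerivAt_hat hf p)).congr_deriv ?_
    ring
  have hl : Tendsto (fun p : ℝ => Complex.exp (Complex.I * (p : ℂ) * (y : ℂ)) * hat f p) atTop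
      (𝓝 0) := by
    rw [tendsto_zero_iff_norm_tendsto_zero]
    simp_rw [norm_mul, norm_cexp_I_mul, one_mul]
    exact tendsto_zero_iff_norm_tendsto_zero.1 (tendsto_hat_atTop hf)
  have h := integral_Ioi_of_hasDerivAt_of_tendsto' hd
    ((i1.const_mul _).fun_add (i2.const_mul _)) hl
  rw [integral_add (i1.const_mul _) (i2.const_mul _), integral_const_mul, integral_const_mul] at h
  simp only [Complex.ofReal_zero, mul_zero, zero_mul, Complex.exp_zero, one_mul, zero_sub] at h
  unfold posPart
  linear_combination (-Complex.I * (((Real.sqrt (2 * Real.pi))⁻¹ : ℝ) : ℂ)) * h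
    - (((Real.sqrt (2 * Real.pi))⁻¹ : ℝ) : ℂ) *
      ((∫ p in Ioi (0 : ℝ), Complex.exp (Complex.I * (p : ℂ) * (y : ℂ))
        * hat (fun y => (y : ℂ) * f y) p) - y * ∫ p in Ioi (0 : ℝ),
        Complex.exp (Complex.I * (p : ℂ) * (y : ℂ)) * hat f p) * Complex.I_sq

theorem exists_posPart_le (f : ℝ → ℂ) : ∃ M, ∀ y, ‖posPart f y‖ ≤ M := by
  refine ⟨(Real.sqrt (2 * Real.pi))⁻¹ * ∫ p in Ioi (0 : ℝ), ‖hat f p‖, fun y => ?_⟩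
  unfold posPart
  rw [norm_mul, Complex.norm_real, Real.norm_of_nonneg (by positivity)]
  gcongr
  refine (norm_integral_le_integral_norm _).trans_eq ?_
  simp_rw [norm_mul, norm_cexp_I_mul, one_mul]

theorem exists_posPart_le_div {f : ℝ → ℂ} (hf : IsTest f) :
    ∃ M, ∀ y, ‖posPart f y‖ ≤ M / (1 + |y|) := by
  obtain ⟨M₀, h₀⟩ := exists_posPart_le f
  obtain ⟨M₁, h₁⟩ := exists_posPart_le (fun y => (y : ℂ) * f y)
  refine ⟨M₀ + (‖Complex.I * (((Real.sqrt (2 * Real.pi))⁻¹ : ℝ) : ℂ) * hat f 0‖ + M₁), fun y => ?_⟩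
  rw [le_div_iff₀ (by positivity), mul_add, mul_one]
  refine add_le_add (h₀ y) ?_
  have : ‖posPart f y‖ * |y| = ‖(y : ℂ) * posPart f y‖ := by
    rw [norm_mul, Complex.norm_real, Real.norm_eq_abs, mul_comm]
  rw [this, mul_posPart hf]
  exact (norm_add_le _ _).trans (add_le_add_right (h₁ y) _)

/-- The transform of a derivative vanishes at zero, so the boundary term of `mul_posPart` is absent
and one more power of `y` is gained. -/
theorem exists_posPart_deriv_le_div {f : ℝ → ℂ} (hf : IsTest f) :
    ∃ M, ∀ y, ‖posPart (deriv f) y‖ ≤ M / (1 + y ^ 2) := by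
  obtain ⟨M₀, h₀⟩ := exists_posPart_le (deriv f)
  obtain ⟨M₁, h₁⟩ := exists_posPart_le_div hf.deriv.id_mul
  refine ⟨M₀ + M₁, fun y => ?_⟩
  rw [le_div_iff₀ (by positivity), mul_add, mul_one]
  refine add_le_add (h₀ y) ?_
  have h2 := mul_posPart hf.deriv y
  rw [hat_deriv hf, Complex.ofReal_zero, mul_zero, zero_mul, mul_zero, zero_add] at h2
  have h3 : ‖posPart (deriv f) y‖ * y ^ 2 = |y| * ‖posPart (fun y => (y : ℂ) * deriv f y) y‖ := by
    rw [← h2, norm_mul, Complex.norm_real, Real.norm_eq_abs, ← sq_abs]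
    ring
  have h4 := h₁ y
  rw [le_div_iff₀ (by positivity)] at h4
  rw [h3]
  nlinarith [norm_nonneg (posPart (fun y => (y : ℂ) * deriv f y) y)]

theorem isTame_posPart {f : ℝ → ℂ} (hf : IsTest f) : ∃ M, IsTame M (posPart f) := by
  obtain ⟨M₀, h₀⟩ := exists_posPart_le_div hf
  obtain ⟨M₁, h₁⟩ := exists_posPart_deriv_le_div hf
  obtain ⟨M₂, h₂⟩ := exists_posPart_deriv_le_div hf.deriv
  refine ⟨max M₀ (max M₁ M₂), contDiff_posPart hf, fun y => (h₀ y).trans ?_, fun y => ?_,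
    fun y => ?_⟩
  · gcongr; exact le_max_left _ _
  · rw [deriv_posPart hf]
    refine (h₁ y).trans ?_
    gcongr; exact (le_max_left _ _).trans (le_max_right _ _)
  · rw [deriv_posPart hf, deriv_posPart hf.deriv]
    refine (h₂ y).trans ?_
    gcongr; exact (le_max_right _ _).trans (le_max_right _ _)

theorem negPart_eq {f : ℝ → ℂ} (hf : IsTest f) : negPart f = fun y => f y - posPart f y :=
  funext fun y => by
    rw [← posPart_add_negPart hf.continuous hf.integrable (integrable_hat hf) y]
    ring

theorem deriv_negPart {f : ℝ → ℂ} (hf : IsTest f) : deriv (negPart f) = negPart (deriv f) := by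
  rw [negPart_eq hf, negPart_eq hf.deriv]
  exact funext fun y => ((hf.hasDerivAt y).fun_sub (hasDerivAt_posPart hf y)).deriv

theorem isTame_negPart {f : ℝ → ℂ} (hf : IsTest f) : ∃ M, IsTame M (negPart f) := by
  obtain ⟨M, hM⟩ := hf.isTame
  obtain ⟨N, hN⟩ := isTame_posPart hf
  exact ⟨M + N, negPart_eq hf ▸ hM.sub hN⟩

theorem integrable_posPart_deriv {f : ℝ → ℂ} (hf : IsTest f) : Integrable (posPart (deriv f)) := by
  obtain ⟨N, hN⟩ := isTame_posPart hf
  exact deriv_posPart hf ▸ hN.integrable_deriv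

/-- The transform of f' vanishes at zero, hence its truncation to positive momenta is still
continuous and Fourier inversion holds at every point. -/
theorem hat_posPart_deriv {f : ℝ → ℂ} (hf : IsTest f) (k : ℝ) :
    hat (posPart (deriv f)) k = (Ioi (0 : ℝ)).indicator (hat (deriv f)) k := by
  refine hat_integral_exp_mul (m := (Ioi (0 : ℝ)).indicator (hat (deriv f))) ?_
    ((integrable_hat hf.deriv).indicator measurableSet_Ioi) (integrable_posPart_deriv hf)
    (fun y => ?_) k
  · refine continuous_indicator (fun a ha => ?_) (continuous_hat hf.deriv).continuousOn
    rw [frontier_Ioi, mem_singleton_iff] at ha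
    rw [ha, hat_deriv hf]
    simp
  · unfold posPart
    congr 1
    rw [← integral_indicator measurableSet_Ioi]
    refine integral_congr_ae (ae_of_all _ fun p => ?_)
    by_cases hp : p ∈ Ioi (0 : ℝ) <;> simp [hp]

/-! ### Mean values of the regularized products -/

theorem twoPt_add_add {x : ℝ → ℝ} (hx : Continuous x) {A B A' B' : ℝ → ℂ} (hA : FieldDefined x A)
    (hB : FieldDefined x B) (hA' : FieldDefined x A') (hB' : FieldDefined x B') :
    twoPt x (fun y => A y + B y) (fun y => A' y + B' y)
      = twoPt x A A' + twoPt x A B' + twoPt x B A' + twoPt x B B' := by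
  have i : ∀ {F G : ℝ → ℂ}, FieldDefined x F → FieldDefined x G →
      Integrable (fun k => inHat x F k * inHat x G (-k)) momentumMeasure := fun hF hG =>
    MemLp.integrable_mul hF.2.1 hG.2.2
  unfold twoPt
  rw [← integral_add (i hA hA') (i hA hB'), ← integral_add ((i hA hA').fun_add (i hA hB')) (i hB hA'),
    ← integral_add (((i hA hA').fun_add (i hA hB')).fun_add (i hB hA')) (i hB hB')]
  refine integral_congr_ae (ae_of_all _ fun k => ?_)
  simp only
  rw [inHat_add hx hA.1 hB.1, inHat_add hx hA'.1 hB'.1]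
  ring

theorem emit_add {x : ℝ → ℝ} (hx : Continuous x) {g A B : ℝ → ℂ}
    (hg : MemLp (fun k => hat g k) 2 momentumMeasure) (hA : FieldDefined x A)
    (hB : FieldDefined x B) :
    emit x g (fun y => A y + B y) = emit x g A + emit x g B := by
  have i : ∀ {F : ℝ → ℂ}, FieldDefined x F →
      Integrable (fun k => hat g k * inHat x F (-k)) momentumMeasure := fun hF =>
    MemLp.integrable_mul hg hF.2.2
  unfold emit
  rw [← integral_add (i hA) (i hB)]
  refine integral_congr_ae (ae_of_all _ fun k => ?_)
  simp only
  rw [inHat_add hx hA.1 hB.1, mul_add]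

theorem absorb_add {x : ℝ → ℝ} (hx : Continuous x) {g A B : ℝ → ℂ}
    (hg : MemLp (fun k => hat g k) 2 momentumMeasure) (hA : FieldDefined x A)
    (hB : FieldDefined x B) :
    absorb x g (fun y => A y + B y) = absorb x g A + absorb x g B := by
  have hg' : MemLp (fun k => conj (hat g k)) 2 momentumMeasure := hg.star
  have i : ∀ {F : ℝ → ℂ}, FieldDefined x F →
      Integrable (fun k => inHat x F k * conj (hat g k)) momentumMeasure := fun hF =>
    MemLp.integrable_mul hF.2.1 hg'
  unfold absorb
  rw [← integral_add (i hA) (i hB)]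
  refine integral_congr_ae (ae_of_all _ fun k => ?_)
  simp only
  rw [inHat_add hx hA.1 hB.1, add_mul]

theorem deriv_eq_posPart_add_negPart {f : ℝ → ℂ} (hf : IsTest f) :
    deriv f = fun y => posPart (deriv f) y + negPart (deriv f) y :=
  funext fun y => (posPart_add_negPart hf.deriv.continuous hf.deriv.integrable
    (integrable_hat hf.deriv) y).symm

theorem BoundedAcceleration.fieldDefined_posPart {x : ℝ → ℝ} (hx : BoundedAcceleration x)
    {f : ℝ → ℂ} (hf : IsTest f) : FieldDefined x (posPart (_root_.deriv f)) := by
  obtain ⟨_, h⟩ := isTame_posPart hf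
  exact deriv_posPart hf ▸ hx.fieldDefined h

theorem BoundedAcceleration.fieldDefined_negPart {x : ℝ → ℝ} (hx : BoundedAcceleration x)
    {f : ℝ → ℂ} (hf : IsTest f) : FieldDefined x (negPart (_root_.deriv f)) := by
  obtain ⟨_, h⟩ := isTame_negPart hf
  exact deriv_negPart hf ▸ hx.fieldDefined h

theorem hat_negPart_deriv {f : ℝ → ℂ} (hf : IsTest f) {k : ℝ} (hk : k < 0) :
    hat (negPart (deriv f)) k = hat (deriv f) k := by
  have h := inHat_add continuous_id (boundedAcceleration_id.fieldDefined_posPart hf).1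
    (boundedAcceleration_id.fieldDefined_negPart hf).1 k
  rw [← deriv_eq_posPart_add_negPart hf] at h
  have h2 := hat_posPart_deriv hf k
  rw [indicator_of_notMem (by simpa using hk.le)] at h2
  unfold hat at h2 ⊢
  rw [h, h2, zero_add]

/-- For x = id only positive momenta of the first argument and negative momenta of the second enter
the two-point function. -/
theorem twoPt_id_posPart_negPart {f₁ f₂ : ℝ → ℂ} (hf₁ : IsTest f₁) (hf₂ : IsTest f₂) :
    twoPt id (posPart (deriv f₁)) (negPart (deriv f₂)) = twoPt id (deriv f₁) (deriv f₂) := by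
  unfold twoPt
  refine integral_congr_ae ?_
  filter_upwards [ae_momentumMeasure_pos] with k hk
  have h1 := hat_posPart_deriv hf₁ k
  rw [indicator_of_mem (by simpa using hk)] at h1
  have h2 := hat_negPart_deriv hf₂ (k := -k) (by simpa using hk)
  unfold hat at h1 h2
  rw [h1, h2]

theorem twoPt_id_posPart_right (A : ℝ → ℂ) {f : ℝ → ℂ} (hf : IsTest f) :
    twoPt id A (posPart (deriv f)) = 0 := by
  unfold twoPt
  refine integral_eq_zero_of_ae ?_
  filter_upwards [ae_momentumMeasure_pos] with k hk
  have h1 := hat_posPart_deriv hf (-k)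
  rw [indicator_of_notMem (by simpa using hk.le)] at h1
  unfold hat at h1
  simp [h1]

/-- Normal ordering with respect to `y` subtracts the two-point function of the vacuum of `y`. -/
theorem BoundedAcceleration.twoPt_normal {x : ℝ → ℝ} (hx : BoundedAcceleration x) {f₁ f₂ : ℝ → ℂ}
    (hf₁ : IsTest f₁) (hf₂ : IsTest f₂) :
    twoPt x (posPart (_root_.deriv f₁)) (posPart (_root_.deriv f₂))
        + twoPt x (negPart (_root_.deriv f₁)) (posPart (_root_.deriv f₂))
        + twoPt x (negPart (_root_.deriv f₂)) (posPart (_root_.deriv f₁))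
        + twoPt x (negPart (_root_.deriv f₁)) (negPart (_root_.deriv f₂))
      = twoPt x (_root_.deriv f₁) (_root_.deriv f₂)
        - twoPt id (_root_.deriv f₁) (_root_.deriv f₂) := by
  obtain ⟨_, hG⟩ := isTame_posPart hf₁
  obtain ⟨_, hH⟩ := isTame_negPart hf₂
  -- The four ordered products differ from the expanded full product only by the commutator of the
  -- positive part of `f₁` with the negative part of `f₂`. It is evaluated at x = id, where the
  -- reversed order contributes zero and the direct order gives the full two-point function.
  have hcomm := hx.commutator_eq hG hH
  rw [deriv_posPart hf₁, deriv_negPart hf₂, twoPt_id_posPart_negPart hf₁ hf₂,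
    twoPt_id_posPart_right _ hf₁] at hcomm
  have hsum := twoPt_add_add hx.1.continuous (hx.fieldDefined_posPart hf₁)
    (hx.fieldDefined_negPart hf₁) (hx.fieldDefined_posPart hf₂) (hx.fieldDefined_negPart hf₂)
  rw [← deriv_eq_posPart_add_negPart hf₁, ← deriv_eq_posPart_add_negPart hf₂] at hsum
  linear_combination -hsum - hcomm

/-- The kernel of the contribution of the particle to the mean values in `Ω_g`. -/
noncomputable def particleKernel (x : ℝ → ℝ) (g : ℝ → ℂ) (p : ℝ × ℝ) : ℂ :=
  1 / 4 * (deriv x p.1 * g (x p.1) * conj (deriv x p.2 * g (x p.2))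
    + conj (deriv x p.1 * g (x p.1)) * (deriv x p.2 * g (x p.2)))

theorem continuous_particleKernel {x : ℝ → ℝ} (hx : ContDiff ℝ ∞ x) {g : ℝ → ℂ}
    (hg : Continuous g) : Continuous (particleKernel x g) := by
  have hxc := hx.continuous
  have hx1 : Continuous (deriv x) := hx.continuous_deriv (by simp)
  have hu : Continuous fun y => (deriv x y : ℝ) * g (x y) := by fun_prop
  have hu' : Continuous fun y => conj ((deriv x y : ℝ) * g (x y)) := Complex.continuous_conj.comp hu
  exact continuous_const.mul (((hu.comp continuous_fst).mul (hu'.comp continuous_snd)).add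
    ((hu'.comp continuous_fst).mul (hu.comp continuous_snd)))

theorem particleKernel_diag (x : ℝ → ℝ) (g : ℝ → ℂ) (y : ℝ) :
    particleKernel x g (y, y) = (deriv x y ^ 2 * (‖g (x y)‖ ^ 2 / 2) : ℝ) := by
  unfold particleKernel
  simp only [map_mul, Complex.conj_ofReal]
  have h : g (x y) * conj (g (x y)) = ((‖g (x y)‖ ^ 2 : ℝ) : ℂ) := by
    rw [Complex.mul_conj, Complex.normSq_eq_norm_sq]
  push_cast at h ⊢
  linear_combination ((deriv x y : ℝ) : ℂ) ^ 2 / 2 * h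

/-- The amplitudes are single integrals with prefactors -i/2 and i/2; their product has the
prefactor 1/4. -/
theorem emit_mul_absorb {x : ℝ → ℝ} (hx : ContDiff ℝ ∞ x) {g : 𝓢(ℝ, ℂ)}
    (hg : ∀ k < 0, hat g k = 0) {f₁ f₂ : ℝ → ℂ} (hf₁ : IsTest f₁) (hf₂ : IsTest f₂) :
    emit x g (deriv f₁) * absorb x g (deriv f₂) + emit x g (deriv f₂) * absorb x g (deriv f₁)
      = ∫ p : ℝ × ℝ, particleKernel x g p * (f₁ p.1 * f₂ p.2) := by
  have hxc := hx.continuous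
  have hgc := g.continuous
  have hx1 : Continuous (deriv x) := hx.continuous_deriv (by simp)
  have hu : Continuous fun y => (deriv x y : ℝ) * g (x y) := by fun_prop
  have hu' : Continuous fun y => conj ((deriv x y : ℝ) * g (x y)) := Complex.continuous_conj.comp hu
  have hint : ∀ {K : ℝ × ℝ → ℂ}, Continuous K →
      Integrable (fun p : ℝ × ℝ => K p * (f₁ p.1 * f₂ p.2)) := fun hK =>
    integrable_kernel_mul (O := univ) hK.continuousOn hf₁.continuous hf₂.continuous hf₁.2 hf₂.2
      (subset_univ _)
  have e : ∀ a b : ℝ → ℂ, (∫ y, a y * f₁ y) * (∫ y, b y * f₂ y)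
      = ∫ p : ℝ × ℝ, a p.1 * b p.2 * (f₁ p.1 * f₂ p.2) := fun a b => by
    rw [← integral_prod_mul, ← Measure.volume_eq_prod]
    refine integral_congr_ae (ae_of_all _ fun p => ?_)
    simp only
    ring
  have i1 := hint (K := fun p => (deriv x p.1 : ℝ) * g (x p.1) * conj ((deriv x p.2 : ℝ) * g (x p.2)))
    ((hu.comp continuous_fst).mul (hu'.comp continuous_snd))
  have i2 := hint (K := fun p => conj ((deriv x p.1 : ℝ) * g (x p.1)) * ((deriv x p.2 : ℝ) * g (x p.2)))
    ((hu'.comp continuous_fst).mul (hu.comp continuous_snd))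
  have e1 := e (fun y => (deriv x y : ℝ) * g (x y)) (fun y => conj ((deriv x y : ℝ) * g (x y)))
  have e2 := e (fun y => conj ((deriv x y : ℝ) * g (x y))) (fun y => (deriv x y : ℝ) * g (x y))
  have e3 : ∫ p : ℝ × ℝ, particleKernel x g p * (f₁ p.1 * f₂ p.2)
      = 1 / 4 * ((∫ y, (deriv x y : ℝ) * g (x y) * f₁ y) * (∫ y, conj ((deriv x y : ℝ) * g (x y)) * f₂ y)
        + (∫ y, conj ((deriv x y : ℝ) * g (x y)) * f₁ y) * ∫ y, (deriv x y : ℝ) * g (x y) * f₂ y) := by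
    rw [e1, e2, ← integral_add i1 i2, ← integral_const_mul]
    refine integral_congr_ae (ae_of_all _ fun p => ?_)
    simp only [particleKernel]
    ring
  rw [e3, emit_deriv hx hg hf₁, emit_deriv hx hg hf₂, absorb_deriv hx hg hf₁,
    absorb_deriv hx hg hf₂]
  generalize (∫ y, (deriv x y : ℝ) * g (x y) * f₁ y : ℂ) = a
  generalize (∫ y, (deriv x y : ℝ) * g (x y) * f₂ y : ℂ) = b
  generalize (∫ y, conj ((deriv x y : ℝ) * g (x y)) * f₁ y : ℂ) = c
  generalize (∫ y, conj ((deriv x y : ℝ) * g (x y)) * f₂ y : ℂ) = d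
  linear_combination (-(a * d + b * c) / 4) * Complex.I_sq

/-- The particle terms are symmetric under exchange of the two fields, so normal ordering leaves
them alone: by additivity the four products add up to the amplitudes of the undivided fields. Only
the vacuum part is changed. -/
theorem BoundedAcceleration.oneParticle_normal {x : ℝ → ℝ} (hx : BoundedAcceleration x)
    {g : 𝓢(ℝ, ℂ)} (hg : IsNormalizedTest g) {f₁ f₂ : ℝ → ℂ} (hf₁ : IsTest f₁) (hf₂ : IsTest f₂) :
    fockInner (oneParticle g) (normalProduct x f₁ f₂ (oneParticle g))
      = twoPt x (_root_.deriv f₁) (_root_.deriv f₂) - twoPt id (_root_.deriv f₁) (_root_.deriv f₂)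
        + ∫ p : ℝ × ℝ, particleKernel x g p * (f₁ p.1 * f₂ p.2) := by
  have p₁ := hx.fieldDefined_posPart hf₁
  have p₂ := hx.fieldDefined_posPart hf₂
  have n₁ := hx.fieldDefined_negPart hf₁
  have n₂ := hx.fieldDefined_negPart hf₂
  have hL := memLp_hat hg
  rw [oneParticle_normalProduct hL hg.2 p₁ p₂ n₁ n₂, ← emit_mul_absorb hx.1 hg.1 hf₁ hf₂,
    ← hx.twoPt_normal hf₁ hf₂]
  have a₁ := emit_add hx.1.continuous hL p₁ n₁
  have a₂ := emit_add hx.1.continuous hL p₂ n₂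
  have b₁ := absorb_add hx.1.continuous hL p₁ n₁
  have b₂ := absorb_add hx.1.continuous hL p₂ n₂
  rw [← deriv_eq_posPart_add_negPart hf₁] at a₁ b₁
  rw [← deriv_eq_posPart_add_negPart hf₂] at a₂ b₂
  rw [a₁, a₂, b₁, b₂]
  unfold oneParticleMean
  ring

/-! ### The energy-momentum tensors -/

/-- `E` is the contribution of the particle, zero for the vacuum, so that both states are treated at
once. -/
theorem BoundedAcceleration.isNormalTensor_iff {x : ℝ → ℝ} (hx : BoundedAcceleration x)
    {Ψ : FockVector} {E : ℝ × ℝ → ℂ} (hE : Continuous E)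
    (hΨ : ∀ f₁ f₂, IsTest f₁ → IsTest f₂ → fockInner Ψ (normalProduct x f₁ f₂ Ψ)
      = twoPt x (_root_.deriv f₁) (_root_.deriv f₂) - twoPt id (_root_.deriv f₁) (_root_.deriv f₂)
        + ∫ p : ℝ × ℝ, E p * (f₁ p.1 * f₂ p.2))
    {t : ℝ → ℝ} (ht : ∀ y, E (y, y) = (t y : ℂ)) (T : ℝ → ℝ) :
    IsNormalTensor x Ψ T ↔ T = fun y => -(1 / (24 * Real.pi)) * schwarzian x y + t y := by
  obtain ⟨K, hKc, hKd, hK⟩ := exists_regular_kernel hx.1 hx.2.1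
  have hker : HasKernelOn univ (fun f₁ f₂ => fockInner Ψ (normalProduct x f₁ f₂ Ψ))
      (fun p => K p + E p) := by
    refine ⟨(hKc.add hE).continuousOn, fun f₁ f₂ hf₁ hf₂ hO => ?_⟩
    simp only
    rw [hΨ f₁ f₂ hf₁ hf₂, (hK f₁ f₂ hf₁ hf₂).1, ← integral_add
      (integrable_kernel_mul hKc.continuousOn hf₁.continuous hf₂.continuous hf₁.2 hf₂.2 hO)
      (integrable_kernel_mul hE.continuousOn hf₁.continuous hf₂.continuous hf₁.2 hf₂.2 hO)]
    simp_rw [add_mul]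
  constructor
  · rintro ⟨_, K', hK', hT⟩
    funext y
    have h := hT y
    rw [hK'.eqOn isOpen_univ hker (mem_univ (y, y))] at h
    simp only at h
    rw [hKd, ht] at h
    exact_mod_cast h
  · rintro rfl
    refine ⟨fun f hf => ⟨hx.fieldDefined_posPart hf, hx.fieldDefined_negPart hf⟩, _, hker,
      fun y => ?_⟩
    simp only
    rw [hKd, ht]
    push_cast
    ring

/-- Off the diagonal the kernel is the regular one plus the universal `S` plus `E`. As `S` depends
only on the separation, its values at (y, y + ε) and (x(y), x(y) + ε) agree and cancel before the
limit is taken. -/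
theorem isSubtractedTensor_iff {x : ℝ → ℝ} (hx : ContDiff ℝ ∞ x) (hp : ∀ y, 0 < deriv x y)
    {Ψ : FockVector} {E : ℝ × ℝ → ℂ} (hE : Continuous E)
    (hΨ : ∀ f₁ f₂, IsTest f₁ → IsTest f₂ → fockInner Ψ (symProduct x f₁ f₂ Ψ)
      = (twoPt x (deriv f₁) (deriv f₂) + twoPt x (deriv f₂) (deriv f₁)) / 2
        + ∫ p : ℝ × ℝ, E p * (f₁ p.1 * f₂ p.2))
    {t : ℝ → ℝ} (ht : ∀ y, E (y, y) = (t y : ℂ)) (T : ℝ → ℝ) :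
    IsSubtractedTensor x Ψ T ↔ T = fun y => -(1 / (24 * Real.pi)) * schwarzian x y + t y := by
  obtain ⟨K, hKc, hKd, hK⟩ := exists_regular_kernel hx hp
  let S : ℝ × ℝ → ℂ := fun p => (-(1 / (4 * Real.pi) / (p.1 - p.2) ^ 2 : ℝ) : ℂ)
  have hoff : IsOpen offDiag := isOpen_ne_fun continuous_fst continuous_snd
  have hS : ContinuousOn S offDiag := by
    refine (Complex.continuous_ofReal.comp_continuousOn
      (ContinuousOn.div continuousOn_const (by fun_prop) fun p hp => ?_)).neg
    exact pow_ne_zero 2 (sub_ne_zero.2 hp)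
  have hSswap : ∀ p : ℝ × ℝ, S p.swap = S p := fun p => by
    simp only [S, Prod.fst_swap, Prod.snd_swap, sub_sq_comm]
  -- Locality: the commutator vanishes when the supports do not meet, so symmetrization does not
  -- alter the kernel off the diagonal.
  have hsym : ∀ f₁ f₂, IsTest f₁ → IsTest f₂ → tsupport f₁ ×ˢ tsupport f₂ ⊆ offDiag →
      twoPt id (deriv f₂) (deriv f₁) = twoPt id (deriv f₁) (deriv f₂) := by
    intro f₁ f₂ hf₁ hf₂ hO
    have hO' : tsupport f₂ ×ˢ tsupport f₁ ⊆ offDiag := fun p hp =>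
      Ne.symm (hO (a := p.swap) ⟨hp.2, hp.1⟩)
    rw [twoPt_id_offDiag hf₁ hf₂ hO, twoPt_id_offDiag hf₂ hf₁ hO', integral_kernel_swap]
    exact integral_congr_ae (ae_of_all _ fun p => congrArg (· * _) (hSswap p))
  have hker : HasKernelOn offDiag (fun f₁ f₂ => fockInner Ψ (symProduct x f₁ f₂ Ψ))
      (fun p => K p + S p + E p) := by
    refine ⟨(hKc.continuousOn.add hS).add hE.continuousOn, fun f₁ f₂ hf₁ hf₂ hO => ?_⟩
    have i : ∀ {L : ℝ × ℝ → ℂ}, ContinuousOn L offDiag →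
        Integrable (fun p : ℝ × ℝ => L p * (f₁ p.1 * f₂ p.2)) := fun hL =>
      integrable_kernel_mul hL hf₁.continuous hf₂.continuous hf₁.2 hf₂.2 hO
    obtain ⟨h1, h2⟩ := hK f₁ f₂ hf₁ hf₂
    have h3 := hsym f₁ f₂ hf₁ hf₂ hO
    have h4 : twoPt id (deriv f₁) (deriv f₂) = ∫ p : ℝ × ℝ, S p * (f₁ p.1 * f₂ p.2) :=
      twoPt_id_offDiag hf₁ hf₂ hO
    simp only
    rw [hΨ f₁ f₂ hf₁ hf₂]
    simp_rw [add_mul]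
    rw [integral_add ((i hKc.continuousOn).fun_add (i hS)) (i hE.continuousOn),
      integral_add (i hKc.continuousOn) (i hS), ← h1, ← h4]
    linear_combination (-h2 + h3) / 2
  have hker₀ : HasKernelOn offDiag
      (fun f₁ f₂ => fockInner vacuum (symProduct id f₁ f₂ vacuum)) S := by
    refine ⟨hS, fun f₁ f₂ hf₁ hf₂ hO => ?_⟩
    simp only
    rw [vacuum_symProduct, hsym f₁ f₂ hf₁ hf₂ hO, add_self_div_two]
    exact twoPt_id_offDiag hf₁ hf₂ hO
  have hlim : ∀ y, Tendsto (fun ε : ℝ => (K (y, y + ε) + S (y, y + ε) + E (y, y + ε))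
      - S (x y, x y + ε)) (𝓝[≠] 0)
      (𝓝 ((-(1 / (24 * Real.pi)) * schwarzian x y + t y : ℝ) : ℂ)) := by
    intro y
    have hc : Continuous fun ε : ℝ => K (y, y + ε) + E (y, y + ε) := by fun_prop
    have h := (hc.tendsto 0).mono_left (nhdsWithin_le_nhds (s := {0}ᶜ))
    rw [add_zero, hKd, ht, ← Complex.ofReal_add] at h
    refine h.congr fun ε => ?_
    simp only [S, sub_add_cancel_left]
    ring
  constructor
  · rintro ⟨_, K', K₀', hK', hK₀', hT⟩
    funext y
    -- Kernels are determined at distinct points only, which is enough in a punctured neighbourhood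
    -- of zero.
    have e : ∀ᶠ ε in 𝓝[≠] (0 : ℝ), K' (y, y + ε) - K₀' (x y, x y + ε)
        = (K (y, y + ε) + S (y, y + ε) + E (y, y + ε)) - S (x y, x y + ε) := by
      filter_upwards [self_mem_nhdsWithin] with ε hε
      have hne : ∀ z : ℝ, (z, z + ε) ∈ offDiag := fun z => by
        have : ε ≠ 0 := hε
        simp [offDiag, this]
      rw [hK'.eqOn hoff hker (hne y), hK₀'.eqOn hoff hker₀ (hne (x y))]
    have := tendsto_nhds_unique ((hT y).congr' e) (hlim y)
    exact_mod_cast this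
  · rintro rfl
    exact ⟨fun f hf => ⟨fieldDefined_deriv hx hp hf, fieldDefined_deriv contDiff_id (by simp) hf⟩,
      _, S, hker, hker₀, hlim⟩

theorem isNormalTensor_vacuum_iff {x : ℝ → ℝ} (hx : BoundedAcceleration x) (T : ℝ → ℝ) :
    IsNormalTensor x vacuum T ↔ T = fun y => -(1 / (24 * Real.pi)) * schwarzian x y := by
  have h := hx.isNormalTensor_iff (Ψ := vacuum) (E := fun _ => 0) continuous_const
    (fun f₁ f₂ hf₁ hf₂ => by
      rw [vacuum_normalProduct, hx.twoPt_normal hf₁ hf₂]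
      simp) (t := fun _ => 0) (fun y => by simp) T
  simpa using h

theorem isNormalTensor_oneParticle_iff {x : ℝ → ℝ} (hx : BoundedAcceleration x) {g : 𝓢(ℝ, ℂ)}
    (hg : IsNormalizedTest g) (T : ℝ → ℝ) :
    IsNormalTensor x (oneParticle g) T ↔ T = fun y => -(1 / (24 * Real.pi)) * schwarzian x y
      + deriv x y ^ 2 * (‖g (x y)‖ ^ 2 / 2) :=
  hx.isNormalTensor_iff (continuous_particleKernel hx.1 g.continuous)
    (fun _ _ hf₁ hf₂ => hx.oneParticle_normal hg hf₁ hf₂) (particleKernel_diag x g) T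

theorem isSubtractedTensor_vacuum_iff {x : ℝ → ℝ} (hx : ContDiff ℝ ∞ x) (hp : ∀ y, 0 < deriv x y)
    (T : ℝ → ℝ) :
    IsSubtractedTensor x vacuum T ↔ T = fun y => -(1 / (24 * Real.pi)) * schwarzian x y := by
  have h := isSubtractedTensor_iff hx hp (Ψ := vacuum) (E := fun _ => 0) continuous_const
    (fun f₁ f₂ _ _ => by
      rw [vacuum_symProduct]
      simp) (t := fun _ => 0) (fun y => by simp) T
  simpa using h

theorem isSubtractedTensor_oneParticle_iff {x : ℝ → ℝ} (hx : ContDiff ℝ ∞ x)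
    (hp : ∀ y, 0 < deriv x y) {g : 𝓢(ℝ, ℂ)} (hg : IsNormalizedTest g) (T : ℝ → ℝ) :
    IsSubtractedTensor x (oneParticle g) T ↔ T = fun y => -(1 / (24 * Real.pi)) * schwarzian x y
      + deriv x y ^ 2 * (‖g (x y)‖ ^ 2 / 2) := by
  refine isSubtractedTensor_iff hx hp (continuous_particleKernel hx g.continuous)
    (fun f₁ f₂ hf₁ hf₂ => ?_) (particleKernel_diag x g) T
  rw [oneParticle_symProduct (memLp_hat hg) hg.2 (fieldDefined_deriv hx hp hf₁)
    (fieldDefined_deriv hx hp hf₂), ← emit_mul_absorb hx hg.1 hf₁ hf₂]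
  unfold oneParticleMean
  ring

theorem schwarzian_id (y : ℝ) : schwarzian id y = 0 := by
  have h : deriv (id : ℝ → ℝ) = fun _ => 1 := funext fun y => by simp
  simp [schwarzian, iteratedDeriv_succ, h]

end ScalarField

theorem mainTheorem10
    (x : ℝ → ℝ) (hx : ContDiff ℝ ∞ x) (hx_pos : ∀ y, 0 < deriv x y)
    (g : 𝓢(ℝ, ℂ)) (hg : IsNormalizedTest g) :
    -- regularization by normal ordering
    ((∃ C : ℝ, ∀ y, |iteratedDeriv 2 x y| ≤ C * deriv x y) →
      ∃ Tg Tgout Toout : ℝ → ℝ,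
        (∀ T, IsNormalTensor id (oneParticle g) T ↔ T = Tg) ∧
        (∀ T, IsNormalTensor x (oneParticle g) T ↔ T = Tgout) ∧
        (∀ T, IsNormalTensor x vacuum T ↔ T = Toout) ∧
        (∀ ξ, Tg ξ = ‖g ξ‖ ^ 2 / 2) ∧
        (∀ y, Toout y = -(1 / (24 * Real.pi)) * schwarzian x y) ∧
        (∀ y, Tgout y = Toout y + deriv x y ^ 2 * Tg (x y))) ∧
    -- regularization by subtraction
    (∃ Tg Tgout Toout : ℝ → ℝ,
        (∀ T, IsSubtractedTensor id (oneParticle g) T ↔ T = Tg) ∧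
        (∀ T, IsSubtractedTensor x (oneParticle g) T ↔ T = Tgout) ∧
        (∀ T, IsSubtractedTensor x vacuum T ↔ T = Toout) ∧
        (∀ ξ, Tg ξ = ‖g ξ‖ ^ 2 / 2) ∧
        (∀ y, Toout y = -(1 / (24 * Real.pi)) * schwarzian x y) ∧
        (∀ y, Tgout y = Toout y + deriv x y ^ 2 * Tg (x y))) := by
  have hid : ∀ y : ℝ, 0 < deriv id y := fun y => by simp
  have hTg : (fun y => -(1 / (24 * Real.pi)) * schwarzian id y
      + deriv id y ^ 2 * (‖g (id y)‖ ^ 2 / 2)) = fun y => ‖g y‖ ^ 2 / 2 := by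
    funext y
    simp [schwarzian_id]
  refine ⟨fun ⟨C, hC⟩ => ?_, ?_⟩
  · have hacc : BoundedAcceleration x := by
      -- `BoundedAcceleration` asks for a nonnegative constant.
      refine ⟨hx, hx_pos, |C|, abs_nonneg C, fun y => ?_⟩
      have h := hC y
      rw [iteratedDeriv_succ, iteratedDeriv_one] at h
      exact h.trans (mul_le_mul_of_nonneg_right (le_abs_self C) (hx_pos y).le)
    -- The tensors are read off by unification from the equivalences; the transformation law then
    -- holds by definition.
    exact ⟨_, _, _, fun T => hTg ▸ isNormalTensor_oneParticle_iff boundedAcceleration_id hg T,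
      isNormalTensor_oneParticle_iff hacc hg, isNormalTensor_vacuum_iff hacc, fun _ => rfl,
      fun _ => rfl, fun _ => rfl⟩
  · exact ⟨_, _, _, fun T => hTg ▸ isSubtractedTensor_oneParticle_iff contDiff_id hid hg T,
      isSubtractedTensor_oneParticle_iff hx hx_pos hg, isSubtractedTensor_vacuum_iff hx hx_pos,
      fun _ => rfl, fun _ => rfl, fun _ => rfl⟩
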